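/- Let $G$ be a finite group and $\mathbb{F}$ an algebraically closed field. For a ring $A$ with $G$-action let $\mathrm{FP}(A)$ be the fixed-point $G$-Tambara functor, with $\mathrm{FP}(A)(G/H)=A^H$ (more generally $\mathrm{FP}(A)(X)=\mathrm{Map}_G(X,A)$, with restrictions given by composition, and transfers and norms given by sums and products over fibres), and let $\underline{\mathbb{F}}=\mathrm{FP}(\mathbb{F})$, for the trivial action, be the constant Tambara functor. Let $k$ be a $G$-Tambara functor. A $k$-algebra $R$ is a Tambara functor with a map $k\to R$; it is *finite* if it is finitely generated as a $k$-module, and *étale* if it is finitely presented as a $k$-algebra, flat (the functor $R\boxtimes_k-$ on $k$-modules is exact), and has vanishing genuine Kähler differentials: $\Omega^{1,\mathrm{Tamb}}_{R/k}=I/I^{>1}=0$, where $I=\ker(R\boxtimes_k R\to R)$ and $I^{>1}$ is the ideal generated by the products of two elements of $I$ and by the norms of elements of $I$ along non-injective maps of orbits $G/K\to G/H$. A *finite affine étale group scheme over $k$* is a representable functor $\mathrm{Hom}_{k\text{-}\mathrm{Alg}}(R,-):k\text{-}\mathrm{Alg}\to\mathsf{Grp}$ with $R$ finite and étale over $k$;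 with the natural transformations as morphisms these form a category $\mathsf{Grp}^{\mathrm{f\acute{e}t\text{-}aff}}_k$. Let $\mathsf{Grp}^{\mathrm{f\acute{e}t\text{-}aff}}_{\mathbb{F}}$ be the category of finite affine étale group schemes over $\mathbb{F}$ in the usual sense, and $(\mathsf{Grp}^{\mathrm{f\acute{e}t\text{-}aff}}_{\mathbb{F}})^{BG}$ the category of its objects equipped with an action of $G$, with $G$-equivariant morphisms. If $R$ represents a finite affine étale group scheme over $\underline{\mathbb{F}}$, then the $\mathbb{F}$-algebra $R(G/e)$, with the group structure on $\mathrm{Hom}_{\mathbb{F}}(R(G/e),S)\cong\mathrm{Hom}_{\underline{\mathbb{F}}}(R,\mathrm{CoInd}_e^G S)$ and the Weyl action of $G$, represents a finite affine étale group scheme over $\mathbb{F}$ with $G$-action. The resulting functor $$\mathrm{ev}_{G/e}:\mathsf{Grp}^{\mathrm{f\acute{e}t\text{-}aff}}_{\underline{\mathbb{F}}}\longrightarrow(\mathsf{Grp}^{\mathrm{f\acute{e}t\text{-}aff}}_{\mathbb{F}})^{BG}$$ is an equivalence of categories, with inverse induced by $\mathrm{FP}$: there is an inverse functor $J$ such that,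 naturally in the group scheme $\mathcal{A}$ with $G$-action, represented by the $\mathbb{F}$-algebra $A$ with $G$-action, the group scheme $J(\mathcal{A})$ is represented by $\mathrm{FP}(A)$, in such a way that the isomorphism $\mathrm{ev}_{G/e}J(\mathcal{A})\cong\mathcal{A}$ is represented by the canonical isomorphism $\mathrm{FP}(A)(G/e)\cong A$. -/

import Mathlib

universe u

namespace Tamb

open CategoryTheory

/-! ### Finite `G`-sets, pullbacks and exponential diagrams -/

/-- A finite `G`-set. -/
structure FinGSet (G : Type u) [Group G] where
  /-- The underlying set. -/
  carrier : Type u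
  [action : MulAction G carrier]
  [finite : Finite carrier]

attribute [instance] FinGSet.action FinGSet.finite

instance (G : Type u) [Group G] : CoeSort (FinGSet G) (Type u) := ⟨FinGSet.carrier⟩

section GSets

variable {G : Type u} [Group G]

/-- The square `W → X → Z`, `W → Y → Z` of finite `G`-sets is a pullback square. -/
def IsPullbackSq {W X Y Z : FinGSet G} (p : W →[G] X) (q : W →[G] Y)
    (f : X →[G] Z) (g : Y →[G] Z) : Prop :=
  (∀ w, f (p w) = g (q w)) ∧ ∀ x y, f x = g y → ∃! w, p w = x ∧ q w = y

/-- The exponential diagram of `A --q--> X --p--> Y`: it consists of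
`e : E → A`, `p' : E → P` and `q' : P → Y`, where `P → Y` is the dependent product of `q` along `p`
(the fibre of `P` over `y` is the set of sections of `q` over the fibre `p⁻¹(y)`),
`E = X ×_Y P`, and `e` is the evaluation map. -/
structure IsExponentialDiagram {A X Y E P : FinGSet G} (q : A →[G] X) (p : X →[G] Y)
    (e : E →[G] A) (p' : E →[G] P) (q' : P →[G] Y) : Prop where
  isPullback : IsPullbackSq (q.comp e) p' p q'
  sections : ∀ (y : Y) (s : {x : X // p x = y} → A), (∀ x, q (s x) = x.1) →
    ∃! t : P, q' t = y ∧ ∀ x, ∃ w : E, p' w = t ∧ e w = s x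

end GSets

/-! ### Tambara functors -/

/-- A `G`-Tambara functor: commutative rings indexed by finite `G`-sets, with restrictions,
transfers and norms.  Restrictions and transfers form a Green functor, restrictions and norms form a
multiplicative semi-Mackey functor, and transfers and norms are related by the distributive law
for exponential diagrams. -/
structure TambaraFunctor (G : Type u) [Group G] where
  /-- The value at a finite `G`-set. -/
  obj : FinGSet G → Type u
  [ring : ∀ X, CommRing (obj X)]
  /-- Restriction. -/
  res : ∀ {X Y : FinGSet G}, (X →[G] Y) → obj Y →+* obj X
  /-- Transfer. -/
  tr : ∀ {X Y : FinGSet G}, (X →[G] Y) → obj X →+ obj Y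
  /-- Norm. -/
  nm : ∀ {X Y : FinGSet G}, (X →[G] Y) → obj X →* obj Y
  res_id : ∀ {X : FinGSet G} (a : obj X), res (MulActionHom.id G) a = a
  res_comp : ∀ {X Y Z : FinGSet G} (g : Y →[G] Z) (f : X →[G] Y) (a : obj Z),
    res (g.comp f) a = res f (res g a)
  tr_id : ∀ {X : FinGSet G} (a : obj X), tr (MulActionHom.id G) a = a
  tr_comp : ∀ {X Y Z : FinGSet G} (g : Y →[G] Z) (f : X →[G] Y) (a : obj X),
    tr (g.comp f) a = tr g (tr f a)
  nm_id : ∀ {X : FinGSet G} (a : obj X), nm (MulActionHom.id G) a = a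
  nm_comp : ∀ {X Y Z : FinGSet G} (g : Y →[G] Z) (f : X →[G] Y) (a : obj X),
    nm (g.comp f) a = nm g (nm f a)
  /-- Finite disjoint unions are taken to products. -/
  additive : ∀ {J : Type u} [Finite J] {X : J → FinGSet G} {Y : FinGSet G}
    (i : ∀ j, X j →[G] Y), (∀ y, ∃! x : Σ j, X j, i x.1 x.2 = y) →
    Function.Bijective (fun (a : obj Y) (j : J) => res (i j) a)
  res_tr : ∀ {W X Y Z : FinGSet G} {p : W →[G] X} {q : W →[G] Y} {f : X →[G] Z} {g : Y →[G] Z},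
    IsPullbackSq p q f g → ∀ a, res g (tr f a) = tr q (res p a)
  res_nm : ∀ {W X Y Z : FinGSet G} {p : W →[G] X} {q : W →[G] Y} {f : X →[G] Z} {g : Y →[G] Z},
    IsPullbackSq p q f g → ∀ a, res g (nm f a) = nm q (res p a)
  /-- Frobenius reciprocity. -/
  frobenius : ∀ {X Y : FinGSet G} (f : X →[G] Y) (a : obj X) (b : obj Y),
    tr f (a * res f b) = tr f a * b
  /-- The distributive law. -/
  nm_tr : ∀ {A X Y E P : FinGSet G} {q : A →[G] X} {p : X →[G] Y}
    {e : E →[G] A} {p' : E →[G] P} {q' : P →[G] Y},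
    IsExponentialDiagram q p e p' q' → ∀ a, nm p (tr q a) = tr q' (nm p' (res e a))

attribute [instance] TambaraFunctor.ring

namespace TambaraFunctor

variable {G : Type u} [Group G]

/-- A morphism of Tambara functors. -/
@[ext]
structure Hom (R S : TambaraFunctor G) where
  /-- The component at a finite `G`-set. -/
  app : ∀ X, R.obj X →+* S.obj X
  res : ∀ {X Y : FinGSet G} (f : X →[G] Y) (a : R.obj Y), app X (R.res f a) = S.res f (app Y a)
  tr : ∀ {X Y : FinGSet G} (f : X →[G] Y) (a : R.obj X), app Y (R.tr f a) = S.tr f (app X a)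
  nm : ∀ {X Y : FinGSet G} (f : X →[G] Y) (a : R.obj X), app Y (R.nm f a) = S.nm f (app X a)

instance : Category (TambaraFunctor G) where
  Hom := Hom
  id R := ⟨fun _ => RingHom.id _, fun _ _ => rfl, fun _ _ => rfl, fun _ _ => rfl⟩
  comp f g := ⟨fun X => (g.app X).comp (f.app X),
    fun h a => by simp [f.res, g.res], fun h a => by simp [f.tr, g.tr],
    fun h a => by simp [f.nm, g.nm]⟩

@[ext]
theorem hom_ext {R S : TambaraFunctor G} {f g : R ⟶ S} (h : ∀ X a, f.app X a = g.app X a) :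
    f = g :=
  Hom.ext (funext fun X => RingHom.ext (h X))

@[simp] theorem id_app (R : TambaraFunctor G) (X : FinGSet G) (a : R.obj X) :
    Hom.app (𝟙 R) X a = a := rfl

@[simp] theorem comp_app {R S T : TambaraFunctor G} (f : R ⟶ S) (g : S ⟶ T) (X : FinGSet G)
    (a : R.obj X) : Hom.app (f ≫ g) X a = g.app X (f.app X a) := rfl

end TambaraFunctor

/-- Algebras over a Tambara functor `k`. -/
abbrev TAlg {G : Type u} [Group G] (k : TambaraFunctor G) := Under k

/-! ### Modules -/

/-- A module over (the underlying Green functor of) a Tambara functor. -/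
structure TModule {G : Type u} [Group G] (k : TambaraFunctor G) where
  /-- The value at a finite `G`-set. -/
  obj : FinGSet G → Type u
  [addCommGroup : ∀ X, AddCommGroup (obj X)]
  [module : ∀ X, Module (k.obj X) (obj X)]
  /-- Restriction. -/
  res : ∀ {X Y : FinGSet G}, (X →[G] Y) → obj Y →+ obj X
  /-- Transfer. -/
  tr : ∀ {X Y : FinGSet G}, (X →[G] Y) → obj X →+ obj Y
  res_id : ∀ {X : FinGSet G} (a : obj X), res (MulActionHom.id G) a = a
  res_comp : ∀ {X Y Z : FinGSet G} (g : Y →[G] Z) (f : X →[G] Y) (a : obj Z),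
    res (g.comp f) a = res f (res g a)
  tr_id : ∀ {X : FinGSet G} (a : obj X), tr (MulActionHom.id G) a = a
  tr_comp : ∀ {X Y Z : FinGSet G} (g : Y →[G] Z) (f : X →[G] Y) (a : obj X),
    tr (g.comp f) a = tr g (tr f a)
  /-- Finite disjoint unions are taken to products. -/
  additive : ∀ {J : Type u} [Finite J] {X : J → FinGSet G} {Y : FinGSet G}
    (i : ∀ j, X j →[G] Y), (∀ y, ∃! x : Σ j, X j, i x.1 x.2 = y) →
    Function.Bijective (fun (a : obj Y) (j : J) => res (i j) a)
  res_tr : ∀ {W X Y Z : FinGSet G} {p : W →[G] X} {q : W →[G] Y} {f : X →[G] Z} {g : Y →[G] Z},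
    IsPullbackSq p q f g → ∀ a, res g (tr f a) = tr q (res p a)
  res_smul : ∀ {X Y : FinGSet G} (f : X →[G] Y) (c : k.obj Y) (a : obj Y),
    res f (c • a) = k.res f c • res f a
  tr_smul_res : ∀ {X Y : FinGSet G} (f : X →[G] Y) (c : k.obj X) (a : obj Y),
    tr f (c • res f a) = k.tr f c • a
  tr_res_smul : ∀ {X Y : FinGSet G} (f : X →[G] Y) (c : k.obj Y) (a : obj X),
    tr f (k.res f c • a) = c • tr f a

attribute [instance] TModule.addCommGroup TModule.module

namespace TModule

variable {G : Type u} [Group G] {k : TambaraFunctor G}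

/-- A morphism of modules over a Tambara functor. -/
structure Hom (M N : TModule k) where
  /-- The component at a finite `G`-set. -/
  app : ∀ X, M.obj X →ₗ[k.obj X] N.obj X
  res : ∀ {X Y : FinGSet G} (f : X →[G] Y) (a : M.obj Y), app X (M.res f a) = N.res f (app Y a)
  tr : ∀ {X Y : FinGSet G} (f : X →[G] Y) (a : M.obj X), app Y (M.tr f a) = N.tr f (app X a)

/-- A sequence `0 → L → M → N → 0` of modules is short exact (exactness is levelwise). -/
structure ShortExact {L M N : TModule k} (f : Hom L M) (g : Hom M N) : Prop where
  injective : ∀ X, Function.Injective (f.app X)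
  exact : ∀ X, Function.Exact (f.app X) (g.app X)
  surjective : ∀ X, Function.Surjective (g.app X)

/-- The elements of the submodule generated by the elements `m j` in levels `X j`. -/
inductive InSpan (M : TModule k) {J : Type} {X : J → FinGSet G} (m : ∀ j, M.obj (X j)) :
    ∀ Y : FinGSet G, M.obj Y → Prop
  | gen (j : J) : InSpan M m (X j) (m j)
  | zero (Y : FinGSet G) : InSpan M m Y 0
  | add {Y : FinGSet G} {a b : M.obj Y} : InSpan M m Y a → InSpan M m Y b → InSpan M m Y (a + b)
  | smul {Y : FinGSet G} (c : k.obj Y) {a : M.obj Y} : InSpan M m Y a → InSpan M m Y (c • a)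
  | res {Y Z : FinGSet G} (f : Y →[G] Z) {a : M.obj Z} :
      InSpan M m Z a → InSpan M m Y (M.res f a)
  | tr {Y Z : FinGSet G} (f : Y →[G] Z) {a : M.obj Y} :
      InSpan M m Y a → InSpan M m Z (M.tr f a)

/-- Finitely generated modules. -/
def FinitelyGenerated (M : TModule k) : Prop :=
  ∃ (n : ℕ) (X : Fin n → FinGSet G) (m : ∀ j, M.obj (X j)), ∀ Y a, InSpan M m Y a

/-! #### The relative box product

At a level `X`, the group `(M ⊠_k N)(X)` is generated by symbols `[f, m, n]` for `f : Y → X`,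
`m ∈ M(Y)` and `n ∈ N(Y)` (standing for the transfer of `m ⊗ n` along `f`), subject to
bilinearity over `k(Y)` and Frobenius reciprocity. -/

/-- The symbols generating `(M ⊠_k N)(X)`. -/
structure BoxGen (M N : TModule k) (X : FinGSet G) where
  /-- The source of the structure map. -/
  src : FinGSet G
  /-- The structure map. -/
  map : src →[G] X
  /-- The left component. -/
  left : M.obj src
  /-- The right component. -/
  right : N.obj src

/-- The symbol `[f, m, n]`. -/
def sym {M N : TModule k} {X Y : FinGSet G} (f : Y →[G] X) (m : M.obj Y) (n : N.obj Y) :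
    FreeAbelianGroup (BoxGen M N X) :=
  FreeAbelianGroup.of ⟨Y, f, m, n⟩

/-- The relations defining `(M ⊠_k N)(X)`. -/
inductive BoxRel (M N : TModule k) (X : FinGSet G) : FreeAbelianGroup (BoxGen M N X) → Prop
  | add_left {Y : FinGSet G} (f : Y →[G] X) (m m' : M.obj Y) (n : N.obj Y) :
      BoxRel M N X (sym f (m + m') n - (sym f m n + sym f m' n))
  | add_right {Y : FinGSet G} (f : Y →[G] X) (m : M.obj Y) (n n' : N.obj Y) :
      BoxRel M N X (sym f m (n + n') - (sym f m n + sym f m n'))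
  | smul {Y : FinGSet G} (f : Y →[G] X) (c : k.obj Y) (m : M.obj Y) (n : N.obj Y) :
      BoxRel M N X (sym f (c • m) n - sym f m (c • n))
  | tr_left {Y Z : FinGSet G} (f : Y →[G] X) (g : Z →[G] Y) (m : M.obj Z) (n : N.obj Y) :
      BoxRel M N X (sym f (M.tr g m) n - sym (f.comp g) m (N.res g n))
  | tr_right {Y Z : FinGSet G} (f : Y →[G] X) (g : Z →[G] Y) (m : M.obj Y) (n : N.obj Z) :
      BoxRel M N X (sym f m (N.tr g n) - sym (f.comp g) (M.res g m) n)

/-- The subgroup of relations. -/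
def boxRel (M N : TModule k) (X : FinGSet G) : AddSubgroup (FreeAbelianGroup (BoxGen M N X)) :=
  AddSubgroup.closure {r | BoxRel M N X r}

/-- The value `(M ⊠_k N)(X)` of the box product. -/
abbrev Box (M N : TModule k) (X : FinGSet G) : Type (u + 1) :=
  FreeAbelianGroup (BoxGen M N X) ⧸ boxRel M N X

/-- The map of symbols induced by a module morphism `N → N'`. -/
def symMap (M : TModule k) {N N' : TModule k} (φ : Hom N N') (X : FinGSet G) :
    FreeAbelianGroup (BoxGen M N X) →+ FreeAbelianGroup (BoxGen M N' X) :=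
  FreeAbelianGroup.lift fun s => sym s.map s.left (φ.app s.src s.right)

theorem symMap_sym (M : TModule k) {N N' : TModule k} (φ : Hom N N') {X Y : FinGSet G}
    (f : Y →[G] X) (m : M.obj Y) (n : N.obj Y) :
    symMap M φ X (sym f m n) = sym f m (φ.app Y n) := by
  simp [symMap, sym]

theorem boxRel_le_comap (M : TModule k) {N N' : TModule k} (φ : Hom N N') (X : FinGSet G) :
    boxRel M N X ≤ (boxRel M N' X).comap (symMap M φ X) := by
  rw [boxRel, AddSubgroup.closure_le]
  rintro _ h
  refine AddSubgroup.subset_closure ?_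
  cases h with
  | add_left f m m' n => simpa [symMap_sym] using BoxRel.add_left f m m' (φ.app _ n)
  | add_right f m n n' => simpa [symMap_sym] using BoxRel.add_right f m (φ.app _ n) (φ.app _ n')
  | smul f c m n => simpa [symMap_sym] using BoxRel.smul f c m (φ.app _ n)
  | tr_left f g m n =>
    simpa [symMap_sym, φ.res] using BoxRel.tr_left f g m (φ.app _ n)
  | tr_right f g m n =>
    simpa [symMap_sym, φ.tr] using BoxRel.tr_right f g m (φ.app _ n)

/-- The map `(M ⊠_k N)(X) → (M ⊠_k N')(X)` induced by a module morphism `N → N'`. -/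
def boxMap (M : TModule k) {N N' : TModule k} (φ : Hom N N') (X : FinGSet G) :
    Box M N X →+ Box M N' X :=
  QuotientAddGroup.map _ _ (symMap M φ X) (boxRel_le_comap M φ X)

/-- Flat modules: the functor `M ⊠_k -` is exact. -/
def Flat (M : TModule k) : Prop :=
  ∀ (N₁ N₂ N₃ : TModule k) (f : Hom N₁ N₂) (g : Hom N₂ N₃), ShortExact f g → ∀ X : FinGSet G,
    Function.Injective (boxMap M f X) ∧ Function.Exact (boxMap M f X) (boxMap M g X) ∧
      Function.Surjective (boxMap M g X)

end TModule

/-! ### Finite and étale algebras over a Tambara functor -/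

namespace TAlg

variable {G : Type u} [Group G] {k : TambaraFunctor G}

/-- The ring `R(X)` of a `k`-algebra `R`. -/
abbrev lvl (R : TAlg k) (X : FinGSet G) : Type u := R.right.obj X

/-- The `k`-module underlying a `k`-algebra. -/
def toModule (R : TAlg k) : TModule k where
  obj := R.right.obj
  module X := (R.hom.app X).toModule
  res f := (R.right.res f).toAddMonoidHom
  tr f := R.right.tr f
  res_id := R.right.res_id
  res_comp := R.right.res_comp
  tr_id := R.right.tr_id
  tr_comp := R.right.tr_comp
  additive := R.right.additive
  res_tr := R.right.res_tr
  res_smul {X Y} f c a := by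
    change R.right.res f (R.hom.app Y c * a) = R.hom.app X (k.res f c) * R.right.res f a
    rw [map_mul, R.hom.res]
  tr_smul_res {X Y} f c a := by
    change R.right.tr f (R.hom.app X c * R.right.res f a) = R.hom.app Y (k.tr f c) * a
    rw [R.right.frobenius, R.hom.tr]
  tr_res_smul {X Y} f c a := by
    change R.right.tr f (R.hom.app X (k.res f c) * a) = R.hom.app Y c * R.right.tr f a
    rw [R.hom.res, mul_comm, mul_comm (R.hom.app Y c)]; exact R.right.frobenius f a _

/-- A `k`-algebra is finite if it is finitely generated as a `k`-module. -/
def IsFinite (R : TAlg k) : Prop := R.toModule.FinitelyGenerated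

/-- A `k`-algebra is flat if it is flat as a `k`-module. -/
def IsFlat (R : TAlg k) : Prop := R.toModule.Flat

/-- Tambara polynomials over `k` in variables `x j` of levels `X j`. -/
inductive Poly (k : TambaraFunctor G) {J : Type} (X : J → FinGSet G) : FinGSet G → Type (u + 1)
  | var (j : J) : Poly k X (X j)
  | const {Y : FinGSet G} (c : k.obj Y) : Poly k X Y
  | add {Y : FinGSet G} (a b : Poly k X Y) : Poly k X Y
  | mul {Y : FinGSet G} (a b : Poly k X Y) : Poly k X Y
  | res {Y Z : FinGSet G} (f : Y →[G] Z) (a : Poly k X Z) : Poly k X Y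
  | tr {Y Z : FinGSet G} (f : Y →[G] Z) (a : Poly k X Y) : Poly k X Z
  | nm {Y Z : FinGSet G} (f : Y →[G] Z) (a : Poly k X Y) : Poly k X Z

/-- The value of a Tambara polynomial at elements `s j` of a `k`-algebra `S`. -/
def Poly.eval (S : TAlg k) {J : Type} {X : J → FinGSet G} (s : ∀ j, S.right.obj (X j)) :
    ∀ {Y : FinGSet G}, Poly k X Y → S.right.obj Y
  | _, .var j => s j
  | _, .const c => S.hom.app _ c
  | _, .add a b => a.eval S s + b.eval S s
  | _, .mul a b => a.eval S s * b.eval S s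
  | _, .res f a => S.right.res f (a.eval S s)
  | _, .tr f a => S.right.tr f (a.eval S s)
  | _, .nm f a => S.right.nm f (a.eval S s)

/-- A `k`-algebra `R` is finitely presented if it is presented by finitely many generators `r j` in
levels `X j`, subject to finitely many relations `p i = q i` in levels `Y i`.

The Tambara polynomials in `X`, modulo the identities valid in all `k`-algebras, are the
elements of the free polynomial `k`-algebra on `X`, and a map from the free polynomial algebra
on `Y` is the choice of elements in the levels `Y i`.  So this says
that `R` is the coequalizer of a pair of maps between free polynomial `k`-algebras on finitely many
generators. -/
def IsFinitelyPresented (R : TAlg k) : Prop :=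
  ∃ (n : ℕ) (X : Fin n → FinGSet G) (r : ∀ j, R.right.obj (X j))
    (m : ℕ) (Y : Fin m → FinGSet G) (p q : ∀ i, Poly k X (Y i)),
    (∀ i, (p i).eval R r = (q i).eval R r) ∧
    ∀ (S : TAlg k) (s : ∀ j, S.right.obj (X j)), (∀ i, (p i).eval S s = (q i).eval S s) →
      ∃! φ : R ⟶ S, ∀ j, φ.right.app (X j) (r j) = s j

/-- For `k`-algebra maps `i₁ : R → P` and `i₂ : S → P`, the map `(R ⊠_k S)(X) → P(X)` which takes
`[f, a, b]` to `tr_f (i₁ a * i₂ b)`, on the level of symbols. -/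
def boxSymDesc {R S P : TAlg k} (i₁ : R ⟶ P) (i₂ : S ⟶ P) (X : FinGSet G) :
    FreeAbelianGroup (TModule.BoxGen R.toModule S.toModule X) →+ P.right.obj X :=
  FreeAbelianGroup.lift fun s =>
    P.right.tr s.map (i₁.right.app s.src s.left * i₂.right.app s.src s.right)

theorem boxSymDesc_sym {R S P : TAlg k} (i₁ : R ⟶ P) (i₂ : S ⟶ P) {X Y : FinGSet G}
    (f : Y →[G] X) (a : R.right.obj Y) (b : S.right.obj Y) :
    boxSymDesc i₁ i₂ X (TModule.sym (M := R.toModule) (N := S.toModule) f a b) =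
      P.right.tr f (i₁.right.app Y a * i₂.right.app Y b) := by
  simp [boxSymDesc, TModule.sym]

theorem hom_app_const {R P : TAlg k} (i : R ⟶ P) (X : FinGSet G) (c : k.obj X) :
    i.right.app X (R.hom.app X c) = P.hom.app X c := by
  rw [← Under.w i]; rfl

theorem boxRel_le_ker {R S P : TAlg k} (i₁ : R ⟶ P) (i₂ : S ⟶ P) (X : FinGSet G) :
    TModule.boxRel R.toModule S.toModule X ≤ (boxSymDesc i₁ i₂ X).ker := by
  have smul_aux : ∀ {Y : FinGSet G} (f : Y →[G] X) (c : k.obj Y) (m : R.right.obj Y)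
      (n : S.right.obj Y),
      P.right.tr f (i₁.right.app Y (R.hom.app Y c * m) * i₂.right.app Y n) =
        P.right.tr f (i₁.right.app Y m * i₂.right.app Y (S.hom.app Y c * n)) := by
    intro Y f c m n
    rw [map_mul (i₁.right.app Y), map_mul (i₂.right.app Y), hom_app_const, hom_app_const]
    congr 1
    ring
  have tr_left_aux : ∀ {Y Z : FinGSet G} (f : Y →[G] X) (g : Z →[G] Y) (m : R.right.obj Z)
      (n : S.right.obj Y),
      P.right.tr f (i₁.right.app Y (R.right.tr g m) * i₂.right.app Y n) =
        P.right.tr (f.comp g) (i₁.right.app Z m * i₂.right.app Z (S.right.res g n)) := by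
    intro Y Z f g m n
    rw [i₁.right.tr, i₂.right.res, P.right.tr_comp, P.right.frobenius]
  have tr_right_aux : ∀ {Y Z : FinGSet G} (f : Y →[G] X) (g : Z →[G] Y) (m : R.right.obj Y)
      (n : S.right.obj Z),
      P.right.tr f (i₁.right.app Y m * i₂.right.app Y (S.right.tr g n)) =
        P.right.tr (f.comp g) (i₁.right.app Z (R.right.res g m) * i₂.right.app Z n) := by
    intro Y Z f g m n
    rw [i₂.right.tr, i₁.right.res, P.right.tr_comp, mul_comm (P.right.res g _),
      P.right.frobenius, mul_comm]
  rw [TModule.boxRel, AddSubgroup.closure_le]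
  rintro _ h
  rw [SetLike.mem_coe, AddMonoidHom.mem_ker]
  cases h with
  | add_left f m m' n =>
    rw [map_sub, map_add, sub_eq_zero]
    erw [boxSymDesc_sym, boxSymDesc_sym, boxSymDesc_sym]
    erw [map_add]
    rw [add_mul, map_add]
  | add_right f m n n' =>
    rw [map_sub, map_add, sub_eq_zero]
    erw [boxSymDesc_sym, boxSymDesc_sym, boxSymDesc_sym]
    erw [map_add]
    rw [mul_add, map_add]
  | smul f c m n =>
    rw [map_sub, sub_eq_zero]
    erw [boxSymDesc_sym, boxSymDesc_sym]
    exact smul_aux f c m n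
  | tr_left f g m n =>
    rw [map_sub, sub_eq_zero]
    erw [boxSymDesc_sym, boxSymDesc_sym]
    exact tr_left_aux f g m n
  | tr_right f g m n =>
    rw [map_sub, sub_eq_zero]
    erw [boxSymDesc_sym, boxSymDesc_sym]
    exact tr_right_aux f g m n

/-- The map `(R ⊠_k S)(X) → P(X)`, `[f, a, b] ↦ tr_f (i₁ a * i₂ b)`, for
`k`-algebra maps `i₁ : R → P` and `i₂ : S → P`. -/
def boxDesc {R S P : TAlg k} (i₁ : R ⟶ P) (i₂ : S ⟶ P) (X : FinGSet G) :
    TModule.Box R.toModule S.toModule X →+ P.right.obj X :=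
  QuotientAddGroup.lift _ (boxSymDesc i₁ i₂ X) (boxRel_le_ker i₁ i₂ X)

/-- The `k`-algebra `R ⊠_k R`, i.e. the box product `R ⊠_k R` with the Tambara functor structure
for which the coprojections `i₁, i₂ : R → R ⊠_k R` are maps of `k`-algebras
and `[f, a, b] = tr_f (i₁ a * i₂ b)`, together with the
multiplication map `R ⊠_k R → R`.  It is unique up to a unique isomorphism. -/
structure BoxSquare (R : TAlg k) where
  /-- The `k`-algebra `R ⊠_k R`. -/
  alg : TAlg k
  /-- The first coprojection. -/
  inl : R ⟶ alg
  /-- The second coprojection. -/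
  inr : R ⟶ alg
  bijective : ∀ X, Function.Bijective (boxDesc inl inr X)
  /-- The multiplication map. -/
  mul : alg ⟶ R
  inl_mul : inl ≫ mul = 𝟙 R
  inr_mul : inr ≫ mul = 𝟙 R

/-- The kernel of a map of `k`-algebras. -/
def ker {R S : TAlg k} (φ : R ⟶ S) (X : FinGSet G) : Ideal (R.right.obj X) :=
  RingHom.ker (φ.right.app X)

/-- Elements of the ideal `I^{>1}` of the Tambara functor `P` generated by all products of two
elements of `I` and all norms of elements of `I` along non-injective maps `G/K → G/H` of orbits. -/
inductive InPowGTOne (P : TambaraFunctor G) (I : ∀ X, Ideal (P.obj X)) :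
    ∀ X : FinGSet G, P.obj X → Prop
  | prod {X : FinGSet G} {a b : P.obj X} : a ∈ I X → b ∈ I X → InPowGTOne P I X (a * b)
  | norm {X Y : FinGSet G} (f : X →[G] Y) {a : P.obj X} : MulAction.IsPretransitive G X →
      Nonempty X → MulAction.IsPretransitive G Y → ¬ Function.Injective f → a ∈ I X →
      InPowGTOne P I Y (P.nm f a)
  | zero (X : FinGSet G) : InPowGTOne P I X 0
  | add {X : FinGSet G} {a b : P.obj X} :
      InPowGTOne P I X a → InPowGTOne P I X b → InPowGTOne P I X (a + b)
  | mul {X : FinGSet G} (c : P.obj X) {a : P.obj X} :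
      InPowGTOne P I X a → InPowGTOne P I X (c * a)
  | res {X Y : FinGSet G} (f : X →[G] Y) {a : P.obj Y} :
      InPowGTOne P I Y a → InPowGTOne P I X (P.res f a)
  | tr {X Y : FinGSet G} (f : X →[G] Y) {a : P.obj X} :
      InPowGTOne P I X a → InPowGTOne P I Y (P.tr f a)

/-- The ideal `I^{>1}`. -/
def powGTOne (P : TambaraFunctor G) (I : ∀ X, Ideal (P.obj X)) (X : FinGSet G) :
    Ideal (P.obj X) where
  carrier := {a | InPowGTOne P I X a}
  add_mem' := InPowGTOne.add
  zero_mem' := InPowGTOne.zero X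
  smul_mem' c _ := InPowGTOne.mul c

/-- The value at `X` of the genuine Kähler differentials `I / I^{>1}`, where `I` is the kernel
of `R ⊠_k R → R`. -/
abbrev Kaehler {R : TAlg k} (B : BoxSquare R) (X : FinGSet G) : Type u :=
  ker B.mul X ⧸
    Submodule.comap (Submodule.subtype (ker B.mul X)) (powGTOne B.alg.right (ker B.mul) X)

/-- A `k`-algebra is formally étale if it is flat over `k` and its genuine Kähler differentials
vanish. -/
def IsFormallyEtale (R : TAlg k) : Prop :=
  R.IsFlat ∧ ∃ B : BoxSquare R, ∀ X, Subsingleton (Kaehler B X)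

/-- Étale algebras over a Tambara functor. -/
def IsEtale (R : TAlg k) : Prop := R.IsFormallyEtale ∧ R.IsFinitelyPresented

end TAlg

end Tamb

/-! ### Sums and products over fibres -/

namespace Tamb

section Fibres

variable {X Y Z W A : Type*}

/-- The product of a function over the fibres of a map. -/
@[to_additive]
noncomputable def fibreProd [CommMonoid A] (f : X → Y) (φ : X → A) (y : Y) : A :=
  ∏ᶠ x : {x : X // f x = y}, φ x.1

@[to_additive]
theorem fibreProd_id [CommMonoid A] (φ : X → A) (y : X) : fibreProd (fun x => x) φ y = φ y :=
  finprod_unique (α := {x : X // x = y}) fun x => φ x.1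

@[to_additive]
theorem fibreProd_comp [CommMonoid A] [Finite X] [Finite Y] (g : Y → Z) (f : X → Y)
    (φ : X → A) (z : Z) :
    fibreProd (fun x => g (f x)) φ z = fibreProd g (fibreProd f φ) z := by
  classical
  have := Fintype.ofFinite X
  have := Fintype.ofFinite Y
  unfold fibreProd
  rw [finprod_eq_prod_of_fintype]
  simp only [finprod_eq_prod_of_fintype]
  rw [← Fintype.prod_sigma (fun p : Σ y : {y // g y = z}, {x // f x = y.1} => φ p.2.1)]
  refine Fintype.prod_bijective (fun x => ⟨⟨f x.1, x.2⟩, ⟨x.1, rfl⟩⟩) ⟨?_, ?_⟩ _ _ fun _ => rfl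
  · rintro ⟨x, hx⟩ ⟨x', hx'⟩ h
    simp only [Sigma.mk.injEq, Subtype.mk.injEq] at h
    obtain ⟨h1, h2⟩ := h
    rw [Subtype.heq_iff_coe_eq (by simp [h1])] at h2
    exact Subtype.ext h2
  · rintro ⟨⟨y, hy⟩, ⟨x, hx⟩⟩
    obtain rfl : f x = y := hx
    exact ⟨⟨x, hy⟩, rfl⟩

@[to_additive]
theorem fibreProd_mul [CommMonoid A] [Finite X] (f : X → Y) (φ ψ : X → A) (y : Y) :
    fibreProd f (fun x => φ x * ψ x) y = fibreProd f φ y * fibreProd f ψ y :=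
  finprod_mul_distrib (Set.toFinite _) (Set.toFinite _)

@[to_additive]
theorem fibreProd_one [CommMonoid A] (f : X → Y) (y : Y) :
    fibreProd f (fun _ => (1 : A)) y = 1 := finprod_one

/-- Compatibility with a map of fibres which is bijective and with a homomorphism of the values. -/
@[to_additive]
theorem map_fibreProd {B : Type*} [CommMonoid A] [CommMonoid B] [Finite X] (ρ : A →* B)
    (f : X → Y) (f' : W → Z) (φ : X → A) (ψ : W → B) (h : W → X) (y : Y) (z : Z)
    (hm : ∀ w, f' w = z → f (h w) = y) (hψ : ∀ w, ψ w = ρ (φ (h w)))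
    (hu : ∀ x, f x = y → ∃! w, f' w = z ∧ h w = x) :
    fibreProd f' ψ z = ρ (fibreProd f φ y) := by
  unfold fibreProd
  rw [MonoidHom.map_finprod _ (Set.toFinite _)]
  refine finprod_eq_of_bijective (fun w => ⟨h w.1, hm _ w.2⟩) ⟨?_, ?_⟩ fun w => hψ _
  · rintro ⟨w, hw⟩ ⟨w', hw'⟩ e
    simp only [Subtype.mk.injEq] at e
    exact Subtype.ext ((hu _ (hm _ hw)).unique ⟨hw, rfl⟩ ⟨hw', e.symm⟩)
  · rintro ⟨x, hx⟩
    obtain ⟨w, ⟨h1, h2⟩, -⟩ := hu x hx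
    exact ⟨⟨w, h1⟩, Subtype.ext h2⟩

theorem fibreSum_mul [CommRing A] [Finite X] (f : X → Y) (φ : X → A) (ψ : Y → A) (y : Y) :
    fibreSum f (fun x => φ x * ψ (f x)) y = fibreSum f φ y * ψ y := by
  classical
  have := Fintype.ofFinite X
  unfold fibreSum
  rw [finsum_eq_sum_of_fintype, finsum_eq_sum_of_fintype, Finset.sum_mul]
  exact Finset.sum_congr rfl fun x _ => by simp only [x.2]

end Fibres

section

variable {G : Type u} [Group G]

theorem fibreProd_pullback {A : Type*} [CommMonoid A] {W X Y Z : FinGSet G} {p : W →[G] X}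
    {q : W →[G] Y} {f : X →[G] Z} {g : Y →[G] Z} (h : IsPullbackSq p q f g) (φ : X → A) (y : Y) :
    fibreProd f φ (g y) = fibreProd q (fun w => φ (p w)) y := by
  refine (map_fibreProd (MonoidHom.id A) f q φ _ p (g y) y (fun w hw => ?_) (fun _ => rfl)
    fun x hx => ?_).symm
  · rw [h.1 w, hw]
  · obtain ⟨w, ⟨h1, h2⟩, h3⟩ := h.2 x y hx
    exact ⟨w, ⟨h2, h1⟩, fun w' hw' => h3 w' ⟨hw'.2, hw'.1⟩⟩

theorem fibreSum_pullback {A : Type*} [AddCommMonoid A] {W X Y Z : FinGSet G} {p : W →[G] X}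
    {q : W →[G] Y} {f : X →[G] Z} {g : Y →[G] Z} (h : IsPullbackSq p q f g) (φ : X → A) (y : Y) :
    fibreSum f φ (g y) = fibreSum q (fun w => φ (p w)) y := by
  refine (map_fibreSum (AddMonoidHom.id A) f q φ _ p (g y) y (fun w hw => ?_) (fun _ => rfl)
    fun x hx => ?_).symm
  · rw [h.1 w, hw]
  · obtain ⟨w, ⟨h1, h2⟩, h3⟩ := h.2 x y hx
    exact ⟨w, ⟨h2, h1⟩, fun w' hw' => h3 w' ⟨hw'.2, hw'.1⟩⟩

theorem fibreProd_equivariant {A : Type*} [CommMonoid A] (ρ : A →* A) (g : G) {X Y : FinGSet G}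
    (f : X →[G] Y) (φ : X → A) (hφ : ∀ x, φ (g • x) = ρ (φ x)) (y : Y) :
    fibreProd f φ (g • y) = ρ (fibreProd f φ y) := by
  refine map_fibreProd ρ f f φ φ (fun w => g⁻¹ • w) y (g • y) (fun w hw => ?_) (fun w => ?_)
    fun x hx => ⟨g • x, ⟨by rw [map_smul, hx], by simp⟩, ?_⟩
  · rw [map_smul, hw, inv_smul_smul]
  · rw [← hφ, smul_inv_smul]
  · rintro w ⟨-, rfl⟩
    simp

theorem fibreSum_equivariant {A : Type*} [AddCommMonoid A] (ρ : A →+ A) (g : G) {X Y : FinGSet G}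
    (f : X →[G] Y) (φ : X → A) (hφ : ∀ x, φ (g • x) = ρ (φ x)) (y : Y) :
    fibreSum f φ (g • y) = ρ (fibreSum f φ y) := by
  refine map_fibreSum ρ f f φ φ (fun w => g⁻¹ • w) y (g • y) (fun w hw => ?_) (fun w => ?_)
    fun x hx => ⟨g • x, ⟨by rw [map_smul, hx], by simp⟩, ?_⟩
  · rw [map_smul, hw, inv_smul_smul]
  · rw [← hφ, smul_inv_smul]
  · rintro w ⟨-, rfl⟩
    simp

theorem fibreProd_fibreSum {B : Type*} [CommRing B] {A X Y E P : FinGSet G} {q : A →[G] X}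
    {p : X →[G] Y} {e : E →[G] A} {p' : E →[G] P} {q' : P →[G] Y}
    (h : IsExponentialDiagram q p e p' q') (φ : A → B) (y : Y) :
    fibreProd p (fibreSum q φ) y =
      fibreSum q' (fibreProd p' (fun w => φ (e w))) y := by
  classical
  have := Fintype.ofFinite A
  have := Fintype.ofFinite X
  have := Fintype.ofFinite E
  have := Fintype.ofFinite P
  unfold fibreProd fibreSum
  simp only [finprod_eq_prod_of_fintype, finsum_eq_sum_of_fintype]
  rw [Finset.prod_univ_sum, Fintype.piFinset_univ]
  have key : ∀ (t : {t : P // q' t = y}) (x : {x : X // p x = y}),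
      ∃! w : E, q (e w) = x.1 ∧ p' w = t.1 := fun t x => h.isPullback.2 x.1 t.1 (x.2.trans t.2.symm)
  choose w hw hw' using key
  refine (Fintype.sum_bijective (fun (t : {t : P // q' t = y}) (x : {x : X // p x = y}) =>
    (⟨e (w t x), (hw t x).1⟩ : {a : A // q a = x.1})) ⟨?_, ?_⟩ _ _ fun t => ?_).symm
  · intro t t' htt'
    obtain ⟨t₀, -, h0⟩ := h.sections y (fun x => e (w t x)) (fun x => (hw t x).1)
    have h1 := h0 t.1 ⟨t.2, fun x => ⟨w t x, (hw t x).2, rfl⟩⟩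
    have h2 := h0 t'.1 ⟨t'.2, fun x => ⟨w t' x, (hw t' x).2,
      (congrArg Subtype.val (congrFun htt' x)).symm⟩⟩
    exact Subtype.ext (h1.trans h2.symm)
  · intro s
    obtain ⟨t, ⟨ht, hs⟩, -⟩ := h.sections y (fun x => (s x).1) (fun x => (s x).2)
    refine ⟨⟨t, ht⟩, funext fun x => Subtype.ext ?_⟩
    obtain ⟨v, hv, hv'⟩ := hs x
    have : v = w ⟨t, ht⟩ x := hw' ⟨t, ht⟩ x v ⟨by rw [hv', (s x).2], hv⟩
    change e (w ⟨t, ht⟩ x) = (s x).1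
    rw [← this, hv']
  · refine (Fintype.prod_bijective (fun x : {x : X // p x = y} =>
      (⟨w t x, (hw t x).2⟩ : {v : E // p' v = t.1})) ⟨?_, ?_⟩ _ _ fun x => rfl).symm
    · intro x x' hx
      have hx := congrArg Subtype.val hx
      exact Subtype.ext (by rw [← (hw t x).1, ← (hw t x').1]; exact congrArg (fun v => q (e v)) hx)
    · rintro ⟨v, hv⟩
      have hp : p (q (e v)) = y := by
        have := h.isPullback.1 v
        rw [hv, t.2] at this
        exact this
      exact ⟨⟨q (e v), hp⟩, Subtype.ext (hw' t ⟨q (e v), hp⟩ v ⟨rfl, hv⟩).symm⟩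

end

/-! ### Fixed point and coinduced Tambara functors -/

section FixedPoints

variable {G : Type u} [Group G]

/-- The ring of equivariant functions from a finite `G`-set to a ring with `G`-action `ρ`. -/
def equivariantFunctions {A : Type u} [CommRing A] (ρ : G →* (A →+* A)) (X : FinGSet G) :
    Subring (X → A) where
  carrier := {φ | ∀ (g : G) (x : X), φ (g • x) = ρ g (φ x)}
  mul_mem' := fun ha hb g x => by simp [ha g x, hb g x]
  one_mem' := fun g x => by simp
  add_mem' := fun ha hb g x => by simp [ha g x, hb g x]
  zero_mem' := fun g x => by simp
  neg_mem' := fun ha g x => by simp [ha g x]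

/-- The fixed point Tambara functor `FP(A)` of a ring `A` with `G`-action `ρ`: its value at `X` is
the ring of equivariant functions `X → A`, so `FP(A)(G/H) = A^H`; restrictions are given
by composition, transfers and norms by sums and products over fibres. -/
noncomputable def fixedPoint {A : Type u} [CommRing A] (ρ : G →* (A →+* A)) :
    TambaraFunctor G where
  obj X := equivariantFunctions ρ X
  res f :=
    { toFun := fun φ => ⟨fun x => φ.1 (f x), fun g x => by simpa using φ.2 g (f x)⟩
      map_one' := rfl
      map_mul' := fun _ _ => rfl
      map_zero' := rfl
      map_add' := fun _ _ => rfl }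
  tr f :=
    { toFun := fun φ => ⟨fibreSum f φ.1, fun g y =>
        fibreSum_equivariant (ρ g).toAddMonoidHom g f φ.1 (φ.2 g) y⟩
      map_zero' := Subtype.ext (funext fun y => fibreSum_zero _ y)
      map_add' := fun φ ψ => Subtype.ext (funext fun y => fibreSum_add _ φ.1 ψ.1 y) }
  nm f :=
    { toFun := fun φ => ⟨fibreProd f φ.1, fun g y =>
        fibreProd_equivariant (ρ g).toMonoidHom g f φ.1 (φ.2 g) y⟩
      map_one' := Subtype.ext (funext fun y => fibreProd_one _ y)
      map_mul' := fun φ ψ => Subtype.ext (funext fun y => fibreProd_mul _ φ.1 ψ.1 y) }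
  res_id _ := rfl
  res_comp _ _ _ := rfl
  tr_id φ := Subtype.ext (funext fun y => fibreSum_id φ.1 y)
  tr_comp g f φ := Subtype.ext (funext fun y => fibreSum_comp g f φ.1 y)
  nm_id φ := Subtype.ext (funext fun y => fibreProd_id φ.1 y)
  nm_comp g f φ := Subtype.ext (funext fun y => fibreProd_comp g f φ.1 y)
  additive {J _ X Y} i hi := by
    constructor
    · intro φ ψ h
      refine Subtype.ext (funext fun y => ?_)
      obtain ⟨⟨j, x⟩, rfl, -⟩ := hi y
      exact congrFun (congrArg Subtype.val (congrFun h j)) x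
    · intro φ
      choose s hs hs' using hi
      have hsi : ∀ j x, s (i j x) = ⟨j, x⟩ := fun j x => (hs' (i j x) ⟨j, x⟩ rfl).symm
      refine ⟨⟨fun y => (φ (s y).1).1 (s y).2, fun g y => ?_⟩, ?_⟩
      · have : s (g • y) = ⟨(s y).1, g • (s y).2⟩ := by
          rw [← hsi, map_smul, hs]
        change (φ (s (g • y)).1).1 (s (g • y)).2 = ρ g ((φ (s y).1).1 (s y).2)
        rw [this]
        exact (φ (s y).1).2 g (s y).2
      · refine funext fun j => Subtype.ext (funext fun x => ?_)
        change (φ (s (i j x)).1).1 (s (i j x)).2 = (φ j).1 x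
        rw [hsi]
  res_tr h φ := Subtype.ext (funext fun y => fibreSum_pullback h φ.1 y)
  res_nm h φ := Subtype.ext (funext fun y => fibreProd_pullback h φ.1 y)
  frobenius f φ ψ := Subtype.ext (funext fun y => fibreSum_mul f φ.1 ψ.1 y)
  nm_tr h φ := Subtype.ext (funext fun y => fibreProd_fibreSum h φ.1 y)

/-- The constant Tambara functor, i.e. `FP` of a ring with trivial action. -/
noncomputable abbrev const (G : Type u) [Group G] (A : Type u) [CommRing A] : TambaraFunctor G :=
  fixedPoint (1 : G →* (A →+* A))

/-- The Tambara functor `CoInd_e^G S` coinduced from the trivial group: its value at `X` is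
the ring of all functions `X → S`; restrictions are given
by composition, transfers and norms by sums and products over fibres. -/
noncomputable def coind (G : Type u) [Group G] (S : Type u) [CommRing S] : TambaraFunctor G where
  obj X := X → S
  ring X := inferInstanceAs (CommRing (X → S))
  res f :=
    { toFun := fun φ x => φ (f x)
      map_one' := rfl
      map_mul' := fun _ _ => rfl
      map_zero' := rfl
      map_add' := fun _ _ => rfl }
  tr f :=
    { toFun := fibreSum f
      map_zero' := funext fun y => fibreSum_zero _ y
      map_add' := fun φ ψ => funext fun y => fibreSum_add _ φ ψ y }
  nm f :=
    { toFun := fibreProd f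
      map_one' := funext fun y => fibreProd_one _ y
      map_mul' := fun φ ψ => funext fun y => fibreProd_mul _ φ ψ y }
  res_id _ := rfl
  res_comp _ _ _ := rfl
  tr_id φ := funext fun y => fibreSum_id φ y
  tr_comp g f φ := funext fun y => fibreSum_comp g f φ y
  nm_id φ := funext fun y => fibreProd_id φ y
  nm_comp g f φ := funext fun y => fibreProd_comp g f φ y
  additive {J _ X Y} i hi := by
    constructor
    · intro φ ψ h
      refine funext fun y => ?_
      obtain ⟨⟨j, x⟩, rfl, -⟩ := hi y
      exact congrFun (congrFun h j) x
    · intro φ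
      choose s hs hs' using hi
      have hsi : ∀ j x, s (i j x) = ⟨j, x⟩ := fun j x => (hs' (i j x) ⟨j, x⟩ rfl).symm
      refine ⟨fun y => φ (s y).1 (s y).2, funext fun j => funext fun x => ?_⟩
      change φ (s (i j x)).1 (s (i j x)).2 = φ j x
      rw [hsi]
  res_tr h φ := funext fun y => fibreSum_pullback h φ y
  res_nm h φ := funext fun y => fibreProd_pullback h φ y
  frobenius f φ ψ := funext fun y => fibreSum_mul f φ ψ y
  nm_tr h φ := funext fun y => fibreProd_fibreSum h φ y

end FixedPoints

end Tamb

/-! ### The level `G/e` -/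

namespace Tamb

open CategoryTheory

section BottomLevel

variable {G : Type u} [Group G] [Finite G]

/-- The `G`-set `G/e`, i.e. `G` acting on itself by left translations. -/
abbrev free (G : Type u) [Group G] [Finite G] : FinGSet G := ⟨G⟩

/-- The map `G/e → X` of `G`-sets which takes `1` to `x`. -/
def orb {X : FinGSet G} (x : X) : free G →[G] X where
  toFun g := g • x
  map_smul' g h := mul_smul g h x

@[simp] theorem orb_apply {X : FinGSet G} (x : X) (g : G) : orb x g = g • x := rfl

theorem orb_one : orb (X := free G) (1 : G) = MulActionHom.id G :=
  MulActionHom.ext fun g => mul_one g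

theorem comp_orb {X Y : FinGSet G} (f : X →[G] Y) (x : X) : f.comp (orb x) = orb (f x) :=
  MulActionHom.ext fun g => map_smul f g x

/-- The `G`-set `J × G/e`. -/
def copies (G : Type u) [Group G] [Finite G] (J : Type u) [Finite J] : FinGSet G where
  carrier := J × G
  action :=
    { smul := fun g x => (x.1, g * x.2)
      one_smul := fun x => Prod.ext rfl (one_mul x.2)
      mul_smul := fun g h x => Prod.ext rfl (mul_assoc g h x.2) }
  finite := inferInstance

/-- The inclusion of the copy of `G/e` with index `j`. -/
def copiesIncl {J : Type u} [Finite J] (j : J) : free G →[G] copies G J where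
  toFun h := (j, h)
  map_smul' _ _ := rfl

/-- The projection `J × G/e → G/e`. -/
def copiesProj (G : Type u) [Group G] [Finite G] (J : Type u) [Finite J] :
    copies G J →[G] free G where
  toFun x := x.2
  map_smul' _ _ := rfl

theorem copiesProj_comp {J : Type u} [Finite J] (j : J) :
    (copiesProj G J).comp (copiesIncl j) = MulActionHom.id G := rfl

/-- The empty `G`-set. -/
def emptySet (G : Type u) [Group G] : FinGSet G where
  carrier := PEmpty.{u + 1}
  action :=
    { smul := fun _ x => x, one_smul := fun x => x.elim, mul_smul := fun _ _ x => x.elim }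
  finite := inferInstance

/-- The map from the empty `G`-set. -/
def emptyMap (X : FinGSet G) : emptySet G →[G] X where
  toFun x := x.elim
  map_smul' _ x := x.elim

theorem subsingleton_empty (R : TambaraFunctor G) : Subsingleton (R.obj (emptySet G)) := by
  have := R.additive (J := PEmpty.{u + 1}) (X := fun j => j.elim) (Y := emptySet G)
    (fun j => j.elim) (fun y => PEmpty.elim y)
  exact ⟨fun a b => this.1 (funext fun j => j.elim)⟩

theorem isPullback_incl_self {J : Type u} [Finite J] (j : J) :
    IsPullbackSq (MulActionHom.id G) (MulActionHom.id G) (copiesIncl (G := G) j)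
      (copiesIncl j) :=
  ⟨fun _ => rfl, fun x y h => ⟨x, ⟨rfl, congrArg Prod.snd h⟩, fun _ hw => hw.1⟩⟩

theorem isPullback_incl_ne {J : Type u} [Finite J] {j l : J} (h : j ≠ l) :
    IsPullbackSq (emptyMap (free G)) (emptyMap (free G)) (copiesIncl (G := G) j)
      (copiesIncl l) :=
  ⟨fun w => w.elim, fun _ _ e => (h (congrArg Prod.fst e)).elim⟩

theorem copies_ext (R : TambaraFunctor G) {J : Type u} [Finite J] {a b : R.obj (copies G J)}
    (h : ∀ j, R.res (copiesIncl j) a = R.res (copiesIncl j) b) : a = b :=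
  (R.additive (fun j : J => copiesIncl (G := G) j)
    (fun _ => ⟨⟨_, _⟩, rfl, fun x hx => by subst hx; rfl⟩)).1 (funext h)

theorem tr_copiesProj (R : TambaraFunctor G) {J : Type u} [Finite J] (a : R.obj (copies G J)) :
    R.tr (copiesProj G J) a = ∑ᶠ j, R.res (copiesIncl j) a := by
  classical
  have := Fintype.ofFinite J
  rw [finsum_eq_sum_of_fintype]
  have key : a = ∑ j, R.tr (copiesIncl j) (R.res (copiesIncl j) a) := by
    refine copies_ext R fun l => ?_
    rw [map_sum, Finset.sum_eq_single l, R.res_tr (isPullback_incl_self l), R.res_id, R.tr_id]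
    · intro j _ hj
      have := subsingleton_empty R
      rw [R.res_tr (isPullback_incl_ne hj), Subsingleton.elim (R.res _ _) 0, map_zero]
    · simp
  conv_lhs => rw [key]
  rw [map_sum]
  refine Finset.sum_congr rfl fun j _ => ?_
  rw [← R.tr_comp, copiesProj_comp, R.tr_id]

theorem nm_copiesProj (R : TambaraFunctor G) {J : Type u} [Finite J] (a : R.obj (copies G J)) :
    R.nm (copiesProj G J) a = ∏ᶠ j, R.res (copiesIncl j) a := by
  classical
  have := Fintype.ofFinite J
  rw [finprod_eq_prod_of_fintype]
  have key : a = ∏ j, R.nm (copiesIncl j) (R.res (copiesIncl j) a) := by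
    refine copies_ext R fun l => ?_
    rw [map_prod, Finset.prod_eq_single l, R.res_nm (isPullback_incl_self l), R.res_id, R.nm_id]
    · intro j _ hj
      have := subsingleton_empty R
      rw [R.res_nm (isPullback_incl_ne hj), Subsingleton.elim (R.res _ _) 1, map_one]
    · simp
  conv_lhs => rw [key]
  rw [map_prod]
  refine Finset.prod_congr rfl fun j _ => ?_
  rw [← R.nm_comp, copiesProj_comp, R.nm_id]

/-- The fibre of `X × G/e → X` as a pullback. -/
def fibreMap {X Y : FinGSet G} (f : X →[G] Y) (y : Y) : copies G {x : X // f x = y} →[G] X where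
  toFun x := x.2 • x.1.1
  map_smul' g x := mul_smul g x.2 x.1.1

theorem isPullback_fibre {X Y : FinGSet G} (f : X →[G] Y) (y : Y) :
    IsPullbackSq (fibreMap f y) (copiesProj G {x : X // f x = y}) f (orb y) := by
  refine ⟨fun w => ?_, fun x g h => ?_⟩
  · change f (w.2 • w.1.1) = w.2 • y
    rw [map_smul, w.1.2]
  · have h : f x = (g : G) • y := h
    refine ⟨(⟨(g : G)⁻¹ • x, by rw [map_smul, h, inv_smul_smul]⟩, g), ⟨smul_inv_smul _ _, rfl⟩, ?_⟩
    rintro ⟨⟨x', hx'⟩, g'⟩ ⟨h1, h2⟩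
    obtain rfl : g' = g := h2
    have h1 : (g' : G) • x' = x := h1
    subst h1
    exact Prod.ext (Subtype.ext (inv_smul_smul g' x').symm) rfl

theorem fibreMap_comp_incl {X Y : FinGSet G} (f : X →[G] Y) (y : Y) (x : {x : X // f x = y}) :
    (fibreMap f y).comp (copiesIncl x) = orb x.1 := rfl

theorem res_orb_tr (R : TambaraFunctor G) {X Y : FinGSet G} (f : X →[G] Y) (a : R.obj X) (y : Y) :
    R.res (orb y) (R.tr f a) = fibreSum f (fun x => R.res (orb x) a) y := by
  rw [R.res_tr (isPullback_fibre f y), tr_copiesProj]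
  refine finsum_congr fun x => ?_
  rw [← R.res_comp, fibreMap_comp_incl]

theorem res_orb_nm (R : TambaraFunctor G) {X Y : FinGSet G} (f : X →[G] Y) (a : R.obj X) (y : Y) :
    R.res (orb y) (R.nm f a) = fibreProd f (fun x => R.res (orb x) a) y := by
  rw [R.res_nm (isPullback_fibre f y), nm_copiesProj]
  refine finprod_congr fun x => ?_
  rw [← R.res_comp, fibreMap_comp_incl]

end BottomLevel

section Functors

variable {G : Type u} [Group G] {F : Type u} [CommRing F]

/-- The constant functions, as a ring homomorphism from `F` to the value of the constant Tambara
functor at `X`. -/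
noncomputable def constHom (G : Type u) [Group G] (F : Type u) [CommRing F] (X : FinGSet G) :
    F →+* (const G F).obj X where
  toFun c := ⟨fun _ => c, fun _ _ => rfl⟩
  map_one' := rfl
  map_mul' _ _ := rfl
  map_zero' := rfl
  map_add' _ _ := rfl

/-- The action of `G` on the ring underlying an `F`-algebra with `G`-action. -/
def ringAction (A : Action (CommAlgCat.{u} F) G) : G →* (A.V →+* A.V) where
  toFun g := (A.ρ g).hom.toRingHom
  map_one' := by rw [map_one]; rfl
  map_mul' g h := by rw [map_mul]; rfl

theorem fibreSum_map {A B : Type*} [AddCommMonoid A] [AddCommMonoid B] {X Y : Type*} [Finite X]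
    (u : A →+ B) (f : X → Y) (φ : X → A) (y : Y) :
    u (fibreSum f φ y) = fibreSum f (fun x => u (φ x)) y :=
  (map_fibreSum u f f φ _ id y y (fun _ h => h) (fun _ => rfl)
    fun x hx => ⟨x, ⟨hx, rfl⟩, fun _ h => h.2⟩).symm

theorem fibreProd_map {A B : Type*} [CommMonoid A] [CommMonoid B] {X Y : Type*} [Finite X]
    (u : A →* B) (f : X → Y) (φ : X → A) (y : Y) :
    u (fibreProd f φ y) = fibreProd f (fun x => u (φ x)) y :=
  (map_fibreProd u f f φ _ id y y (fun _ h => h) (fun _ => rfl)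
    fun x hx => ⟨x, ⟨hx, rfl⟩, fun _ h => h.2⟩).symm

/-- The map of fixed point Tambara functors induced by an equivariant ring homomorphism. -/
noncomputable def fixedPointMap {A B : Type u} [CommRing A] [CommRing B] {ρ : G →* (A →+* A)}
    {σ : G →* (B →+* B)} (u : A →+* B) (hu : ∀ g a, u (ρ g a) = σ g (u a)) :
    fixedPoint ρ ⟶ fixedPoint σ where
  app X := ((u.compLeft X).comp (equivariantFunctions ρ X).subtype).codRestrict
    (equivariantFunctions σ X) fun φ g x => (congrArg u (φ.2 g x)).trans (hu g (φ.1 x))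
  res _ _ := rfl
  tr f φ := Subtype.ext (funext fun y => fibreSum_map u.toAddMonoidHom f φ.1 y)
  nm f φ := Subtype.ext (funext fun y => fibreProd_map u.toMonoidHom f φ.1 y)

/-- The map of coinduced Tambara functors induced by a ring homomorphism. -/
noncomputable def coindMap (G : Type u) [Group G] {A B : Type u} [CommRing A] [CommRing B]
    (u : A →+* B) : coind G A ⟶ coind G B where
  app X := u.compLeft X
  res _ _ := rfl
  tr f φ := funext fun y => fibreSum_map u.toAddMonoidHom f φ y
  nm f φ := funext fun y => fibreProd_map u.toMonoidHom f φ y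

/-- The inclusion of the equivariant functions in all functions, `FP(A) → CoInd_e^G A`. -/
noncomputable def fixedPointIncl {A : Type u} [CommRing A] (ρ : G →* (A →+* A)) :
    fixedPoint ρ ⟶ coind G A where
  app X := (equivariantFunctions ρ X).subtype
  res _ _ := rfl
  tr _ _ := rfl
  nm _ _ := rfl

/-- The fixed point construction, from `F`-algebras with `G`-action to algebras over the constant
Tambara functor. -/
noncomputable def FP (G : Type u) [Group G] (F : Type u) [CommRing F] :
    Action (CommAlgCat.{u} F) G ⥤ TAlg (const G F) where
  obj A := Under.mk (fixedPointMap (σ := ringAction A) (algebraMap F A.V)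
    fun g a => ((A.ρ g).hom.commutes a).symm)
  map {A B} u := Under.homMk
    (fixedPointMap (ρ := ringAction A) (σ := ringAction B) u.hom.hom.toRingHom
      fun g a => congrArg (fun v => v.hom a) (u.comm g))
    (TambaraFunctor.hom_ext fun _ φ => Subtype.ext (funext fun x => u.hom.hom.commutes (φ.1 x)))
  map_id _ := rfl
  map_comp _ _ := rfl

/-- Coinduction from the trivial group, from `F`-algebras to algebras over the constant Tambara
functor. -/
noncomputable def coindAlg (G : Type u) [Group G] (F : Type u) [CommRing F] :
    CommAlgCat.{u} F ⥤ TAlg (const G F) where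
  obj S := Under.mk (fixedPointIncl (1 : G →* (F →+* F)) ≫ coindMap G (algebraMap F S))
  map u := Under.homMk (coindMap G u.hom.toRingHom)
    (TambaraFunctor.hom_ext fun _ φ => funext fun x => u.hom.commutes (φ.1 x))
  map_id _ := rfl
  map_comp _ _ := rfl

variable [Finite G]

/-- The `F`-algebra `R(G/e)`, for an algebra `R` over the constant Tambara functor. -/
def Bottom (R : TAlg (const G F)) : Type u := R.right.obj (free G)

noncomputable instance (R : TAlg (const G F)) : CommRing (Bottom R) :=
  inferInstanceAs (CommRing (R.right.obj (free G)))

noncomputable instance (R : TAlg (const G F)) : Algebra F (Bottom R) :=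
  RingHom.toAlgebra ((R.hom.app (free G)).comp (constHom G F (free G)))

/-- The action of `g : G` on `R(G/e)`, induced by the automorphism `x ↦ x * g` of `G/e`. -/
noncomputable def weyl (R : TAlg (const G F)) (g : G) : Bottom R →ₐ[F] Bottom R :=
  { R.right.res (orb (X := free G) g) with
    commutes' := fun c => (R.hom.res (orb (X := free G) g) (constHom G F (free G) c)).symm }

theorem weyl_apply (R : TAlg (const G F)) (g : G) (a : R.right.obj (free G)) :
    weyl R g a = R.right.res (orb (X := free G) g) a := rfl

theorem orb_mul (g h : G) : (orb (X := free G) h).comp (orb (X := free G) g) =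
    orb (X := free G) (g * h : G) :=
  MulActionHom.ext fun x => mul_assoc x g h

theorem res_orb_one (R : TambaraFunctor G) (a : R.obj (free G)) :
    R.res (orb (X := free G) (1 : G)) a = a := by
  rw [orb_one, R.res_id]

theorem res_orb_mul (R : TambaraFunctor G) (g h : G) (a : R.obj (free G)) :
    R.res (orb (X := free G) (g * h : G)) a =
      R.res (orb (X := free G) g) (R.res (orb (X := free G) h) a) := by
  rw [← orb_mul, R.res_comp]

/-- The functor `ev_{G/e}` from algebras over the constant Tambara functor at `F` to `F`-algebras
with an action of `G`. -/
noncomputable def evAlg (G : Type u) [Group G] [Finite G] (F : Type u) [CommRing F] :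
    TAlg (const G F) ⥤ Action (CommAlgCat.{u} F) G where
  obj R :=
    { V := CommAlgCat.of F (Bottom R)
      ρ :=
        { toFun := fun g => CommAlgCat.ofHom (weyl R g)
          map_one' := CommAlgCat.hom_ext (AlgHom.ext fun a =>
            res_orb_one R.right a)
          map_mul' := fun g h => CommAlgCat.hom_ext (AlgHom.ext fun a =>
            res_orb_mul R.right g h a) } }
  map φ :=
    { hom := CommAlgCat.ofHom
        { φ.right.app (free G) with
          commutes' := fun c => TAlg.hom_app_const φ (free G) (constHom G F (free G) c) }
      comm := fun g => CommAlgCat.hom_ext (AlgHom.ext fun a =>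
        φ.right.res (orb (X := free G) g) a) }
  map_id _ := rfl
  map_comp _ _ := rfl

/-- The adjunction between `ev_{G/e}` and `CoInd_e^G`.  The adjunct of `u : R(G/e) → S` takes
`a ∈ R(X)` to the function on `X` whose value at `x` is `u` of the
restriction of `a` along the map `G/e → X` given by `x`. -/
noncomputable def adjunct (R : TAlg (const G F)) (S : CommAlgCat.{u} F) :
    (((evAlg G F).obj R).V ⟶ S) ≃ (R ⟶ (coindAlg G F).obj S) where
  toFun u := Under.homMk
    { app := fun X =>
        { toFun := fun a x => u.hom (R.right.res (orb x) a : Bottom R)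
          map_one' := funext fun x =>
            (congrArg u.hom (map_one (R.right.res (orb x)))).trans (map_one u.hom)
          map_mul' := fun a b => funext fun x =>
            (congrArg u.hom (map_mul (R.right.res (orb x)) a b)).trans (map_mul u.hom _ _)
          map_zero' := funext fun x =>
            (congrArg u.hom (map_zero (R.right.res (orb x)))).trans (map_zero u.hom)
          map_add' := fun a b => funext fun x =>
            (congrArg u.hom (map_add (R.right.res (orb x)) a b)).trans (map_add u.hom _ _) }
      res := fun f a => funext fun x => congrArg u.hom (by
        change R.right.res (orb x) (R.right.res f a) = R.right.res (orb (f x)) a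
        rw [← R.right.res_comp, comp_orb])
      tr := fun f a => funext fun y => (congrArg u.hom (res_orb_tr R.right f a y)).trans
        (map_fibreSum (A := Bottom R) u.hom.toRingHom.toAddMonoidHom f f
          (fun x => R.right.res (orb x) a) _ id y y (fun _ h => h) (fun _ => rfl)
          fun x hx => ⟨x, ⟨hx, rfl⟩, fun _ h => h.2⟩).symm
      nm := fun f a => funext fun y => (congrArg u.hom (res_orb_nm R.right f a y)).trans
        (map_fibreProd (A := Bottom R) u.hom.toRingHom.toMonoidHom f f
          (fun x => R.right.res (orb x) a) _ id y y (fun _ h => h) (fun _ => rfl)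
          fun x hx => ⟨x, ⟨hx, rfl⟩, fun _ h => h.2⟩).symm }
    (TambaraFunctor.hom_ext fun X φ => funext fun x => by
      have h1 : (const G F).res (orb x) φ = constHom G F (free G) (φ.1 x) :=
        Subtype.ext (funext fun g => φ.2 g x)
      change u.hom (R.right.res (orb x) (R.hom.app X φ)) = algebraMap F S (φ.1 x)
      rw [← R.hom.res]
      exact (congrArg (fun v => u.hom (R.hom.app (free G) v)) h1).trans
        (u.hom.commutes (φ.1 x)))
  invFun f := CommAlgCat.ofHom
    { toFun := fun a => (f.right.app (free G) a : G → S) 1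
      map_one' := congrFun (map_one (f.right.app (free G))) (1 : G)
      map_mul' := fun a b => congrFun (map_mul (f.right.app (free G)) a b) (1 : G)
      map_zero' := congrFun (map_zero (f.right.app (free G))) (1 : G)
      map_add' := fun a b => congrFun (map_add (f.right.app (free G)) a b) (1 : G)
      commutes' := fun c =>
        congrFun (TAlg.hom_app_const f (free G) (constHom G F (free G) c)) (1 : G) }
  left_inv u := CommAlgCat.hom_ext (AlgHom.ext fun a => congrArg u.hom (res_orb_one R.right a))
  right_inv f := by
    refine Under.UnderMorphism.ext (TambaraFunctor.hom_ext fun X a => funext fun x => ?_)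
    change (f.right.app (free G) (R.right.res (orb x) a) : G → S) 1 = (f.right.app X a : X → S) x
    rw [f.right.res]
    change (f.right.app X a : X → S) ((1 : G) • x) = _
    rw [one_smul]

end Functors

end Tamb

/-! ### Affine group schemes -/

namespace Tamb

open CategoryTheory

universe v w

/-- An affine group scheme over a category `C` of algebras: a functor
`Hom(R, -) : C ⥤ Grp` for an object `R` of `C`, that is, a group structure on
all the sets `Hom(R, S)` which is natural in `S`. -/
structure GrpSch (C : Type w) [Category.{v} C] where
  /-- The representing algebra. -/
  alg : C
  /-- The group structure on the set of `S`-valued points. -/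
  [grp : ∀ S : C, Group (alg ⟶ S)]
  mul_comp : ∀ {S T : C} (a b : alg ⟶ S) (f : S ⟶ T), (a * b) ≫ f = (a ≫ f) * (b ≫ f)

attribute [instance] GrpSch.grp

namespace GrpSch

section

variable {C : Type w} [Category.{v} C]

/-- The functor of points `Hom(R, -) : C ⥤ Grp`. -/
def points (𝒢 : GrpSch C) : C ⥤ GrpCat.{v} where
  obj S := GrpCat.of (𝒢.alg ⟶ S)
  map f := GrpCat.ofHom
    { toFun := fun a => a ≫ f
      map_one' := by
        have h := 𝒢.mul_comp 1 1 f
        rw [one_mul] at h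
        exact left_eq_mul.mp h
      map_mul' := fun a b => 𝒢.mul_comp a b f }
  map_id S := GrpCat.hom_ext (MonoidHom.ext fun a => Category.comp_id a)
  map_comp f g := GrpCat.hom_ext (MonoidHom.ext fun a => (Category.assoc a f g).symm)

/-- Morphisms of affine group schemes are the natural transformations. -/
instance : Category (GrpSch C) := inferInstanceAs (Category (InducedCategory _ points))

/-- The map of algebras representing a morphism of affine group schemes. -/
def rep {𝒢 ℋ : GrpSch C} (α : 𝒢 ⟶ ℋ) : ℋ.alg ⟶ 𝒢.alg :=
  (α.hom.app 𝒢.alg).hom (𝟙 𝒢.alg : 𝒢.alg ⟶ 𝒢.alg)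

theorem rep_comp_eq {𝒢 ℋ : GrpSch C} (α : 𝒢 ⟶ ℋ) {S : C} (a : 𝒢.alg ⟶ S) :
    rep α ≫ a = (α.hom.app S).hom a := by
  have h := congrArg (fun v => v.hom (𝟙 𝒢.alg : 𝒢.alg ⟶ 𝒢.alg)) (α.hom.naturality a)
  exact h.symm.trans (congrArg (α.hom.app S).hom (Category.id_comp a))

theorem rep_comp_mul {𝒢 ℋ : GrpSch C} (α : 𝒢 ⟶ ℋ) {S : C} (a b : 𝒢.alg ⟶ S) :
    rep α ≫ (a * b) = (rep α ≫ a) * (rep α ≫ b) := by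
  rw [rep_comp_eq, rep_comp_eq, rep_comp_eq]
  exact map_mul (α.hom.app S).hom a b

/-- The morphism of affine group schemes represented by a map of algebras. -/
def ofRep {𝒢 ℋ : GrpSch C} (c : ℋ.alg ⟶ 𝒢.alg)
    (hc : ∀ (S : C) (a b : 𝒢.alg ⟶ S), c ≫ (a * b) = (c ≫ a) * (c ≫ b)) : 𝒢 ⟶ ℋ :=
  InducedCategory.homMk
    { app := fun S => GrpCat.ofHom (MonoidHom.mk' (fun a : 𝒢.alg ⟶ S => c ≫ a) (hc S))
      naturality := fun _ _ f => GrpCat.hom_ext (MonoidHom.ext fun a => (Category.assoc c a f).symm) }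

theorem rep_ofRep {𝒢 ℋ : GrpSch C} (c : ℋ.alg ⟶ 𝒢.alg)
    (hc : ∀ (S : C) (a b : 𝒢.alg ⟶ S), c ≫ (a * b) = (c ≫ a) * (c ≫ b)) :
    rep (ofRep c hc) = c :=
  Category.comp_id c

theorem hom_ext_rep {𝒢 ℋ : GrpSch C} {α β : 𝒢 ⟶ ℋ} (h : rep α = rep β) : α = β := by
  refine InducedCategory.hom_ext (NatTrans.ext (funext fun S => GrpCat.hom_ext
    (MonoidHom.ext fun a => ?_)))
  exact (rep_comp_eq α a).symm.trans ((congrArg (· ≫ a) h).trans (rep_comp_eq β a))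

theorem rep_id (𝒢 : GrpSch C) : rep (𝟙 𝒢) = 𝟙 𝒢.alg := rfl

theorem rep_comp {𝒢 ℋ 𝒦 : GrpSch C} (α : 𝒢 ⟶ ℋ) (β : ℋ ⟶ 𝒦) :
    rep (α ≫ β) = rep β ≫ rep α :=
  (rep_comp_eq β (rep α)).symm

end

/-- The functor which takes an affine group scheme to its representing algebra. -/
def repFunctor (C : Type w) [Category.{v} C] : GrpSch C ⥤ Cᵒᵖ where
  obj 𝒢 := Opposite.op 𝒢.alg
  map α := (rep α).op
  map_id _ := rfl
  map_comp α β := congrArg Quiver.Hom.op (rep_comp α β)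

/-- The functor which takes an affine group scheme with an action of a group `G` to its
representing algebra, with the action for which `g` acts by the map representing `g⁻¹`. -/
def repActionFunctor (C : Type w) [Category.{v} C] (G : Type u) [Group G] :
    Action (GrpSch C) G ⥤ (Action C G)ᵒᵖ where
  obj 𝒜 := Opposite.op
    { V := 𝒜.V.alg
      ρ :=
        { toFun := fun g => rep (𝒜.ρ g⁻¹)
          map_one' := by rw [inv_one, map_one]; rfl
          map_mul' := fun g h => by
            rw [mul_inv_rev, map_mul]
            exact rep_comp _ _ } }
  map {𝒜 ℬ} α := Quiver.Hom.op
    { hom := rep α.hom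
      comm := fun g => by
        have h := congrArg rep (α.comm g⁻¹)
        rw [rep_comp, rep_comp] at h
        exact h.symm }
  map_id _ := rfl
  map_comp α β := congrArg Quiver.Hom.op (Action.hom_ext _ _ (rep_comp α.hom β.hom))

end GrpSch

/-! ### Evaluation of affine group schemes at `G/e` -/

section Evaluation

variable {G : Type u} [Group G] [Finite G] {F : Type u} [CommRing F]

theorem adjunct_comp (R : TAlg (const G F)) {S T : CommAlgCat.{u} F}
    (a : ((evAlg G F).obj R).V ⟶ S) (f : S ⟶ T) :
    adjunct R T (a ≫ f) = adjunct R S a ≫ (coindAlg G F).map f := rfl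

theorem adjunct_precomp {R R' : TAlg (const G F)} (c : R' ⟶ R) {S : CommAlgCat.{u} F}
    (a : ((evAlg G F).obj R).V ⟶ S) :
    adjunct R' S (((evAlg G F).map c).hom ≫ a) = c ≫ adjunct R S a :=
  Under.UnderMorphism.ext (TambaraFunctor.hom_ext fun _ b => funext fun x =>
    congrArg a.hom (c.right.res (orb x) b))

/-- The automorphism `φ ↦ φ (g • -)` of `CoInd_e^G S`. -/
noncomputable def coindShift (S : CommAlgCat.{u} F) (g : G) :
    (coindAlg G F).obj S ⟶ (coindAlg G F).obj S :=
  Under.homMk (U := (coindAlg G F).obj S) (V := (coindAlg G F).obj S)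
    ({ app := fun X => RingHom.pi fun x => Pi.evalRingHom (fun _ : X => (S : Type u)) (g • x)
       res := fun f φ => funext fun x => congrArg φ (map_smul f g x)
       tr := fun f φ => funext fun y => Eq.symm <| map_fibreSum (AddMonoidHom.id S) f f φ _ (fun x => g • x)
         (g • y) y (fun w hw => by rw [map_smul, hw]) (fun _ => rfl)
         fun x hx => ⟨g⁻¹ • x, ⟨by rw [map_smul, hx, inv_smul_smul], smul_inv_smul g x⟩,
           fun w hw => by rw [← hw.2, inv_smul_smul]⟩
       nm := fun f φ => funext fun y => Eq.symm <| map_fibreProd (MonoidHom.id S) f f φ _ (fun x => g • x)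
         (g • y) y (fun w hw => by rw [map_smul, hw]) (fun _ => rfl)
         fun x hx => ⟨g⁻¹ • x, ⟨by rw [map_smul, hx, inv_smul_smul], smul_inv_smul g x⟩,
           fun w hw => by rw [← hw.2, inv_smul_smul]⟩ } : coind G S ⟶ coind G S)
    (TambaraFunctor.hom_ext fun _ φ => funext fun x => congrArg (algebraMap F S) (φ.2 g x))

theorem adjunct_weyl (R : TAlg (const G F)) {S : CommAlgCat.{u} F}
    (a : ((evAlg G F).obj R).V ⟶ S) (g : G) :
    adjunct R S (((evAlg G F).obj R).ρ g ≫ a) = adjunct R S a ≫ coindShift S g :=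
  Under.UnderMorphism.ext (TambaraFunctor.hom_ext fun X b => funext fun x => congrArg a.hom (by
    change R.right.res (orb (X := free G) g) (R.right.res (orb x) b) = R.right.res (orb (g • x)) b
    rw [← R.right.res_comp, comp_orb]
    rfl))

/-- The affine group scheme over `F` represented by `R(G/e)`, for an affine group scheme
over the constant Tambara functor represented by `R`.  The group structure on its `S`-valued points
is the one of `Hom(R, CoInd_e^G S) ≅ Hom(R(G/e), S)`. -/
noncomputable def evGrpObj (𝒢 : GrpSch (TAlg (const G F))) : GrpSch (CommAlgCat.{u} F) where
  alg := ((evAlg G F).obj 𝒢.alg).V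
  grp S := (adjunct 𝒢.alg S).group
  mul_comp {S T} a b f := by
    let := fun S : CommAlgCat.{u} F => (adjunct 𝒢.alg S).group
    apply (adjunct 𝒢.alg T).injective
    rw [adjunct_comp, Equiv.mul_def, Equiv.mul_def, Equiv.apply_symm_apply,
      Equiv.apply_symm_apply, 𝒢.mul_comp, adjunct_comp, adjunct_comp]

theorem adjunct_mul (𝒢 : GrpSch (TAlg (const G F))) {S : CommAlgCat.{u} F}
    (a b : (evGrpObj 𝒢).alg ⟶ S) :
    adjunct 𝒢.alg S (a * b) = adjunct 𝒢.alg S a * adjunct 𝒢.alg S b :=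
  Equiv.apply_symm_apply _ _

/-- The morphism `ev_{G/e} 𝒢 → ev_{G/e} ℋ` induced by a morphism `𝒢 → ℋ`; it is represented by
the value at `G/e` of the map representing `𝒢 → ℋ`. -/
noncomputable def evGrpMap {𝒢 ℋ : GrpSch (TAlg (const G F))} (α : 𝒢 ⟶ ℋ) :
    evGrpObj 𝒢 ⟶ evGrpObj ℋ :=
  GrpSch.ofRep ((evAlg G F).map (GrpSch.rep α)).hom fun S a b => by
    apply (adjunct ℋ.alg S).injective
    refine (adjunct_precomp (GrpSch.rep α) (a * b)).trans ?_
    rw [adjunct_mul, adjunct_mul, GrpSch.rep_comp_mul]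
    exact congrArg₂ (· * ·) (adjunct_precomp _ a).symm (adjunct_precomp _ b).symm

/-- The action of `g : G` on `ev_{G/e} 𝒢`, given on points by composition with the
action of `g⁻¹` on `R(G/e)`. -/
noncomputable def evGrpAct (𝒢 : GrpSch (TAlg (const G F))) (g : G) : evGrpObj 𝒢 ⟶ evGrpObj 𝒢 :=
  GrpSch.ofRep (((evAlg G F).obj 𝒢.alg).ρ g⁻¹) fun S a b => by
    apply (adjunct 𝒢.alg S).injective
    refine (adjunct_weyl 𝒢.alg (a * b) g⁻¹).trans ?_
    rw [adjunct_mul, adjunct_mul, 𝒢.mul_comp]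
    exact congrArg₂ (· * ·) (adjunct_weyl 𝒢.alg a g⁻¹).symm (adjunct_weyl 𝒢.alg b g⁻¹).symm

theorem rep_evGrpAct (𝒢 : GrpSch (TAlg (const G F))) (g : G) :
    GrpSch.rep (evGrpAct 𝒢 g) = ((evAlg G F).obj 𝒢.alg).ρ g⁻¹ :=
  GrpSch.rep_ofRep _ _

theorem rep_evGrpMap {𝒢 ℋ : GrpSch (TAlg (const G F))} (α : 𝒢 ⟶ ℋ) :
    GrpSch.rep (evGrpMap α) = ((evAlg G F).map (GrpSch.rep α)).hom :=
  GrpSch.rep_ofRep _ _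

theorem evGrpAct_one (𝒢 : GrpSch (TAlg (const G F))) : evGrpAct 𝒢 (1 : G) = 𝟙 (evGrpObj 𝒢) := by
  apply GrpSch.hom_ext_rep
  refine (rep_evGrpAct 𝒢 1).trans ?_
  rw [inv_one, map_one]
  rfl

theorem evGrpAct_mul (𝒢 : GrpSch (TAlg (const G F))) (g h : G) :
    evGrpAct 𝒢 (g * h) = evGrpAct 𝒢 h ≫ evGrpAct 𝒢 g := by
  apply GrpSch.hom_ext_rep
  refine (rep_evGrpAct 𝒢 (g * h)).trans ?_
  rw [mul_inv_rev, map_mul, GrpSch.rep_comp]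
  exact (congrArg₂ (· ≫ ·) (rep_evGrpAct 𝒢 g) (rep_evGrpAct 𝒢 h)).symm

theorem evGrpAct_comm {𝒢 ℋ : GrpSch (TAlg (const G F))} (α : 𝒢 ⟶ ℋ) (g : G) :
    evGrpAct 𝒢 g ≫ evGrpMap α = evGrpMap α ≫ evGrpAct ℋ g := by
  apply GrpSch.hom_ext_rep
  rw [GrpSch.rep_comp, GrpSch.rep_comp]
  exact (((evAlg G F).map (GrpSch.rep α)).comm g⁻¹).symm

theorem evGrpMap_id (𝒢 : GrpSch (TAlg (const G F))) : evGrpMap (𝟙 𝒢) = 𝟙 (evGrpObj 𝒢) := by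
  apply GrpSch.hom_ext_rep
  refine (rep_evGrpMap (𝟙 𝒢)).trans ?_
  exact congrArg Action.Hom.hom ((evAlg G F).map_id 𝒢.alg)

theorem evGrpMap_comp {𝒢 ℋ 𝒦 : GrpSch (TAlg (const G F))} (α : 𝒢 ⟶ ℋ) (β : ℋ ⟶ 𝒦) :
    evGrpMap (α ≫ β) = evGrpMap α ≫ evGrpMap β := by
  apply GrpSch.hom_ext_rep
  rw [GrpSch.rep_comp]
  refine (rep_evGrpMap (α ≫ β)).trans ?_
  rw [GrpSch.rep_comp]
  exact congrArg Action.Hom.hom ((evAlg G F).map_comp (GrpSch.rep β) (GrpSch.rep α))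

/-- The functor `ev_{G/e}` from affine group schemes over the constant Tambara functor at
`F` to affine group schemes over `F` with an action of `G`. -/
noncomputable def evGrp (G : Type u) [Group G] [Finite G] (F : Type u) [CommRing F] :
    GrpSch (TAlg (const G F)) ⥤ Action (GrpSch (CommAlgCat.{u} F)) G where
  obj 𝒢 :=
    { V := evGrpObj 𝒢
      ρ :=
        { toFun := evGrpAct 𝒢
          map_one' := evGrpAct_one 𝒢
          map_mul' := evGrpAct_mul 𝒢 } }
  map α :=
    { hom := evGrpMap α
      comm := evGrpAct_comm α }
  map_id 𝒢 := Action.hom_ext _ _ (evGrpMap_id 𝒢)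
  map_comp α β := Action.hom_ext _ _ (evGrpMap_comp α β)

end Evaluation

/-! ### Finite étale affine group schemes -/

section FiniteEtale

/-- Finite affine étale group schemes over a Tambara functor `k`. -/
def finEtTamb {G : Type u} [Group G] (k : TambaraFunctor G) : ObjectProperty (GrpSch (TAlg k)) :=
  fun 𝒢 => TAlg.IsFinite 𝒢.alg ∧ TAlg.IsEtale 𝒢.alg

/-- Finite affine étale group schemes over a ring `F`. -/
def finEt (F : Type u) [CommRing F] : ObjectProperty (GrpSch (CommAlgCat.{u} F)) :=
  fun 𝒢 => Module.Finite F 𝒢.alg ∧ Algebra.Etale F 𝒢.alg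

/-- The category of finite affine étale group schemes over a Tambara functor `k`. -/
abbrev FinEtGrpTamb {G : Type u} [Group G] (k : TambaraFunctor G) := (finEtTamb k).FullSubcategory

/-- The category of finite affine étale group schemes over a ring `F`. -/
abbrev FinEtGrp (F : Type u) [CommRing F] := (finEt F).FullSubcategory

variable (G : Type u) [Group G] [Finite G] (F : Type u) [CommRing F]

/-- `ev_{G/e}` preserves finite affine étale group schemes. -/
def EvPreservesFinEt : Prop :=
  ∀ 𝒢 : GrpSch (TAlg (const G F)), finEtTamb (const G F) 𝒢 → finEt F ((evGrp G F).obj 𝒢).V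

variable {G F}

/-- The functor `ev_{G/e}` from finite affine étale group schemes over the constant
Tambara functor at `F` to finite affine étale group schemes over `F` with an action of `G`. -/
noncomputable def evFinEt (h : EvPreservesFinEt G F) :
    FinEtGrpTamb (const G F) ⥤ Action (FinEtGrp F) G where
  obj 𝒢 :=
    { V := ⟨((evGrp G F).obj 𝒢.obj).V, h 𝒢.obj 𝒢.property⟩
      ρ :=
        { toFun := fun g => ObjectProperty.homMk (((evGrp G F).obj 𝒢.obj).ρ g)
          map_one' := by rw [map_one]; rfl
          map_mul' := fun _ _ => by rw [map_mul]; rfl } }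
  map α :=
    { hom := ObjectProperty.homMk ((evGrp G F).map α.hom).hom
      comm := fun g => ObjectProperty.hom_ext _ (((evGrp G F).map α.hom).comm g) }
  map_id 𝒢 := Action.hom_ext _ _ (ObjectProperty.hom_ext _
    (congrArg Action.Hom.hom ((evGrp G F).map_id 𝒢.obj)))
  map_comp α β := Action.hom_ext _ _ (ObjectProperty.hom_ext _
    (congrArg Action.Hom.hom ((evGrp G F).map_comp α.hom β.hom)))

/-- The algebra representing a finite affine étale group scheme over a Tambara functor. -/
def repTamb {G : Type u} [Group G] (k : TambaraFunctor G) : FinEtGrpTamb k ⥤ (TAlg k)ᵒᵖ :=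
  (finEtTamb k).ι ⋙ GrpSch.repFunctor (TAlg k)

variable (G F)

/-- The algebra with `G`-action representing a finite affine étale group scheme with `G`-action. -/
def repAct : Action (FinEtGrp F) G ⥤ (Action (CommAlgCat.{u} F) G)ᵒᵖ :=
  (finEt F).ι.mapAction G ⋙ GrpSch.repActionFunctor (CommAlgCat.{u} F) G

end FiniteEtale

end Tamb

open CategoryTheory Tamb

namespace Tamb

open CategoryTheory

section ProductSets

variable {G : Type u} [Group G]

/-- The product of two finite `G`-sets. -/
abbrev FinGSet.prod (X Y : FinGSet G) : FinGSet G := ⟨X.carrier × Y.carrier⟩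

/-- The first projection. -/
def fstMap (T X : FinGSet G) : T.prod X →[G] T := ⟨Prod.fst, fun _ _ => rfl⟩

/-- The second projection. -/
def sndMap (T X : FinGSet G) : T.prod X →[G] X := ⟨Prod.snd, fun _ _ => rfl⟩

/-- The map `T × f`. -/
def timesMap (T : FinGSet G) {X Y : FinGSet G} (f : X →[G] Y) : T.prod X →[G] T.prod Y :=
  ⟨fun p => (p.1, f p.2), fun g p => Prod.ext rfl (map_smul f g p.2)⟩

/-- The map `f × X`. -/
def mapTimes {S T : FinGSet G} (f : S →[G] T) (X : FinGSet G) : S.prod X →[G] T.prod X :=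
  ⟨fun p => (f p.1, p.2), fun g p => Prod.ext (map_smul f g p.1) rfl⟩

/-- The diagonal. -/
def diagMap (T : FinGSet G) : T →[G] T.prod T := ⟨fun t => (t, t), fun _ _ => rfl⟩

/-- The graph of the first projection `T × X → T`. -/
def graphMap (T X : FinGSet G) : T.prod X →[G] T.prod (T.prod X) :=
  ⟨fun p => (p.1, p), fun _ _ => rfl⟩

/-- The one-point `G`-set. -/
def point (G : Type u) [Group G] : FinGSet G where
  carrier := PUnit.{u + 1}
  action := { smul := fun _ x => x, one_smul := fun _ => rfl, mul_smul := fun _ _ _ => rfl }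
  finite := inferInstance

/-- The map to the one-point `G`-set. -/
def toPoint (X : FinGSet G) : X →[G] point G := ⟨fun _ => PUnit.unit, fun _ _ => rfl⟩

theorem IsPullbackSq.symm {W X Y Z : FinGSet G} {p : W →[G] X} {q : W →[G] Y}
    {f : X →[G] Z} {g : Y →[G] Z} (h : IsPullbackSq p q f g) : IsPullbackSq q p g f :=
  ⟨fun w => (h.1 w).symm, fun x y hxy => by simpa only [and_comm] using h.2 y x hxy.symm⟩

theorem IsPullbackSq.times (T : FinGSet G) {W X Y Z : FinGSet G} {p : W →[G] X} {q : W →[G] Y}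
    {f : X →[G] Z} {g : Y →[G] Z} (h : IsPullbackSq p q f g) :
    IsPullbackSq (timesMap T p) (timesMap T q) (timesMap T f) (timesMap T g) := by
  refine ⟨fun w => Prod.ext rfl (h.1 w.2), fun x y hxy => ?_⟩
  obtain ⟨w, ⟨h1, h2⟩, h3⟩ := h.2 x.2 y.2 ((congrArg Prod.snd hxy :))
  refine ⟨(x.1, w), ⟨Prod.ext rfl h1, Prod.ext ((congrArg Prod.fst hxy :)) h2⟩, ?_⟩
  rintro ⟨t, w'⟩ ⟨h1', h2'⟩
  exact Prod.ext ((congrArg Prod.fst h1' :)) (h3 w' ⟨(congrArg Prod.snd h1' :), (congrArg Prod.snd h2' :)⟩)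

theorem isPullback_snd (T : FinGSet G) {X Y : FinGSet G} (f : X →[G] Y) :
    IsPullbackSq (sndMap T X) (timesMap T f) f (sndMap T Y) :=
  ⟨fun _ => rfl, fun x y h => ⟨(y.1, x), ⟨rfl, Prod.ext rfl h⟩,
    fun _ hw => Prod.ext ((congrArg Prod.fst hw.2 :)) hw.1⟩⟩

theorem isPullback_mapTimes {S T : FinGSet G} (t : S →[G] T) {X Y : FinGSet G} (f : X →[G] Y) :
    IsPullbackSq (mapTimes t X) (timesMap S f) (timesMap T f) (mapTimes t Y) := by
  refine ⟨fun _ => rfl, fun x y h => ?_⟩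
  have h1 : x.1 = t y.1 := congrArg Prod.fst h
  have h2 : f x.2 = y.2 := congrArg Prod.snd h
  exact ⟨(y.1, x.2), ⟨Prod.ext h1.symm rfl, Prod.ext rfl h2⟩,
    fun w hw => Prod.ext (congrArg Prod.fst hw.2 :) (congrArg Prod.snd hw.1 :)⟩

theorem isPullback_graph (T X : FinGSet G) :
    IsPullbackSq (fstMap T X) (graphMap T X) (diagMap T) (timesMap T (fstMap T X)) :=
  ⟨fun _ => rfl, fun _ y h => ⟨y.2, ⟨(congrArg Prod.snd h).symm,
    Prod.ext ((congrArg Prod.snd h).symm.trans (congrArg Prod.fst h)) rfl⟩,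
    fun _ hw => (congrArg Prod.snd hw.2 :)⟩⟩

/-- Products with a `G`-set preserve decompositions. -/
theorem times_cover (T : FinGSet G) {J : Type u} {X : J → FinGSet G} {Y : FinGSet G}
    {i : ∀ j, X j →[G] Y} (hi : ∀ y, ∃! x : Σ j, X j, i x.1 x.2 = y) (y : T.prod Y) :
    ∃! x : Σ j, T.prod (X j), timesMap T (i x.1) x.2 = y := by
  obtain ⟨⟨j, x⟩, h1, h2⟩ := hi y.2
  refine ⟨⟨j, (y.1, x)⟩, Prod.ext rfl h1, ?_⟩
  rintro ⟨j', t, x'⟩ h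
  obtain ⟨rfl, h3⟩ := Sigma.mk.inj_iff.mp (h2 ⟨j', x'⟩ (congrArg Prod.snd h))
  obtain rfl := eq_of_heq h3
  obtain rfl : t = y.1 := congrArg Prod.fst h
  rfl

end ProductSets

namespace TModule

variable {G : Type u} [Group G] {k : TambaraFunctor G}

/-- The class of the symbol `[f, m, n]` in the box product. -/
def box {M N : TModule k} {X Y : FinGSet G} (f : Y →[G] X) (m : M.obj Y) (n : N.obj Y) :
    Box M N X :=
  QuotientAddGroup.mk (sym f m n)

section Box

variable {M N : TModule k} {X Y Z : FinGSet G}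

theorem box_eq {a b : FreeAbelianGroup (BoxGen M N X)} (h : BoxRel M N X (a - b)) :
    (QuotientAddGroup.mk a : Box M N X) = QuotientAddGroup.mk b := by
  rw [QuotientAddGroup.eq, neg_add_eq_sub, ← neg_sub]
  exact neg_mem (AddSubgroup.subset_closure h)

theorem box_add_left (f : Y →[G] X) (m m' : M.obj Y) (n : N.obj Y) :
    box f (m + m') n = box f m n + box f m' n := box_eq (BoxRel.add_left f m m' n)

theorem box_add_right (f : Y →[G] X) (m : M.obj Y) (n n' : N.obj Y) :
    box f m (n + n') = box f m n + box f m n' := box_eq (BoxRel.add_right f m n n')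

theorem box_smul (f : Y →[G] X) (c : k.obj Y) (m : M.obj Y) (n : N.obj Y) :
    box f (c • m) n = box f m (c • n) := box_eq (BoxRel.smul f c m n)

theorem box_tr_left (f : Y →[G] X) (g : Z →[G] Y) (m : M.obj Z) (n : N.obj Y) :
    box f (M.tr g m) n = box (f.comp g) m (N.res g n) := box_eq (BoxRel.tr_left f g m n)

theorem box_tr_right (f : Y →[G] X) (g : Z →[G] Y) (m : M.obj Y) (n : N.obj Z) :
    box f m (N.tr g n) = box (f.comp g) (M.res g m) n := box_eq (BoxRel.tr_right f g m n)

/-- Additive maps out of a box product which agree on symbols are equal. -/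
theorem box_hom_ext {A : Type*} [AddCommGroup A] {φ ψ : Box M N X →+ A}
    (h : ∀ (Y : FinGSet G) (f : Y →[G] X) (m : M.obj Y) (n : N.obj Y),
      φ (box f m n) = ψ (box f m n)) : φ = ψ :=
  QuotientAddGroup.addMonoidHom_ext _ (FreeAbelianGroup.lift_ext _ _ fun s => h s.src s.map s.left s.right)

theorem boxMap_box (M : TModule k) {N N' : TModule k} (φ : Hom N N') (f : Y →[G] X)
    (m : M.obj Y) (n : N.obj Y) : boxMap M φ X (box f m n) = box f m (φ.app Y n) :=
  congrArg _ (symMap_sym M φ f m n)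

/-- Additive maps out of a box product. -/
def boxLift {A : Type*} [AddCommGroup A]
    (φ : ∀ (Y : FinGSet G), (Y →[G] X) → M.obj Y → N.obj Y → A)
    (h₁ : ∀ {Y} f m m' n, φ Y f (m + m') n = φ Y f m n + φ Y f m' n)
    (h₂ : ∀ {Y} f m n n', φ Y f m (n + n') = φ Y f m n + φ Y f m n')
    (h₃ : ∀ {Y} f (c : k.obj Y) m n, φ Y f (c • m) n = φ Y f m (c • n))
    (h₄ : ∀ {Y Z : FinGSet G} f (g : Z →[G] Y) m n, φ Y f (M.tr g m) n = φ Z (f.comp g) m (N.res g n))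
    (h₅ : ∀ {Y Z : FinGSet G} f (g : Z →[G] Y) m n, φ Y f m (N.tr g n) = φ Z (f.comp g) (M.res g m) n) :
    Box M N X →+ A :=
  QuotientAddGroup.lift _ (FreeAbelianGroup.lift fun s => φ s.src s.map s.left s.right) <| by
    have key : ∀ {Y : FinGSet G} (f : Y →[G] X) (m : M.obj Y) (n : N.obj Y),
        FreeAbelianGroup.lift (fun s : BoxGen M N X => φ s.src s.map s.left s.right)
          (sym f m n) = φ Y f m n := fun f m n => FreeAbelianGroup.lift_apply_of _ _
    refine (AddSubgroup.closure_le _).mpr fun r h => ?_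
    rw [SetLike.mem_coe, AddMonoidHom.mem_ker]
    cases h with
    | add_left f m m' n => rw [map_sub, map_add, sub_eq_zero, key, key, key, h₁]
    | add_right f m n n' => rw [map_sub, map_add, sub_eq_zero, key, key, key, h₂]
    | smul f c m n => rw [map_sub, sub_eq_zero, key, key, h₃]
    | tr_left f g m n => rw [map_sub, sub_eq_zero, key, key, h₄]
    | tr_right f g m n => rw [map_sub, sub_eq_zero, key, key, h₅]

theorem boxLift_box {A : Type*} [AddCommGroup A]
    {φ : ∀ (Y : FinGSet G), (Y →[G] X) → M.obj Y → N.obj Y → A} (h₁ h₂ h₃ h₄ h₅) (f : Y →[G] X)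
    (m : M.obj Y) (n : N.obj Y) : boxLift φ h₁ h₂ h₃ h₄ h₅ (box f m n) = φ Y f m n :=
  FreeAbelianGroup.lift_apply_of _ _

/-- The symmetry of the box product. -/
def boxSwap (M N : TModule k) (X : FinGSet G) : Box M N X →+ Box N M X :=
  boxLift (fun _ f m n => box f n m) (fun _ _ _ _ => box_add_right _ _ _ _)
    (fun _ _ _ _ => box_add_left _ _ _ _) (fun _ _ _ _ => (box_smul _ _ _ _).symm)
    (fun _ _ _ _ => box_tr_right _ _ _ _) fun _ _ _ _ => box_tr_left _ _ _ _

theorem boxSwap_box (f : Y →[G] X) (m : M.obj Y) (n : N.obj Y) :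
    boxSwap M N X (box f m n) = box f n m := boxLift_box _ _ _ _ _ f m n

end Box

/-! #### The modules `k(T × -)` -/

/-- The module `k(T × -)`. -/
def cotensor (k : TambaraFunctor G) (T : FinGSet G) : TModule k where
  obj X := k.obj (T.prod X)
  module X := Module.compHom _ (k.res (sndMap T X))
  res f := (k.res (timesMap T f)).toAddMonoidHom
  tr f := k.tr (timesMap T f)
  res_id a := k.res_id a
  res_comp g f a := k.res_comp (timesMap T g) (timesMap T f) a
  tr_id a := k.tr_id a
  tr_comp g f a := k.tr_comp (timesMap T g) (timesMap T f) a
  additive i hi := k.additive (fun j => timesMap T (i j)) (times_cover T hi)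
  res_tr h a := k.res_tr (h.times T) a
  res_smul {X Y} f c a := by
    change k.res (timesMap T f) (k.res (sndMap T Y) c * a) =
      k.res (sndMap T X) (k.res f c) * k.res (timesMap T f) a
    rw [map_mul, ← k.res_comp, ← k.res_comp]
    rfl
  tr_smul_res {X Y} f c a := by
    change k.tr (timesMap T f) (k.res (sndMap T X) c * k.res (timesMap T f) a) =
      k.res (sndMap T Y) (k.tr f c) * a
    rw [k.frobenius, k.res_tr (isPullback_snd T f)]
  tr_res_smul {X Y} f c a := by
    change k.tr (timesMap T f) (k.res (sndMap T X) (k.res f c) * a) =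
      k.res (sndMap T Y) c * k.tr (timesMap T f) a
    rw [← k.res_comp, mul_comm, mul_comm (k.res _ c), ← k.frobenius, ← k.res_comp]
    rfl

/-- The map `k(T × -) → k(S × -)` induced by `S → T`. -/
def cotensorMap (k : TambaraFunctor G) {S T : FinGSet G} (t : S →[G] T) :
    Hom (cotensor k T) (cotensor k S) where
  app X :=
    { toFun := k.res (mapTimes t X)
      map_add' := map_add _
      map_smul' := fun c (a : k.obj (T.prod X)) => by
        change k.res (mapTimes t X) (k.res (sndMap T X) c * a) =
          k.res (sndMap S X) c * k.res (mapTimes t X) a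
        rw [map_mul, ← k.res_comp]
        rfl }
  res {X Y} f a :=
    (k.res_comp (timesMap T f) (mapTimes t X) a).symm.trans
      (k.res_comp (mapTimes t Y) (timesMap S f) a)
  tr f a := k.res_tr (isPullback_mapTimes t f) a

section Coordinates

variable {K : TModule k} {T : FinGSet G} (ι : Hom K (cotensor k T))

/-- The coordinate function in `k(T × X)` of an element of `K(X)`. -/
def coord {X : FinGSet G} (a : K.obj X) : k.obj (T.prod X) := ι.app X a

theorem coord_add {X : FinGSet G} (a b : K.obj X) : coord ι (a + b) = coord ι a + coord ι b :=
  map_add (ι.app X) a b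

theorem coord_smul {X : FinGSet G} (c : k.obj X) (a : K.obj X) :
    coord ι (c • a) = k.res (sndMap T X) c * coord ι a :=
  map_smul (ι.app X) c a

theorem coord_res {X Y : FinGSet G} (f : X →[G] Y) (a : K.obj Y) :
    coord ι (K.res f a) = k.res (timesMap T f) (coord ι a) := ι.res f a

theorem coord_tr {X Y : FinGSet G} (f : X →[G] Y) (a : K.obj X) :
    coord ι (K.tr f a) = k.tr (timesMap T f) (coord ι a) := ι.tr f a

/-- The map `(K ⊠ N)(X) → N(T × X)` for a module `K` over `k(T × -)`. -/
def boxCoord (N : TModule k) (X : FinGSet G) : Box K N X →+ N.obj (T.prod X) :=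
  boxLift (fun Y f a n => N.tr (timesMap T f) (coord ι a • N.res (sndMap T Y) n))
    (fun _ _ _ _ => by rw [coord_add, add_smul, map_add])
    (fun _ _ _ _ => by rw [map_add, smul_add, map_add])
    (fun _ _ _ _ => by rw [coord_smul, N.res_smul, smul_smul, mul_comm])
    (fun f g m n => by
      rw [coord_tr, ← N.tr_smul_res, ← N.tr_comp, ← N.res_comp, ← N.res_comp]
      rfl)
    fun f g m n => by
      rw [N.res_tr (isPullback_snd T g), ← N.tr_res_smul, ← N.tr_comp, ← coord_res]
      rfl

theorem boxCoord_box (N : TModule k) {X Y : FinGSet G} (f : Y →[G] X) (a : K.obj Y)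
    (n : N.obj Y) : boxCoord ι N X (box f a n) =
      N.tr (timesMap T f) (coord ι a • N.res (sndMap T Y) n) :=
  boxLift_box _ _ _ _ _ f a n

theorem boxCoord_boxMap {N N' : TModule k} (φ : Hom N N') (X : FinGSet G) (z : Box K N X) :
    boxCoord ι N' X (boxMap K φ X z) = φ.app _ (boxCoord ι N X z) := by
  refine DFunLike.congr_fun (box_hom_ext (φ := (boxCoord ι N' X).comp (boxMap K φ X))
    (ψ := (φ.app _).toAddMonoidHom.comp (boxCoord ι N X)) fun Y f m n => ?_) z
  simp only [AddMonoidHom.comp_apply, boxMap_box, boxCoord_box, LinearMap.toAddMonoidHom_coe,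
    φ.tr, map_smul, φ.res]

variable {ι} {e : K.obj T}

theorem coord_res_fst (he : coord ι e = k.tr (diagMap T) 1) (X : FinGSet G) :
    coord ι (K.res (fstMap T X) e) = k.tr (graphMap T X) 1 := by
  rw [coord_res, he, k.res_tr (isPullback_graph T X), map_one]

/-- An element of `K` is recovered from its coordinate function. -/
theorem reconstruct (hι : ∀ X, Function.Injective (ι.app X))
    (he : coord ι e = k.tr (diagMap T) 1) {X : FinGSet G} (a : K.obj X) :
    K.tr (sndMap T X) (coord ι a • K.res (fstMap T X) e) = a := by
  apply hι X
  change coord ι _ = coord ι a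
  have h := k.frobenius (graphMap T X) 1 (k.res (sndMap T (T.prod X)) (coord ι a))
  rw [one_mul] at h
  rw [coord_tr, coord_smul, coord_res_fst he, mul_comm, ← h, ← k.tr_comp, ← k.res_comp]
  exact (k.tr_id _).trans (k.res_id _)

theorem boxCoord_section (he : coord ι e = k.tr (diagMap T) 1) (N : TModule k) {X : FinGSet G}
    (n : N.obj (T.prod X)) :
    boxCoord ι N X (box (sndMap T X) (K.res (fstMap T X) e) n) = n := by
  have h := N.tr_smul_res (graphMap T X) 1 (N.res (sndMap T (T.prod X)) n)
  rw [one_smul] at h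
  rw [boxCoord_box, coord_res_fst he, ← h, ← N.tr_comp, ← N.res_comp]
  exact (N.tr_id _).trans (N.res_id _)

theorem section_boxCoord (hι : ∀ X, Function.Injective (ι.app X))
    (he : coord ι e = k.tr (diagMap T) 1) (N : TModule k) {X : FinGSet G} (z : Box K N X) :
    box (sndMap T X) (K.res (fstMap T X) e) (boxCoord ι N X z) = z := by
  refine DFunLike.congr_fun (box_hom_ext (φ := (AddMonoidHom.mk'
    (fun n : N.obj (T.prod X) => box (sndMap T X) (K.res (fstMap T X) e) n)
    (box_add_right _ _)).comp (boxCoord ι N X)) (ψ := AddMonoidHom.id _) fun Y f m n => ?_) z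
  change box (sndMap T X) (K.res (fstMap T X) e) (boxCoord ι N X (box f m n)) = box f m n
  rw [boxCoord_box, box_tr_right, ← K.res_comp, ← box_smul]
  change box (f.comp (sndMap T Y)) (coord ι m • K.res (fstMap T Y) e) _ = _
  rw [← box_tr_left, reconstruct hι he]

theorem boxCoord_bijective (hι : ∀ X, Function.Injective (ι.app X))
    (he : coord ι e = k.tr (diagMap T) 1) (N : TModule k) (X : FinGSet G) :
    Function.Bijective (boxCoord ι N X) :=
  ⟨Function.LeftInverse.injective (section_boxCoord hι he N), fun n => ⟨_, boxCoord_section he N n⟩⟩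

/-- Modules isomorphic to `k(T × -)` are flat. -/
theorem flat_of_coord (hι : ∀ X, Function.Injective (ι.app X))
    (he : coord ι e = k.tr (diagMap T) 1) : K.Flat := by
  intro N₁ N₂ N₃ f g hfg X
  have b := fun N => boxCoord_bijective hι he N X
  refine ⟨fun x y h => ?_, fun y => ⟨fun h => ?_, ?_⟩, fun z => ?_⟩
  · apply (b N₁).1
    apply hfg.injective
    rw [← boxCoord_boxMap, ← boxCoord_boxMap, h]
  · have h1 := congrArg (boxCoord ι N₃ X) h
    rw [boxCoord_boxMap, map_zero] at h1
    obtain ⟨x, hx⟩ := (hfg.exact _ _).mp h1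
    obtain ⟨z, rfl⟩ := (b N₁).2 x
    exact ⟨z, (b N₂).1 ((boxCoord_boxMap ι f X z).trans hx)⟩
  · rintro ⟨x, rfl⟩
    apply (b N₃).1
    rw [boxCoord_boxMap, boxCoord_boxMap, map_zero]
    exact (hfg.exact _ _).mpr ⟨_, rfl⟩
  · obtain ⟨y, hy⟩ := hfg.surjective _ (boxCoord ι N₃ X z)
    obtain ⟨w, rfl⟩ := (b N₂).2 y
    exact ⟨w, (b N₃).1 ((boxCoord_boxMap ι g X w).trans hy)⟩

/-- Modules isomorphic to `k(T × -)` are finitely generated. -/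
theorem finitelyGenerated_of_coord (hι : ∀ X, Function.Injective (ι.app X))
    (he : coord ι e = k.tr (diagMap T) 1) : K.FinitelyGenerated := by
  refine ⟨1, fun _ => T, fun _ => e, fun Y a => ?_⟩
  rw [← reconstruct hι he a]
  exact .tr _ (.smul _ (.res _ (.gen 0)))

end Coordinates

end TModule

end Tamb

namespace Tamb

open CategoryTheory

namespace TModule

variable {G : Type u} [Group G] {k : TambaraFunctor G}

/-! #### Cokernels and left exactness -/

namespace Hom

/-- The identity. -/
def id (M : TModule k) : Hom M M := ⟨fun _ => LinearMap.id, fun _ _ => rfl, fun _ _ => rfl⟩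

/-- The difference of two morphisms. -/
def sub {M N : TModule k} (φ ψ : Hom M N) : Hom M N where
  app X := φ.app X - ψ.app X
  res f a := by simp [φ.res, ψ.res]
  tr f a := by simp [φ.tr, ψ.tr]

section Coker

variable {L M N : TModule k} (φ : Hom L M)

theorem range_le_comap_res {X Y : FinGSet G} (f : X →[G] Y) :
    (LinearMap.range (φ.app Y)).toAddSubgroup ≤
      (LinearMap.range (φ.app X)).toAddSubgroup.comap (M.res f) := by
  rintro _ ⟨a, rfl⟩
  exact ⟨L.res f a, φ.res f a⟩

theorem range_le_comap_tr {X Y : FinGSet G} (f : X →[G] Y) :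
    (LinearMap.range (φ.app X)).toAddSubgroup ≤
      (LinearMap.range (φ.app Y)).toAddSubgroup.comap (M.tr f) := by
  rintro _ ⟨a, rfl⟩
  exact ⟨L.tr f a, φ.tr f a⟩

theorem mkQ_surj {X : FinGSet G} (a : M.obj X ⧸ LinearMap.range (φ.app X)) :
    ∃ b, Submodule.Quotient.mk b = a := Submodule.Quotient.mk_surjective _ a

/-- The cokernel of a morphism of modules. -/
def coker : TModule k where
  obj X := M.obj X ⧸ LinearMap.range (φ.app X)
  res f := QuotientAddGroup.map _ _ (M.res f) (φ.range_le_comap_res f)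
  tr f := QuotientAddGroup.map _ _ (M.tr f) (φ.range_le_comap_tr f)
  res_id a := by
    obtain ⟨b, rfl⟩ := φ.mkQ_surj a
    exact congrArg Submodule.Quotient.mk (M.res_id b)
  res_comp g f a := by
    obtain ⟨b, rfl⟩ := φ.mkQ_surj a
    exact congrArg Submodule.Quotient.mk (M.res_comp g f b)
  tr_id a := by
    obtain ⟨b, rfl⟩ := φ.mkQ_surj a
    exact congrArg Submodule.Quotient.mk (M.tr_id b)
  tr_comp g f a := by
    obtain ⟨b, rfl⟩ := φ.mkQ_surj a
    exact congrArg Submodule.Quotient.mk (M.tr_comp g f b)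
  additive {J _ X Y} i hi := by
    constructor
    · rw [Function.Injective]
      intro a a' h
      obtain ⟨b, rfl⟩ := φ.mkQ_surj a
      obtain ⟨b', rfl⟩ := φ.mkQ_surj a'
      have h1 : ∀ j, ∃ c, φ.app (X j) c = M.res (i j) (b - b') := fun j => by
        have := (Submodule.Quotient.eq _).mp (congrFun h j)
        rwa [← map_sub] at this
      choose c hc using h1
      obtain ⟨d, hd⟩ := (L.additive i hi).2 c
      refine (Submodule.Quotient.eq _).mpr ⟨d, (M.additive i hi).1 (funext fun j => ?_)⟩
      change M.res (i j) _ = M.res (i j) _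
      rw [← hc, ← congrFun hd j, φ.res]
    · intro a
      choose b hb using fun j => φ.mkQ_surj (a j)
      obtain ⟨d, hd⟩ := (M.additive i hi).2 b
      exact ⟨Submodule.Quotient.mk d, funext fun j =>
        (congrArg Submodule.Quotient.mk (congrFun hd j)).trans (hb j)⟩
  res_tr h a := by
    obtain ⟨b, rfl⟩ := φ.mkQ_surj a
    exact congrArg Submodule.Quotient.mk (M.res_tr h b)
  res_smul f c a := by
    obtain ⟨b, rfl⟩ := φ.mkQ_surj a
    exact congrArg Submodule.Quotient.mk (M.res_smul f c b)
  tr_smul_res f c a := by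
    obtain ⟨b, rfl⟩ := φ.mkQ_surj a
    exact congrArg Submodule.Quotient.mk (M.tr_smul_res f c b)
  tr_res_smul f c a := by
    obtain ⟨b, rfl⟩ := φ.mkQ_surj a
    exact congrArg Submodule.Quotient.mk (M.tr_res_smul f c b)

/-- The projection to the cokernel. -/
def toCoker : Hom M φ.coker := ⟨fun _ => Submodule.mkQ _, fun _ _ => rfl, fun _ _ => rfl⟩

/-- The map out of the cokernel. -/
def cokerDesc (ψ : Hom M N) (h : ∀ X a, ψ.app X (φ.app X a) = 0) : Hom φ.coker N where
  app X := Submodule.liftQ _ (ψ.app X) (by rintro _ ⟨a, rfl⟩; exact h X a)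
  res f a := by
    obtain ⟨b, rfl⟩ := φ.mkQ_surj a
    exact ψ.res f b
  tr f a := by
    obtain ⟨b, rfl⟩ := φ.mkQ_surj a
    exact ψ.tr f b

theorem shortExact_coker (h : ∀ X, Function.Injective (φ.app X)) : ShortExact φ φ.toCoker :=
  ⟨h, fun X => LinearMap.exact_map_mkQ_range (φ.app X), fun _ => Submodule.mkQ_surjective _⟩

end Coker

end Hom

/-- Flat modules preserve injectivity. -/
theorem Flat.injective {M : TModule k} (hM : M.Flat) {N N' : TModule k} {φ : Hom N N'}
    (h : ∀ X, Function.Injective (φ.app X)) (X : FinGSet G) :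
    Function.Injective (boxMap M φ X) :=
  (hM _ _ _ _ _ (φ.shortExact_coker h) X).1

/-- Flat modules preserve kernels. -/
theorem Flat.exact {M : TModule k} (hM : M.Flat) {N₁ N₂ N₃ : TModule k} {φ : Hom N₁ N₂}
    {ψ : Hom N₂ N₃} (h : ∀ X, Function.Injective (φ.app X))
    (h' : ∀ X, Function.Exact (φ.app X) (ψ.app X)) (X : FinGSet G) {z : Box M N₂ X}
    (hz : boxMap M ψ X z = 0) : ∃ w, boxMap M φ X w = z := by
  refine ((hM _ _ _ _ _ (φ.shortExact_coker h) X).2.1 z).mp ?_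
  have hψ : ∀ X a, ψ.app X (φ.app X a) = 0 := fun X a => (h' X _).mpr ⟨a, rfl⟩
  refine hM.injective (φ := φ.cokerDesc ψ hψ) (fun Y => ?_) X ?_
  · refine (injective_iff_map_eq_zero _).mpr fun a ha => ?_
    obtain ⟨b, rfl⟩ := φ.mkQ_surj a
    exact (Submodule.Quotient.mk_eq_zero _).mpr ((h' Y b).mp ha)
  · rw [map_zero, ← hz]
    exact DFunLike.congr_fun (box_hom_ext
      (φ := (boxMap M (φ.cokerDesc ψ hψ) X).comp (boxMap M φ.toCoker X))
      (ψ := boxMap M ψ X) fun Y f m n => by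
        simp only [AddMonoidHom.comp_apply, boxMap_box]
        rfl) z

/-! #### Box products with `k(T × -)` -/

/-- The isomorphism `(M ⊠ k(T × -))(X) → M(T × X)`. -/
def boxCotensor (M : TModule k) (T X : FinGSet G) :
    Box M (cotensor k T) X →+ M.obj (T.prod X) :=
  (boxCoord (Hom.id (cotensor k T)) M X).comp (boxSwap M (cotensor k T) X)

theorem boxCotensor_box (M : TModule k) {T X Y : FinGSet G} (f : Y →[G] X) (m : M.obj Y)
    (a : k.obj (T.prod Y)) :
    boxCotensor M T X (box (N := cotensor k T) f m a) =
      M.tr (timesMap T f) (a • M.res (sndMap T Y) m) :=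
  (congrArg _ (boxSwap_box (N := cotensor k T) f m a)).trans
    (boxCoord_box (Hom.id (cotensor k T)) M f a m)

theorem boxCotensor_bijective (M : TModule k) (T X : FinGSet G) :
    Function.Bijective (boxCotensor M T X) := by
  have hs : ∀ {M N : TModule k} (z : Box M N X), boxSwap N M X (boxSwap M N X z) = z :=
    fun {M N} z => DFunLike.congr_fun (box_hom_ext
      (φ := (boxSwap N M X).comp (boxSwap M N X)) (ψ := AddMonoidHom.id _) fun Y f m n => by
        simp only [AddMonoidHom.comp_apply, boxSwap_box, AddMonoidHom.id_apply]) z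
  exact (boxCoord_bijective (ι := Hom.id (cotensor k T)) (e := k.tr (diagMap T) 1)
    (fun _ => Function.injective_id) rfl M X).comp
    (Function.bijective_iff_has_inverse.mpr ⟨_, hs, hs⟩)

theorem boxCotensor_cotensorMap (M : TModule k) {S T : FinGSet G} (t : S →[G] T) (X : FinGSet G)
    (z : Box M (cotensor k T) X) :
    boxCotensor M S X (boxMap M (cotensorMap k t) X z) =
      M.res (mapTimes t X) (boxCotensor M T X z) := by
  refine DFunLike.congr_fun (box_hom_ext
    (φ := (boxCotensor M S X).comp (boxMap M (cotensorMap k t) X))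
    (ψ := (M.res (mapTimes t X)).comp (boxCotensor M T X)) fun Y f m a => ?_) z
  have key : ∀ a : k.obj (T.prod Y),
      M.res (mapTimes t X) (M.tr (timesMap T f) (a • M.res (sndMap T Y) m)) =
        M.tr (timesMap S f) (k.res (mapTimes t Y) a • M.res (sndMap S Y) m) := fun a => by
    rw [M.res_tr (isPullback_mapTimes t f), M.res_smul, ← M.res_comp]
    rfl
  simp only [AddMonoidHom.comp_apply, boxMap_box]
  exact (boxCotensor_box M f m _).trans
    ((key a).symm.trans (congrArg _ (boxCotensor_box M f m a).symm))

end TModule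

section FreeSets

variable {G : Type u} [Group G] [Finite G]

/-- A free `G`-set is a disjoint union of copies of `G/e`. -/
theorem orb_cover {J : Type u} {Y : FinGSet G} {s : J → Y}
    (hs : ∀ y : Y, ∃! p : J × G, p.2 • s p.1 = y) (y : Y) :
    ∃! x : Σ _ : J, free G, orb (s x.1) x.2 = y := by
  obtain ⟨⟨j, g⟩, h1, h2⟩ := hs y
  refine ⟨⟨j, g⟩, h1, ?_⟩
  rintro ⟨j', g'⟩ h
  obtain ⟨rfl, rfl⟩ : j' = j ∧ g' = g :=
    ⟨congrArg Prod.fst (h2 (j', g') h), congrArg Prod.snd (h2 (j', g') h)⟩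
  rfl

theorem prod_orbits (X : FinGSet G) (y : (free G).prod X) :
    ∃! p : X × G, p.2 • (((1 : G), p.1) : (free G).prod X) = y := by
  refine ⟨((y.1 : G)⁻¹ • y.2, y.1), Prod.ext (mul_one (y.1 : G)) (smul_inv_smul (y.1 : G) y.2), ?_⟩
  rintro ⟨x, g⟩ h
  have h1 : g * 1 = y.1 := congrArg Prod.fst h
  have h2 : g • x = y.2 := congrArg Prod.snd h
  rw [mul_one] at h1
  rw [← h1, ← h2, inv_smul_smul]

theorem prod_prod_orbits (X : FinGSet G) (y : ((free G).prod (free G)).prod X) :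
    ∃! p : (G × X) × G, p.2 • (((((1 : G), p.1.1) : (free G).prod (free G)), p.1.2) :
      ((free G).prod (free G)).prod X) = y := by
  obtain ⟨⟨a, b⟩, x⟩ := y
  refine ⟨(((a : G)⁻¹ * b, (a : G)⁻¹ • x), a), Prod.ext (Prod.ext (mul_one (a : G))
    (mul_inv_cancel_left (a : G) b)) (smul_inv_smul (a : G) x), ?_⟩
  rintro ⟨⟨h, x'⟩, g⟩ e
  have h1 : g * 1 = a := congrArg (fun q => q.1.1) e
  have h2 : g * h = b := congrArg (fun q => q.1.2) e
  have h3 : g • x' = x := congrArg Prod.snd e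
  rw [mul_one] at h1
  rw [← h1, ← h2, ← h3, inv_smul_smul, inv_mul_cancel_left]

end FreeSets

/-! ### Flat modules over the constant Tambara functor -/

section FlatConstant

open TModule

variable {G : Type u} [Group G] [Finite G] {F : Type u} [CommRing F]

theorem cotensorMap_point_injective (X : FinGSet G) :
    Function.Injective ((cotensorMap (const G F) (toPoint (free G))).app X) := by
  intro φ ψ h
  refine Subtype.ext (funext fun x => ?_)
  exact congrFun (congrArg Subtype.val h) (((1 : G), x.2) : (free G).prod X)

/-- The two restrictions from `k(G/e × -)` to `k(G/e × G/e × -)`, subtracted. -/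
noncomputable def cotensorDiff (G : Type u) [Group G] [Finite G] (F : Type u) [CommRing F] :
    Hom (cotensor (const G F) (free G)) (cotensor (const G F) ((free G).prod (free G))) :=
  (cotensorMap _ (fstMap _ _)).sub (cotensorMap _ (sndMap _ _))

theorem cotensor_exact (X : FinGSet G) :
    Function.Exact ((cotensorMap (const G F) (toPoint (free G))).app X)
      ((cotensorDiff G F).app X) := by
  intro φ
  constructor
  · intro h
    have h1 : ∀ (a b : G) (x : X), φ.1 ((a, x) : (free G).prod X) = φ.1 ((b, x) : (free G).prod X) :=
      fun a b x => sub_eq_zero.mp (congrFun (congrArg Subtype.val h) ((((a, b) :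
        (free G).prod (free G)), x) : ((free G).prod (free G)).prod X))
    refine ⟨⟨fun y => φ.1 (((1 : G), y.2) : (free G).prod X), fun g y => ?_⟩, ?_⟩
    · exact (h1 1 (g * 1) (g • y.2)).trans (φ.2 g (((1 : G), y.2) : (free G).prod X))
    · exact Subtype.ext (funext fun y => h1 1 y.1 y.2)
  · rintro ⟨ψ, rfl⟩
    exact Subtype.ext (funext fun y => sub_self _)

variable {M : TModule (const G F)}

/-- The elements of a flat module over the constant Tambara functor are determined by their
restrictions to `G/e`. -/
theorem Flat.ext_orb (hM : M.Flat) {X : FinGSet G} {m m' : M.obj X}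
    (h : ∀ x : X, M.res (orb x) m = M.res (orb x) m') : m = m' := by
  have inj : Function.Injective (M.res (mapTimes (toPoint (free G)) X)) := by
    intro a b hab
    obtain ⟨a, rfl⟩ := (boxCotensor_bijective M (point G) X).2 a
    obtain ⟨b, rfl⟩ := (boxCotensor_bijective M (point G) X).2 b
    rw [← boxCotensor_cotensorMap, ← boxCotensor_cotensorMap] at hab
    rw [hM.injective cotensorMap_point_injective X ((boxCotensor_bijective _ _ _).1 hab)]
  have h1 : M.res (sndMap (point G) X) m = M.res (sndMap (point G) X) m' := by
    apply inj
    apply (M.additive (fun x : X => orb (X := (free G).prod X) ((1 : G), x))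
      (orb_cover (prod_orbits X))).1
    funext x
    change M.res _ (M.res _ (M.res _ m)) = M.res _ (M.res _ (M.res _ m'))
    simp only [← M.res_comp]
    have e : ((sndMap (point G) X).comp (mapTimes (toPoint (free G)) X)).comp
        (orb (X := (free G).prod X) ((1 : G), x)) = orb x := rfl
    rw [e]
    exact h x
  have h2 := congrArg (M.res (⟨fun x => (PUnit.unit, x), fun _ _ => rfl⟩ :
    X →[G] (point G).prod X)) h1
  rw [← M.res_comp, ← M.res_comp] at h2
  exact (M.res_id m).symm.trans (h2.trans (M.res_id m'))

/-- Equivariant families of elements at level `G/e` of a flat module over the constant Tambara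
functor come from unique elements. -/
theorem Flat.exists_glue (hM : M.Flat) {X : FinGSet G} (φ : X → M.obj (free G))
    (hφ : ∀ (g : G) (x : X), φ (g • x) = M.res (orb (X := free G) g) (φ x)) :
    ∃ m : M.obj X, ∀ x, M.res (orb x) m = φ x := by
  obtain ⟨n, hn⟩ := (M.additive (fun x : X => orb (X := (free G).prod X) ((1 : G), x))
      (orb_cover (prod_orbits X))).2 φ
  have hn : ∀ x : X, M.res (orb (X := (free G).prod X) ((1 : G), x)) n = φ x := congrFun hn
  have hd : M.res (mapTimes (fstMap (free G) (free G)) X) n =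
      M.res (mapTimes (sndMap (free G) (free G)) X) n := by
    have hc := orb_cover (Y := ((free G).prod (free G)).prod X) (s := fun p : G × X =>
      (((1 : G), p.1), p.2)) (prod_prod_orbits X)
    apply (M.additive (fun p : G × X => orb (X := ((free G).prod (free G)).prod X)
      (((1 : G), p.1), p.2)) hc).1
    funext p
    obtain ⟨h, x⟩ := p
    change M.res _ (M.res _ n) = M.res _ (M.res _ n)
    rw [← M.res_comp, ← M.res_comp, comp_orb, comp_orb]
    change M.res (orb (X := (free G).prod X) ((1 : G), x)) n =
      M.res (orb (X := (free G).prod X) (h, x)) n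
    have e : orb (X := (free G).prod X) (h, x) =
        (orb (X := (free G).prod X) ((1 : G), h⁻¹ • x)).comp (orb (X := free G) h) := by
      rw [comp_orb]
      congr 1
      exact Prod.ext (mul_one h).symm (smul_inv_smul h x).symm
    rw [e, M.res_comp, hn, hn, ← hφ, smul_inv_smul]
  obtain ⟨z, rfl⟩ := (boxCotensor_bijective M (free G) X).2 n
  obtain ⟨w, rfl⟩ := hM.exact (z := z) cotensorMap_point_injective cotensor_exact X (by
    apply (boxCotensor_bijective _ _ _).1
    rw [map_zero, ← sub_eq_zero.mpr hd, ← boxCotensor_cotensorMap, ← boxCotensor_cotensorMap,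
      ← map_sub]
    congr 1
    refine DFunLike.congr_fun (box_hom_ext (φ := boxMap M (cotensorDiff G F) X)
      (ψ := boxMap M (cotensorMap _ (fstMap _ _)) X - boxMap M (cotensorMap _ (sndMap _ _)) X)
      fun Y f m a => ?_) z
    rw [AddMonoidHom.sub_apply, boxMap_box, boxMap_box, boxMap_box, eq_sub_iff_add_eq,
      ← box_add_right]
    congr 1
    exact sub_add_cancel _ _)
  refine ⟨M.res (⟨fun x => (PUnit.unit, x), fun _ _ => rfl⟩ : X →[G] (point G).prod X)
    (boxCotensor M (point G) X w), fun x => ?_⟩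
  rw [← hn, boxCotensor_cotensorMap, ← M.res_comp, ← M.res_comp]
  rfl

end FlatConstant

end Tamb

namespace Tamb

open CategoryTheory

/-! ### The level `G/e` of a finite étale algebra -/

section FibreSums

theorem fibreSum_congr {X Y A : Type*} [AddCommMonoid A] {f : X → Y} {φ ψ : X → A} {y : Y}
    (h : ∀ x, f x = y → φ x = ψ x) : fibreSum f φ y = fibreSum f ψ y :=
  finsum_congr fun x => h x.1 x.2

theorem fibreProd_congr {X Y A : Type*} [CommMonoid A] {f : X → Y} {φ ψ : X → A} {y : Y}
    (h : ∀ x, f x = y → φ x = ψ x) : fibreProd f φ y = fibreProd f ψ y :=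
  finprod_congr fun x => h x.1 x.2

end FibreSums

section Bottom

open scoped TensorProduct

variable {G : Type u} [Group G] [Finite G]

theorem res_orb_mem_sq (P : TambaraFunctor G) {I : ∀ X, Ideal (P.obj X)}
    (hI : ∀ {X Y : FinGSet G} (f : X →[G] Y) (a : P.obj Y), a ∈ I Y → P.res f a ∈ I X)
    {X : FinGSet G} {a : P.obj X} (h : TAlg.InPowGTOne P I X a) :
    ∀ x : X, P.res (orb x) a ∈ I (free G) * I (free G) := by
  induction h with
  | prod ha hb =>
    intro x
    rw [map_mul]
    exact Ideal.mul_mem_mul (hI _ _ ha) (hI _ _ hb)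
  | @norm X Y f a hX _ hY hf ha =>
    intro y
    classical
    have := Fintype.ofFinite X
    rw [res_orb_nm, fibreProd, finprod_eq_prod_of_fintype]
    obtain ⟨x, x', hxx', hne⟩ : ∃ x x', f x = f x' ∧ x ≠ x' := by
      simpa [Function.Injective] using hf
    obtain ⟨g, hg⟩ := MulAction.exists_smul_eq G (f x) y
    rw [← Finset.mul_prod_erase Finset.univ _
        (Finset.mem_univ (⟨g • x, by rw [map_smul, hg]⟩ : {x // f x = y})),
      ← Finset.mul_prod_erase _ _ (Finset.mem_erase.mpr ⟨fun h => hne ?_, Finset.mem_univ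
        (⟨g • x', by rw [map_smul, ← hxx', hg]⟩ : {x // f x = y})⟩), ← mul_assoc]
    · exact Ideal.mul_mem_right _ _ (Ideal.mul_mem_mul (hI _ _ ha) (hI _ _ ha))
    · exact (smul_left_cancel g (congrArg Subtype.val h)).symm
  | zero X =>
    intro x
    rw [map_zero]
    exact zero_mem _
  | add _ _ h1 h2 =>
    intro x
    rw [map_add]
    exact add_mem (h1 x) (h2 x)
  | mul c _ h =>
    intro x
    rw [map_mul]
    exact Ideal.mul_mem_left _ _ (h x)
  | res f _ h =>
    intro x
    rw [← P.res_comp, comp_orb]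
    exact h _
  | tr f _ h =>
    intro y
    rw [res_orb_tr]
    exact finsum_induction (· ∈ _) (zero_mem _) (fun _ _ => add_mem) fun x => h x.1

variable {F : Type u} [CommRing F]

/-- The restriction to `G/e` along `x`, as an element of the `F`-algebra `R(G/e)`. -/
noncomputable def atPoint (R : TAlg (const G F)) {X : FinGSet G} (x : X) :
    R.right.obj X →+* Bottom R :=
  R.right.res (orb x)

theorem const_free (c : (const G F).obj (free G)) : c = constHom G F (free G) (c.1 (1 : G)) :=
  Subtype.ext (funext fun g => (congrArg c.1 (mul_one (g : G)).symm).trans (c.2 g (1 : G)))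

theorem atPoint_const (R : TAlg (const G F)) {X : FinGSet G} (x : X) (c : (const G F).obj X) :
    atPoint R x (R.hom.app X c) = algebraMap F (Bottom R) (c.1 x) := by
  refine (R.hom.res (orb x) c).symm.trans ?_
  rw [const_free ((const G F).res (orb x) c)]
  change R.hom.app (free G) (constHom G F (free G) (c.1 ((1 : G) • x))) = _
  rw [one_smul]
  rfl

theorem atPoint_tr (R : TAlg (const G F)) {X Y : FinGSet G} (f : X →[G] Y) (a : R.right.obj X)
    (y : Y) : atPoint R y (R.right.tr f a) = fibreSum f (fun x => atPoint R x a) y :=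
  res_orb_tr R.right f a y

theorem atPoint_res (R : TAlg (const G F)) {X Y : FinGSet G} (f : X →[G] Y) (a : R.right.obj Y)
    (x : X) : atPoint R x (R.right.res f a) = atPoint R (f x) a := by
  refine (R.right.res_comp f (orb x) a).symm.trans ?_
  rw [comp_orb]
  rfl

theorem atPoint_one (R : TAlg (const G F)) (a : R.right.obj (free G)) :
    atPoint R (X := free G) (1 : G) a = a := res_orb_one R.right a

/-- The map of `F`-algebras at level `G/e`. -/
noncomputable def bottomMap {R S : TAlg (const G F)} (φ : R ⟶ S) : Bottom R →ₐ[F] Bottom S :=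
  ((evAlg G F).map φ).hom.hom

theorem bottomMap_atPoint {R S : TAlg (const G F)} (φ : R ⟶ S) {X : FinGSet G} (x : X)
    (a : R.right.obj X) : bottomMap φ (atPoint R x a) = atPoint S x (φ.right.app X a) :=
  φ.right.res (orb x) a

theorem finite_bottom {R : TAlg (const G F)} (h : R.IsFinite) : Module.Finite F (Bottom R) := by
  obtain ⟨n, X, m, hm⟩ := h
  let s : Set (Bottom R) := Set.range fun p : Σ j, X j => atPoint R p.2 (m p.1)
  have key : ∀ Y a, TModule.InSpan R.toModule m Y a →
      ∀ y : Y, atPoint R y a ∈ Submodule.span F s := by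
    intro Y a ha
    induction ha with
    | gen j => exact fun y => Submodule.subset_span ⟨⟨j, y⟩, rfl⟩
    | zero Y =>
      intro y
      exact (map_zero (atPoint R y)).symm ▸ zero_mem _
    | add _ _ h1 h2 =>
      intro y
      exact (map_add (atPoint R y) _ _).symm ▸ add_mem (h1 y) (h2 y)
    | @smul Y c a _ h1 =>
      intro y
      change atPoint R y (R.hom.app Y c * (show R.right.obj Y from a)) ∈ _
      rw [map_mul, atPoint_const, ← Algebra.smul_def]
      exact Submodule.smul_mem _ _ (h1 y)
    | res f _ h1 =>
      intro y
      exact (atPoint_res R f _ y).symm ▸ h1 _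
    | tr f _ h1 =>
      intro y
      refine (atPoint_tr R f _ y).symm ▸ ?_
      exact finsum_induction (· ∈ _) (zero_mem _) (fun _ _ => add_mem) fun x => h1 x.1
  have hs : s.Finite := Set.finite_range _
  refine ⟨⟨hs.toFinset, eq_top_iff.mpr fun a _ => ?_⟩⟩
  · rw [Set.Finite.coe_toFinset]
    rw [← atPoint_one R a]
    exact key _ a (hm _ a) _

theorem tmul_tr_left (R : TAlg (const G F)) {X Y Z : FinGSet G} (f : Y →[G] X) (g : Z →[G] Y)
    (a : R.right.obj Z) (b : R.right.obj Y) (x : X) :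
    fibreSum f (fun y => atPoint R y (R.right.tr g a) ⊗ₜ[F] atPoint R y b) x =
      fibreSum (f.comp g) (fun z => atPoint R z a ⊗ₜ[F] atPoint R z (R.right.res g b)) x := by
  refine Eq.trans (fibreSum_congr fun y _ => ?_) (fibreSum_comp f g _ x).symm
  rw [atPoint_tr]
  refine (fibreSum_map ((TensorProduct.mk F _ _).flip (atPoint R y b)).toAddMonoidHom
    g _ y).trans (fibreSum_congr fun z hz => ?_)
  rw [atPoint_res, hz]
  rfl

theorem tmul_tr_right (R : TAlg (const G F)) {X Y Z : FinGSet G} (f : Y →[G] X) (g : Z →[G] Y)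
    (a : R.right.obj Y) (b : R.right.obj Z) (x : X) :
    fibreSum f (fun y => atPoint R y a ⊗ₜ[F] atPoint R y (R.right.tr g b)) x =
      fibreSum (f.comp g) (fun z => atPoint R z (R.right.res g a) ⊗ₜ[F] atPoint R z b) x := by
  refine Eq.trans (fibreSum_congr fun y _ => ?_) (fibreSum_comp f g _ x).symm
  rw [atPoint_tr]
  refine (fibreSum_map (TensorProduct.mk F _ _ (atPoint R y a)).toAddMonoidHom
    g _ y).trans (fibreSum_congr fun z hz => ?_)
  rw [atPoint_res, hz]
  rfl

/-- The image of a symbol in the tensor product at level `G/e`. -/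
noncomputable def boxBottomFun (R : TAlg (const G F)) (Y : FinGSet G) (f : Y →[G] free G)
    (a b : R.right.obj Y) : Bottom R ⊗[F] Bottom R :=
  fibreSum f (fun y => atPoint R y a ⊗ₜ[F] atPoint R y b) (1 : G)

/-- At level `G/e` the box product is the tensor product. -/
noncomputable def boxBottom (R : TAlg (const G F)) :
    TModule.Box R.toModule R.toModule (free G) →+ Bottom R ⊗[F] Bottom R :=
  TModule.boxLift (M := R.toModule) (N := R.toModule)
    (boxBottomFun R)
    (fun {Y} f (a a' b : R.right.obj Y) => (fibreSum_congr fun x _ => 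
      (congrArg (· ⊗ₜ[F] atPoint R x b) (map_add (atPoint R x) a a')).trans
        (TensorProduct.add_tmul _ _ _)).trans (fibreSum_add _ _ _ _))
    (fun {Y} f (a b b' : R.right.obj Y) => (fibreSum_congr fun x _ => 
      (congrArg (atPoint R x a ⊗ₜ[F] ·) (map_add (atPoint R x) b b')).trans
        (TensorProduct.tmul_add _ _ _)).trans (fibreSum_add _ _ _ _))
    (fun {Y} f c (a : R.right.obj Y) (b : R.right.obj Y) => fibreSum_congr fun x _ => by
      change atPoint R x (R.hom.app Y c * a) ⊗ₜ[F] atPoint R x b =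
        atPoint R x a ⊗ₜ[F] atPoint R x (R.hom.app Y c * b)
      rw [map_mul, map_mul, atPoint_const, ← Algebra.smul_def, ← Algebra.smul_def,
        TensorProduct.smul_tmul])
    (fun f g a b => tmul_tr_left R f g a b _) (fun f g a b => tmul_tr_right R f g a b _)

theorem boxBottom_box (R : TAlg (const G F)) {Y : FinGSet G} (f : Y →[G] free G)
    (a b : R.right.obj Y) :
    boxBottom R (TModule.box (M := R.toModule) (N := R.toModule) f a b) =
      fibreSum f (fun y => atPoint R y a ⊗ₜ[F] atPoint R y b) (1 : G) :=
  TModule.boxLift_box (M := R.toModule) (N := R.toModule) (φ := boxBottomFun R) _ _ _ _ _ f a b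

theorem boxDesc_box {k : TambaraFunctor G} {R S P : TAlg k} (i₁ : R ⟶ P) (i₂ : S ⟶ P)
    {X Y : FinGSet G} (f : Y →[G] X) (a : R.right.obj Y) (b : S.right.obj Y) :
    TAlg.boxDesc i₁ i₂ X (TModule.box (M := R.toModule) (N := S.toModule) f a b) =
      P.right.tr f (i₁.right.app Y a * i₂.right.app Y b) :=
  TAlg.boxSymDesc_sym i₁ i₂ f a b

/-- The comparison of the tensor product with the box product at level `G/e`. -/
noncomputable def tensorToBottom {R : TAlg (const G F)} (B : TAlg.BoxSquare R) :
    Bottom R ⊗[F] Bottom R →ₐ[F] Bottom B.alg :=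
  Algebra.TensorProduct.productMap (bottomMap B.inl) (bottomMap B.inr)

theorem tensorToBottom_tmul {R : TAlg (const G F)} (B : TAlg.BoxSquare R) (a b : Bottom R) :
    tensorToBottom B (a ⊗ₜ b) = bottomMap B.inl a * bottomMap B.inr b :=
  Algebra.TensorProduct.productMap_apply_tmul _ _ _ _

theorem tensorToBottom_boxBottom {R : TAlg (const G F)} (B : TAlg.BoxSquare R)
    (z : TModule.Box R.toModule R.toModule (free G)) :
    tensorToBottom B (boxBottom R z) = TAlg.boxDesc B.inl B.inr (free G) z := by
  refine DFunLike.congr_fun (TModule.box_hom_ext (M := R.toModule) (N := R.toModule)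
    (φ := (tensorToBottom B).toAddMonoidHom.comp (boxBottom R))
    (ψ := TAlg.boxDesc B.inl B.inr (free G)) fun Y f a b => ?_) z
  refine (congrArg (tensorToBottom B) (boxBottom_box R f a b)).trans ?_
  refine ((fibreSum_map (tensorToBottom B).toAddMonoidHom f _ _).trans ?_).trans
    (boxDesc_box B.inl B.inr f a b).symm
  refine Eq.trans ?_ (atPoint_one B.alg _)
  rw [atPoint_tr]
  refine fibreSum_congr fun y _ => ?_
  rw [map_mul]
  exact (tensorToBottom_tmul B _ _).trans
    (congrArg₂ (· * ·) (bottomMap_atPoint B.inl y a) (bottomMap_atPoint B.inr y b))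

theorem tensorToBottom_bijective {R : TAlg (const G F)} (B : TAlg.BoxSquare R) :
    Function.Bijective (tensorToBottom B) := by
  let D : TModule.Box R.toModule R.toModule (free G) ≃+ Bottom B.alg :=
    AddEquiv.ofBijective (TAlg.boxDesc B.inl B.inr (free G)) (B.bijective (free G))
  have hD : ∀ t, boxBottom R (D.symm (tensorToBottom B t)) = t := by
    intro t
    induction t with
    | zero => simp only [map_zero]
    | add a b ha hb => rw [map_add, map_add, map_add, ha, hb]
    | tmul a b =>
      have h1 : D (TModule.box (M := R.toModule) (N := R.toModule) (MulActionHom.id G) a b) =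
          tensorToBottom B (a ⊗ₜ b) :=
        (boxDesc_box B.inl B.inr _ _ _).trans ((B.alg.right.tr_id _).trans
          (tensorToBottom_tmul B a b).symm)
      rw [← h1, AddEquiv.symm_apply_apply]
      refine (boxBottom_box R _ a b).trans ?_
      refine (fibreSum_id (X := (free G : Type u))
        (fun y => atPoint R y a ⊗ₜ[F] atPoint R y b) (1 : G)).trans ?_
      exact congrArg₂ (· ⊗ₜ[F] ·) (atPoint_one R a) (atPoint_one R b)
  refine ⟨Function.LeftInverse.injective (g := fun p => boxBottom R (D.symm p)) hD, fun p => ?_⟩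
  obtain ⟨z, rfl⟩ := (B.bijective (free G)).2 p
  exact ⟨_, tensorToBottom_boxBottom B z⟩

theorem formallyUnramified_bottom {R : TAlg (const G F)} (B : TAlg.BoxSquare R)
    (hB : Subsingleton (TAlg.Kaehler B (free G))) : Algebra.FormallyUnramified F (Bottom R) := by
  let e : Bottom R ⊗[F] Bottom R ≃+* Bottom B.alg :=
    RingEquiv.ofBijective (tensorToBottom B) (tensorToBottom_bijective B)
  let I : Ideal (Bottom B.alg) := TAlg.ker B.mul (free G)
  have hI : I = (KaehlerDifferential.ideal F (Bottom R)).map (e : _ →+* Bottom B.alg) := by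
    have hmul : ∀ t, bottomMap B.mul (e t) = Algebra.TensorProduct.lmul' F t := by
      refine fun t => DFunLike.congr_fun (f := (bottomMap B.mul).comp (tensorToBottom B))
        (Algebra.TensorProduct.ext' fun a b => ?_) t
      change bottomMap B.mul (tensorToBottom B (a ⊗ₜ b)) = _
      rw [tensorToBottom_tmul, map_mul,
        Algebra.TensorProduct.lmul'_apply_tmul]
      exact congrArg₂ (· * ·) (congrArg (fun v => v.right.app (free G) a) B.inl_mul)
        (congrArg (fun v => v.right.app (free G) b) B.inr_mul)
    ext p
    obtain ⟨t, rfl⟩ := e.surjective p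
    refine Iff.trans ?_ (Ideal.mem_map_of_equiv e _).symm
    constructor
    · exact fun h => ⟨t, (hmul t).symm.trans h, rfl⟩
    · rintro ⟨t', h1, h2⟩
      obtain rfl := e.injective h2
      exact (hmul t').trans h1
  constructor
  rw [KaehlerDifferential, Ideal.cotangent_subsingleton_iff]
  refine le_antisymm Ideal.mul_le_right fun t ht => ?_
  have h1 : e t ∈ I := by
    rw [hI]
    exact Ideal.mem_map_of_mem _ ht
  have h2 : TAlg.InPowGTOne B.alg.right (TAlg.ker B.mul) (free G) (e t) := by
    have h3 : (⟨e t, h1⟩ : TAlg.ker B.mul (free G)) ∈ Submodule.comap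
        (Submodule.subtype (TAlg.ker B.mul (free G)))
        (TAlg.powGTOne B.alg.right (TAlg.ker B.mul) (free G)) :=
      (Submodule.Quotient.mk_eq_zero _).mp (hB.elim _ _)
    exact h3
  have h3 : e t ∈ I * I := by
    have := res_orb_mem_sq B.alg.right (I := TAlg.ker B.mul) (fun f a ha => by
      refine (B.mul.right.res f a).trans ?_
      rw [RingHom.mem_ker.mp ha, map_zero]) h2 (1 : G)
    exact (res_orb_one B.alg.right (e t)) ▸ this
  rw [hI, ← Ideal.map_mul] at h3
  obtain ⟨t', h4, h5⟩ := (Ideal.mem_map_of_equiv e _).mp h3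
  rwa [← e.injective h5]

end Bottom

theorem finEt_bottom {G : Type u} [Group G] [Finite G] {F : Type u} [Field F]
    {R : TAlg (const G F)} (hf : R.IsFinite) (he : R.IsEtale) :
    Module.Finite F (Bottom R) ∧ Algebra.Etale F (Bottom R) := by
  have h1 := finite_bottom hf
  obtain ⟨⟨-, B, hB⟩, -⟩ := he
  have h2 := formallyUnramified_bottom B (hB _)
  have := Algebra.FormallyEtale.of_formallyUnramified_of_field F (Bottom R)
  exact ⟨h1, { finitePresentation := (Algebra.FinitePresentation.of_finiteType).mp inferInstance }⟩

end Tamb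

namespace Tamb

open CategoryTheory

section Exponentials

variable {G : Type u} [Group G]

/-- An invariant subset of a finite `G`-set. -/
def FinGSet.sub (X : FinGSet G) (p : X → Prop) (hp : ∀ (g : G) x, p x → p (g • x)) : FinGSet G where
  carrier := {x : X // p x}
  action :=
    { smul := fun g x => ⟨g • x.1, hp g x.1 x.2⟩
      one_smul := fun x => Subtype.ext (one_smul G x.1)
      mul_smul := fun g h x => Subtype.ext (mul_smul g h x.1) }
  finite := inferInstance

/-- The inclusion of an invariant subset. -/
def FinGSet.subIncl (X : FinGSet G) (p : X → Prop) (hp : ∀ (g : G) x, p x → p (g • x)) :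
    X.sub p hp →[G] X :=
  ⟨Subtype.val, fun _ _ => rfl⟩

theorem sub_cover {X : FinGSet G} {J : Type u} (κ : X → J) (hκ : ∀ (g : G) x, κ (g • x) = κ x)
    (y : X) : ∃! x : Σ j, X.sub (fun x => κ x = j) (fun g x h => (hκ g x).trans h),
      X.subIncl _ (fun g x h => (hκ g x).trans h) x.2 = y := by
  refine ⟨⟨κ y, ⟨y, rfl⟩⟩, rfl, ?_⟩
  rintro ⟨j, ⟨y', rfl⟩⟩ (rfl : y' = y)
  rfl

open scoped Pointwise in
/-- Exponential diagrams exist. -/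
theorem exists_exponential {A X Y : FinGSet G} (q : A →[G] X) (p : X →[G] Y) :
    ∃ (E P : FinGSet G) (e : E →[G] A) (p' : E →[G] P) (q' : P →[G] Y),
      IsExponentialDiagram q p e p' q' := by
  let good : Y.carrier × Set A.carrier → Prop := fun z =>
    (∀ a ∈ z.2, p (q a) = z.1) ∧ ∀ x, p x = z.1 → ∃! a, a ∈ z.2 ∧ q a = x
  let P₀ : FinGSet G := ⟨Y.carrier × Set A.carrier⟩
  have hP : ∀ (g : G) (z : P₀), good z → good (g • z) := by
    rintro g ⟨y, s⟩ ⟨h1, h2⟩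
    refine ⟨fun a ha => ?_, fun x hx => ?_⟩
    · have := h1 _ (Set.mem_smul_set_iff_inv_smul_mem.mp ha)
      rw [map_smul, map_smul, inv_smul_eq_iff] at this
      exact this
    · have hx : p x = g • y := hx
      obtain ⟨a, ⟨h3, h4⟩, h5⟩ := h2 (g⁻¹ • x) (by rw [map_smul, hx, inv_smul_smul])
      refine ⟨g • a, ⟨Set.smul_mem_smul_set h3, by rw [map_smul, h4, smul_inv_smul]⟩, ?_⟩
      rintro b ⟨hb1, hb2⟩
      rw [← h5 (g⁻¹ • b) ⟨Set.mem_smul_set_iff_inv_smul_mem.mp hb1, by rw [map_smul, hb2]⟩,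
        smul_inv_smul]
  let P := P₀.sub good hP
  have hE : ∀ (g : G) (z : A.prod P), z.1 ∈ z.2.1.2 → (g • z).1 ∈ (g • z).2.1.2 :=
    fun g z h => Set.smul_mem_smul_set h
  let E := (A.prod P).sub (fun z => z.1 ∈ z.2.1.2) hE
  let incl : E →[G] A.prod P := (A.prod P).subIncl _ hE
  refine ⟨E, P, (fstMap A P).comp incl, (sndMap A P).comp incl, ⟨fun z => z.1.1, fun _ _ => rfl⟩,
    ⟨fun w => w.1.2.2.1 _ w.2, fun x t h => ?_⟩, fun y s hs => ?_⟩
  · obtain ⟨a, ⟨h1, h2⟩, h3⟩ := t.2.2 x h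
    refine ⟨⟨(a, t), h1⟩, ⟨h2, rfl⟩, ?_⟩
    rintro ⟨⟨b, t'⟩, hb⟩ ⟨h4, rfl : t' = t⟩
    exact Subtype.ext (Prod.ext (h3 b ⟨hb, h4⟩) rfl)
  · have hg : good (y, Set.range s) := by
      refine ⟨?_, fun x hx => ⟨s ⟨x, hx⟩, ⟨⟨_, rfl⟩, hs _⟩, ?_⟩⟩
      · rintro _ ⟨x, rfl⟩
        exact (congrArg p (hs x)).trans x.2
      · rintro _ ⟨⟨x', rfl⟩, rfl⟩
        congr 1
        exact Subtype.ext (hs x').symm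
    refine ⟨⟨(y, Set.range s), hg⟩, ⟨rfl, fun x => ⟨⟨(s x, ⟨(y, Set.range s), hg⟩), ⟨x, rfl⟩⟩,
      rfl, rfl⟩⟩, ?_⟩
    rintro ⟨⟨y', s'⟩, h1, h2⟩ ⟨rfl : y' = y, h3⟩
    refine Subtype.ext (Prod.ext rfl (Set.ext fun a => ⟨fun ha => ?_, ?_⟩))
    · refine ⟨⟨q a, h1 a ha⟩, ?_⟩
      obtain ⟨⟨⟨b, t⟩, hb⟩, h4, h5⟩ := h3 ⟨q a, h1 a ha⟩
      have h4 : t = _ := h4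
      have h5 : b = _ := h5
      subst h4
      exact (h2 (q a) (h1 a ha)).unique ⟨h5 ▸ hb, hs _⟩ ⟨ha, rfl⟩
    · rintro ⟨x, rfl⟩
      obtain ⟨⟨⟨b, t⟩, hb⟩, h4, h5⟩ := h3 x
      have h4 : t = _ := h4
      have h5 : b = _ := h5
      subst h4
      exact h5 ▸ hb

end Exponentials

/-! ### Split algebras -/

section Split

open TModule

variable {G : Type u} [Group G] {F : Type u} [CommRing F]

/-- An equivariant isomorphism of an `F`-algebra with `G`-action with the algebra of functions on a
finite `G`-set. -/
structure Splitting (A : Action (CommAlgCat.{u} F) G) where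
  /-- The finite `G`-set. -/
  pts : FinGSet G
  /-- The isomorphism. -/
  equiv : A.V ≃ₐ[F] (pts → F)
  equivariant : ∀ g a t, equiv (ringAction A g a) t = equiv a (g⁻¹ • t)

namespace Splitting

variable {A : Action (CommAlgCat.{u} F) G} (σ : Splitting A)

/-- The coordinate function of an equivariant function with values in a split algebra. -/
noncomputable def coordHom (X : FinGSet G) :
    ((FP G F).obj A).right.obj X →+* (const G F).obj (σ.pts.prod X) where
  toFun φ := ⟨fun p => σ.equiv (φ.1 p.2) p.1, fun g p => by
    have h1 : φ.1 (g • p.2) = ringAction A g (φ.1 p.2) := φ.2 g p.2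
    change σ.equiv (φ.1 (g • p.2)) (g • p.1) = σ.equiv (φ.1 p.2) p.1
    rw [h1, σ.equivariant, inv_smul_smul]⟩
  map_one' := Subtype.ext (funext fun p => congrFun (map_one σ.equiv) p.1)
  map_mul' _ _ := Subtype.ext (funext fun p => congrFun (map_mul σ.equiv _ _) p.1)
  map_zero' := Subtype.ext (funext fun p => congrFun (map_zero σ.equiv) p.1)
  map_add' _ _ := Subtype.ext (funext fun p => congrFun (map_add σ.equiv _ _) p.1)

theorem coordHom_hom {X : FinGSet G} (c : (const G F).obj X) :
    σ.coordHom X (((FP G F).obj A).hom.app X c) = (const G F).res (sndMap σ.pts X) c :=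
  Subtype.ext (funext fun p => congrFun (σ.equiv.commutes (c.1 p.2)) p.1)

/-- `FP(A)` as the module `k(T × -)`. -/
noncomputable def coordMap :
    Hom ((FP G F).obj A).toModule (cotensor (const G F) σ.pts) where
  app X :=
    { toFun := σ.coordHom X
      map_add' := map_add _
      map_smul' := fun c a => (map_mul (σ.coordHom X) (((FP G F).obj A).hom.app X c) a).trans
        (congrArg (· * _) (σ.coordHom_hom c)) }
  res _ _ := rfl
  tr {X Y} f φ := Subtype.ext (funext fun p => by
    have h := (isPullback_snd σ.pts f)
    refine (fibreSum_map (A := A.V) ((Pi.evalRingHom (fun _ : σ.pts => F) p.1).comp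
      (σ.equiv : A.V →+* (σ.pts → F))).toAddMonoidHom f φ.1 p.2).trans ?_
    refine (fibreSum_pullback h _ p).trans (fibreSum_congr fun w hw => ?_)
    subst hw
    rfl)

theorem coordHom_injective (X : FinGSet G) : Function.Injective (σ.coordHom X) := fun φ ψ h =>
  Subtype.ext (funext fun x => σ.equiv.injective (funext fun t =>
    congrFun (congrArg Subtype.val h) ((t, x) : σ.pts.prod X)))

/-- The idempotents of a split algebra. -/
noncomputable def point (t : σ.pts) : A.V :=
  open scoped Classical in σ.equiv.symm fun t' => if t' = t then 1 else 0

open scoped Classical in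
theorem equiv_point (t t' : σ.pts) : σ.equiv (σ.point t) t' = if t' = t then 1 else 0 := by
  rw [point, AlgEquiv.apply_symm_apply]

theorem ringAction_point (g : G) (t : σ.pts) : ringAction A g (σ.point t) = σ.point (g • t) := by
  classical
  refine σ.equiv.injective (funext fun t' => ?_)
  rw [σ.equivariant, equiv_point, equiv_point]
  simp only [inv_smul_eq_iff]

/-- The universal idempotent of `FP(A)`. -/
noncomputable def idem : ((FP G F).obj A).right.obj σ.pts :=
  ⟨σ.point, fun g t => (σ.ringAction_point g t).symm⟩

/-- The indicator function of the diagonal. -/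
noncomputable def delta (T : FinGSet G) : (const G F).obj (T.prod T) :=
  (const G F).tr (diagMap T) 1

open scoped Classical in
theorem delta_apply (T : FinGSet G) (p : T.prod T) :
    (delta (F := F) T).1 p = if p.1 = p.2 then 1 else 0 := by
  change fibreSum (diagMap T) (fun _ => (1 : F)) p = _
  unfold fibreSum
  split_ifs with h
  · have : Unique {x : T // diagMap T x = p} :=
      ⟨⟨⟨p.1, Prod.ext rfl h⟩⟩, fun x => Subtype.ext (congrArg Prod.fst x.2 :)⟩
    exact finsum_unique _
  · have : IsEmpty {x : T // diagMap T x = p} :=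
      ⟨fun x => h ((congrArg Prod.fst x.2 : x.1 = p.1).symm.trans (congrArg Prod.snd x.2 :))⟩
    exact finsum_of_isEmpty _

theorem coordHom_idem : σ.coordHom σ.pts σ.idem = delta σ.pts := by
  classical
  refine Subtype.ext (funext fun p => ?_)
  rw [delta_apply]
  exact σ.equiv_point p.2 p.1

theorem isFinite (σ : Splitting A) : ((FP G F).obj A).IsFinite :=
  finitelyGenerated_of_coord (ι := σ.coordMap) (e := σ.idem) σ.coordHom_injective σ.coordHom_idem

theorem isFlat (σ : Splitting A) : ((FP G F).obj A).IsFlat :=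
  flat_of_coord (ι := σ.coordMap) (e := σ.idem) σ.coordHom_injective σ.coordHom_idem

theorem reconstruct {X : FinGSet G} (φ : ((FP G F).obj A).right.obj X) :
    ((FP G F).obj A).right.tr (sndMap σ.pts X) (((FP G F).obj A).hom.app _ (σ.coordHom X φ) *
      ((FP G F).obj A).right.res (fstMap σ.pts X) σ.idem) = φ :=
  TModule.reconstruct (ι := σ.coordMap) (e := σ.idem) σ.coordHom_injective σ.coordHom_idem φ

/-- Maps out of `FP(A)` are determined by the image of the universal idempotent. -/
theorem hom_ext {S : TAlg (const G F)} {Φ Ψ : (FP G F).obj A ⟶ S}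
    (h : Φ.right.app _ σ.idem = Ψ.right.app _ σ.idem) : Φ = Ψ := by
  refine Under.UnderMorphism.ext (TambaraFunctor.hom_ext fun X φ => ?_)
  rw [← σ.reconstruct φ, Φ.right.tr, Ψ.right.tr, map_mul (Φ.right.app _), map_mul (Ψ.right.app _), TAlg.hom_app_const,
    TAlg.hom_app_const, Φ.right.res, Ψ.right.res, h]

end Splitting

end Split

end Tamb

namespace Tamb

open CategoryTheory

namespace TAlg

variable {G : Type u} [Group G] {k : TambaraFunctor G} (S : TAlg k)

/-- The structure map of a `k`-algebra. -/
def unit (X : FinGSet G) : k.obj X →+* S.right.obj X := S.hom.app X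

theorem unit_res {X Y : FinGSet G} (f : X →[G] Y) (c : k.obj Y) :
    S.unit X (k.res f c) = S.right.res f (S.unit Y c) := S.hom.res f c

theorem unit_tr {X Y : FinGSet G} (f : X →[G] Y) (c : k.obj X) :
    S.unit Y (k.tr f c) = S.right.tr f (S.unit X c) := S.hom.tr f c

theorem unit_nm {X Y : FinGSet G} (f : X →[G] Y) (c : k.obj X) :
    S.unit Y (k.nm f c) = S.right.nm f (S.unit X c) := S.hom.nm f c

theorem map_unit {R S : TAlg k} (φ : R ⟶ S) (X : FinGSet G) (c : k.obj X) :
    φ.right.app X (R.unit X c) = S.unit X c := hom_app_const φ X c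

end TAlg

namespace TambaraFunctor

variable {G : Type u} [Group G] (R : TambaraFunctor G)

theorem frobenius_left {X Y : FinGSet G} (f : X →[G] Y) (a : R.obj X) (b : R.obj Y) :
    R.tr f (R.res f b * a) = b * R.tr f a := by
  rw [mul_comm, R.frobenius, mul_comm]

theorem tr_one_mul {X Y : FinGSet G} (f : X →[G] Y) (b : R.obj Y) :
    R.tr f 1 * b = R.tr f (R.res f b) := by
  rw [← R.frobenius, one_mul]

end TambaraFunctor

theorem isPullback_toPoint {G : Type u} [Group G] (T X : FinGSet G) :
    IsPullbackSq (fstMap T X) (sndMap T X) (toPoint T) (toPoint X) :=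
  ⟨fun _ => rfl, fun x y _ => ⟨(x, y), ⟨rfl, rfl⟩, fun _ hw => Prod.ext hw.1 hw.2⟩⟩

/-- The map `(τ, 1) : Y → T × Y`. -/
def graphOf {G : Type u} [Group G] {T Y : FinGSet G} (τ : Y →[G] T) : Y →[G] T.prod Y :=
  ⟨fun y => (τ y, y), fun g y => Prod.ext (map_smul τ g y) rfl⟩

/-- The map `T × τ : T × Y → T × T` as a base change of the diagonal. -/
theorem isPullback_graphOf {G : Type u} [Group G] {T Y : FinGSet G} (τ : Y →[G] T) :
    IsPullbackSq τ (graphOf τ) (diagMap T) (timesMap T τ) := by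
  refine ⟨fun _ => rfl, fun x y h => ?_⟩
  have h1 : x = y.1 := congrArg Prod.fst h
  have h2 : x = τ y.2 := congrArg Prod.snd h
  exact ⟨y.2, ⟨h2.symm, Prod.ext (h2.symm.trans h1) rfl⟩, fun _ hw => (congrArg Prod.snd hw.2 :)⟩

namespace Splitting

section

variable {G : Type u} [Group G] {F : Type u} [CommRing F]
  {A : Action (CommAlgCat.{u} F) G} (σ : Splitting A) {S : TAlg (const G F)}
  (s : S.right.obj σ.pts)

/-- The element of `S` with the given coordinates with respect to `s`. -/
noncomputable def lin {X : FinGSet G} (φ : ((FP G F).obj A).right.obj X) : S.right.obj X :=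
  S.right.tr (sndMap σ.pts X) (S.unit _ (σ.coordHom X φ) * S.right.res (fstMap σ.pts X) s)

theorem lin_add {X : FinGSet G} (φ ψ : ((FP G F).obj A).right.obj X) :
    σ.lin s (φ + ψ) = σ.lin s φ + σ.lin s ψ := by
  rw [lin, map_add, map_add, add_mul, map_add]
  rfl

theorem lin_res {X Y : FinGSet G} (f : X →[G] Y) (φ : ((FP G F).obj A).right.obj Y) :
    σ.lin s (((FP G F).obj A).right.res f φ) = S.right.res f (σ.lin s φ) := by
  have h : σ.coordHom X (((FP G F).obj A).right.res f φ) =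
    (const G F).res (timesMap σ.pts f) (σ.coordHom Y φ) := rfl
  rw [lin, lin, S.right.res_tr (isPullback_snd σ.pts f).symm, map_mul (S.right.res _), h, S.unit_res,
    ← S.right.res_comp]
  rfl

theorem lin_tr {X Y : FinGSet G} (f : X →[G] Y) (φ : ((FP G F).obj A).right.obj X) :
    σ.lin s (((FP G F).obj A).right.tr f φ) = S.right.tr f (σ.lin s φ) := by
  have h : σ.coordHom Y (((FP G F).obj A).right.tr f φ) =
    (const G F).tr (timesMap σ.pts f) (σ.coordHom X φ) := σ.coordMap.tr f φ
  rw [lin, lin, ← S.right.tr_comp, h, S.unit_tr, ← S.right.frobenius, ← S.right.res_comp,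
    ← S.right.tr_comp]
  rfl

theorem lin_idem : σ.lin s σ.idem = s := by
  rw [lin, coordHom_idem, delta, S.unit_tr, map_one, S.right.tr_one_mul, ← S.right.tr_comp,
    ← S.right.res_comp]
  exact (S.right.tr_id _).trans (S.right.res_id _)

end

variable {G : Type u} [Group G] [Finite G] {F : Type u} [CommRing F]
  {A : Action (CommAlgCat.{u} F) G}

/-- The relations satisfied by the universal idempotent. -/
structure IsPoint (σ : Splitting A) (S : TAlg (const G F)) (s : S.right.obj σ.pts) : Prop where
  mul : S.right.res (fstMap _ _) s * S.right.res (sndMap _ _) s =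
    S.unit _ (delta σ.pts) * S.right.res (fstMap _ _) s
  tr : S.right.tr (toPoint _) s = 1
  nm : S.right.nm (sndMap (free G) _) (S.right.res (sndMap (free G) _) s) = s

theorem isPoint_idem (σ : Splitting A) : σ.IsPoint ((FP G F).obj A) σ.idem where
  mul := by
    classical
    refine Subtype.ext (funext fun p => σ.equiv.injective (funext fun t => ?_))
    change σ.equiv (σ.point p.1 * σ.point p.2) t =
      σ.equiv (algebraMap F A.V ((delta σ.pts).1 p) * σ.point p.1) t
    rw [map_mul, map_mul, AlgEquiv.commutes, Pi.mul_apply, Pi.mul_apply, equiv_point, equiv_point,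
      delta_apply, Pi.algebraMap_apply]
    by_cases h : t = p.1
    · subst h
      simp
    · simp [h]
  tr := by
    classical
    have := Fintype.ofFinite σ.pts
    refine Subtype.ext (funext fun p => σ.equiv.injective (funext fun t => ?_))
    change σ.equiv (fibreSum (toPoint σ.pts) σ.point p) t = σ.equiv 1 t
    refine (fibreSum_map (A := A.V) ((Pi.evalRingHom (fun _ : σ.pts => F) t).comp
      (σ.equiv : A.V →+* (σ.pts → F))).toAddMonoidHom _ σ.point p).trans ?_
    rw [map_one]
    have : ∀ x, toPoint σ.pts x = p := fun x => rfl
    unfold fibreSum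
    rw [finsum_eq_single _ ⟨t, this t⟩ fun x hx => ?_]
    · exact (σ.equiv_point t t).trans (if_pos rfl)
    · exact (σ.equiv_point x.1 t).trans (if_neg fun h => hx (Subtype.ext h.symm))
  nm := by
    classical
    refine Subtype.ext (funext fun t => ?_)
    change fibreProd (sndMap (free G) σ.pts) (fun p => σ.point p.2) t = σ.point t
    rw [fibreProd_congr (ψ := fun _ => σ.point t) (by rintro x rfl; rfl)]
    have hi : σ.point t ∈ {a : A.V | IsIdempotentElem a} := by
      refine σ.equiv.injective (funext fun t' => ?_)
      rw [map_mul, Pi.mul_apply, equiv_point]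
      split_ifs <;> simp
    have := Fintype.ofFinite {x : (free G).prod σ.pts // sndMap (free G) σ.pts x = t}
    rw [fibreProd, finprod_eq_prod_of_fintype, Finset.prod_const, Finset.card_univ]
    exact IsIdempotentElem.pow_eq hi (Fintype.card_pos_iff.mpr ⟨⟨((1 : G), t), rfl⟩⟩).ne'

variable {σ : Splitting A} {S : TAlg (const G F)} {s : S.right.obj σ.pts}

namespace IsPoint

theorem map (hs : σ.IsPoint S s) {S' : TAlg (const G F)} (f : S ⟶ S') :
    σ.IsPoint S' (f.right.app _ s) where
  mul := by
    have h := congrArg (f.right.app _) hs.mul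
    rwa [map_mul (f.right.app _), map_mul (f.right.app _), TAlg.map_unit, f.right.res,
      f.right.res] at h
  tr := by rw [← f.right.tr, hs.tr, map_one]
  nm := by rw [← f.right.res, ← f.right.nm, hs.nm]

theorem lin_unit (hs : σ.IsPoint S s) {X : FinGSet G} (c : (const G F).obj X) :
    σ.lin s (((FP G F).obj A).unit X c) = S.unit X c := by
  have h : σ.coordHom X (((FP G F).obj A).unit X c) = (const G F).res (sndMap _ _) c :=
    σ.coordHom_hom c
  rw [lin, h, S.unit_res, S.right.frobenius_left, ← S.right.res_tr (isPullback_toPoint σ.pts X),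
    hs.tr, map_one, mul_one]

theorem lin_one (hs : σ.IsPoint S s) {X : FinGSet G} :
    σ.lin s (1 : ((FP G F).obj A).right.obj X) = 1 := by
  rw [← map_one (((FP G F).obj A).unit X), hs.lin_unit, map_one]

theorem lin_zero (hs : σ.IsPoint S s) {X : FinGSet G} :
    σ.lin s (0 : ((FP G F).obj A).right.obj X) = 0 := by
  rw [← map_zero (((FP G F).obj A).unit X), hs.lin_unit, map_zero]

theorem res_mul_lin (hs : σ.IsPoint S s) {Y : FinGSet G} (τ : Y →[G] σ.pts)
    (χ : ((FP G F).obj A).right.obj Y) :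
    S.right.res τ s * σ.lin s χ =
      S.unit Y ((const G F).res (graphOf τ) (σ.coordHom Y χ)) * S.right.res τ s := by
  have h1 := congrArg (S.right.res (timesMap σ.pts τ)) hs.mul
  rw [map_mul, map_mul, ← S.right.res_comp, ← S.right.res_comp, ← S.unit_res, delta,
    (const G F).res_tr (isPullback_graphOf τ), map_one, S.unit_tr, map_one,
    S.right.tr_one_mul] at h1
  change S.right.res (fstMap σ.pts Y) s * S.right.res (τ.comp (sndMap σ.pts Y)) s =
    S.right.tr (graphOf τ) (S.right.res (graphOf τ) (S.right.res (fstMap σ.pts Y) s)) at h1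
  rw [lin, ← S.right.frobenius_left, ← S.right.res_comp, mul_left_comm, mul_comm (S.right.res _ s),
    h1, ← S.right.frobenius_left, ← S.right.tr_comp, ← S.unit_res, ← S.right.res_comp]
  exact S.right.tr_id _

theorem lin_mul (hs : σ.IsPoint S s) {X : FinGSet G} (φ ψ : ((FP G F).obj A).right.obj X) :
    σ.lin s (φ * ψ) = σ.lin s φ * σ.lin s ψ := by
  conv_rhs => rw [lin, ← S.right.frobenius, mul_assoc, ← lin_res, hs.res_mul_lin, ← mul_assoc,
    ← map_mul]
  rw [lin, map_mul (σ.coordHom X)]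
  rfl

/-- At each level, the map determined by `s` is a ring homomorphism. -/
noncomputable def linHom (hs : σ.IsPoint S s) (X : FinGSet G) :
    ((FP G F).obj A).right.obj X →+* S.right.obj X where
  toFun := σ.lin s
  map_one' := hs.lin_one
  map_mul' := hs.lin_mul
  map_zero' := hs.lin_zero
  map_add' := σ.lin_add s

theorem lin_nm_free (hs : σ.IsPoint S s) {X Y : FinGSet G} (f : X →[G] (free G).prod Y)
    (a : ((FP G F).obj A).right.obj X) :
    S.right.nm f (σ.lin s a) = σ.lin s (((FP G F).obj A).right.nm f a) := by
  apply (S.right.additive (fun x : Y => orb (X := (free G).prod Y) ((1 : G), x))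
    (orb_cover (prod_orbits Y))).1
  funext x
  change S.right.res _ (S.right.nm f _) = S.right.res _ (σ.lin s _)
  rw [← lin_res, res_orb_nm, res_orb_nm]
  refine Eq.trans ?_ (fibreProd_map (hs.linHom (free G)).toMonoidHom f _ _).symm
  exact fibreProd_congr fun x _ => (σ.lin_res s (orb x) a).symm

theorem nm_res (hs : σ.IsPoint S s) {Y : FinGSet G} (τ : Y →[G] σ.pts) :
    S.right.nm (sndMap (free G) Y) (S.right.res (sndMap (free G) Y) (S.right.res τ s)) =
      S.right.res τ s := by
  conv_rhs => rw [← hs.nm, S.right.res_nm (isPullback_snd (free G) τ).symm, ← S.right.res_comp]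
  rw [← S.right.res_comp]
  rfl

theorem nm_res_lin (hs : σ.IsPoint S s) {Y : FinGSet G} (a : ((FP G F).obj A).right.obj Y)
    (ha : ∀ y, a.1 y = 0 ∨ a.1 y = 1 ∨ ∃ t, a.1 y = σ.point t) :
    S.right.nm (sndMap (free G) Y) (S.right.res (sndMap (free G) Y) (σ.lin s a)) =
      σ.lin s a := by
  classical
  let κ : Y → ULift.{u} (Fin 3) := fun y => ⟨if a.1 y = 0 then 0 else if a.1 y = 1 then 1 else 2⟩
  have hκ : ∀ (g : G) y, κ (g • y) = κ y := by
    intro g y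
    have inj : Function.Injective (ringAction A g) :=
      Function.LeftInverse.injective (g := ringAction A g⁻¹) fun x => by
        change (ringAction A g⁻¹ * ringAction A g) x = x
        rw [← map_mul, inv_mul_cancel, map_one]
        rfl
    have e0 : a.1 (g • y) = 0 ↔ a.1 y = 0 := by
      rw [show a.1 (g • y) = ringAction A g (a.1 y) from a.2 g y, map_eq_zero_iff _ inj]
    have e1 : a.1 (g • y) = 1 ↔ a.1 y = 1 := by
      rw [show a.1 (g • y) = ringAction A g (a.1 y) from a.2 g y, map_eq_one_iff _ inj]
    simp only [κ, e0, e1]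
  apply (S.right.additive (fun j => Y.subIncl (fun y => κ y = j)
    (fun g x h => (hκ g x).trans h)) (sub_cover κ hκ)).1
  funext j
  change S.right.res _ _ = S.right.res _ _
  set Z := Y.sub (fun y => κ y = j) (fun g x h => (hκ g x).trans h)
  set i : Z →[G] Y := Y.subIncl _ (fun g x h => (hκ g x).trans h)
  rw [S.right.res_nm (isPullback_snd (free G) i).symm, ← S.right.res_comp]
  change S.right.nm (sndMap (free G) Z) (S.right.res (i.comp (sndMap (free G) Z)) (σ.lin s a)) = _
  rw [S.right.res_comp, ← lin_res]
  have hz : ∀ z : Z, κ (i z) = j := fun z => z.2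
  set b : ((FP G F).obj A).right.obj Z := ((FP G F).obj A).right.res i a
  by_cases h0 : ∀ z : Z, b.1 z = 0
  · have hb : b = 0 := Subtype.ext (funext h0)
    rw [hb, ← map_zero (((FP G F).obj A).unit Z), hs.lin_unit, ← S.unit_res, ← S.unit_nm]
    congr 1
    refine Subtype.ext (funext fun z => ?_)
    have : Fintype {x : (free G).prod Z // sndMap (free G) Z x = z} := Fintype.ofFinite _
    change fibreProd (sndMap (free G) Z) (fun _ => (0 : F)) z = 0
    rw [fibreProd, finprod_eq_prod_of_fintype, Finset.prod_const, Finset.card_univ]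
    exact zero_pow (Fintype.card_pos_iff.mpr ⟨⟨((1 : G), z), rfl⟩⟩).ne'
  by_cases h1 : ∀ z : Z, b.1 z = 1
  · have hb : b = 1 := Subtype.ext (funext h1)
    rw [hb, hs.lin_one, map_one, map_one]
  have h2 : ∀ z : Z, ∃ t, b.1 z = σ.point t := by
    push Not at h0 h1
    obtain ⟨z0, hz0⟩ := h0
    obtain ⟨z1, hz1⟩ := h1
    intro z
    rcases ha (i z) with h | h | h
    · have e : κ (i z0) = κ (i z) := (hz z0).trans (hz z).symm
      have hz0 : a.1 (i z0) ≠ 0 := hz0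
      simp only [κ, h, if_true, hz0, if_false, ULift.up_inj] at e
      split_ifs at e <;> simp at e
    · have e : κ (i z1) = κ (i z) := (hz z1).trans (hz z).symm
      have hz1 : a.1 (i z1) ≠ 1 := hz1
      by_cases h01 : (1 : A.V) = 0
      · exact (hz1 ((mul_one _).symm.trans (by rw [h01, mul_zero]))).elim
      · simp only [κ, h, if_true, hz1, if_false, ULift.up_inj, h01] at e
        split_ifs at e <;> simp at e
    · exact h
  by_cases hF : (1 : F) = 0
  · have : Subsingleton (S.right.obj Z) := by
      refine subsingleton_of_zero_eq_one ?_
      rw [← map_one (S.unit Z), ← map_zero (S.unit Z)]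
      exact congrArg _ (Subtype.ext (funext fun _ => hF.symm))
    exact Subsingleton.elim _ _
  have hinj : Function.Injective σ.point := fun t t' h => by
    have := congrFun (congrArg σ.equiv h) t
    rw [equiv_point, equiv_point, if_pos rfl] at this
    by_contra hne
    rw [if_neg hne] at this
    exact hF this
  choose τ hτ using h2
  let τ' : Z →[G] σ.pts := ⟨τ, fun g z => hinj (by
    change σ.point (τ (g • z)) = σ.point (g • τ z)
    rw [← hτ, ← ringAction_point, ← hτ]
    exact b.2 g z)⟩
  have hb : b = ((FP G F).obj A).right.res τ' σ.idem := Subtype.ext (funext hτ)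
  rw [hb, lin_res, lin_idem, hs.nm_res]

theorem nm_res_idem (hs : σ.IsPoint S s) {X Y : FinGSet G} (f : X →[G] Y) (τ : X →[G] σ.pts) :
    S.right.nm f (S.right.res τ s) =
      σ.lin s (((FP G F).obj A).right.nm f (((FP G F).obj A).right.res τ σ.idem)) := by
  rw [← hs.nm_res_lin, ← lin_res, ((FP G F).obj A).right.res_nm (isPullback_snd (free G) f),
    ← hs.lin_nm_free, lin_res, lin_res, lin_idem, ← S.right.nm_comp]
  · conv_lhs => rw [← hs.nm_res τ, ← S.right.nm_comp]
    rfl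
  · classical
    let M : Submonoid A.V :=
      { carrier := {a | a = 0 ∨ a = 1 ∨ ∃ t, a = σ.point t}
        one_mem' := Or.inr (Or.inl rfl)
        mul_mem' := by
          rintro a b (rfl | rfl | ⟨t, rfl⟩) (rfl | rfl | ⟨t', rfl⟩)
          any_goals simp
          · by_cases h : t = t'
            · subst h
              refine Or.inr (Or.inr ⟨t, σ.equiv.injective (funext fun x => ?_)⟩)
              rw [map_mul, Pi.mul_apply, equiv_point]
              split_ifs <;> simp
            · refine Or.inl (σ.equiv.injective (funext fun x => ?_))
              rw [map_mul, Pi.mul_apply, equiv_point, equiv_point, map_zero]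
              split_ifs with h1 h2
              · exact (h (h1.symm.trans h2)).elim
              all_goals simp }
    intro y
    have := Fintype.ofFinite {x // f x = y}
    change fibreProd f (fun x => σ.point (τ x)) y ∈ M
    rw [fibreProd, finprod_eq_prod_of_fintype]
    exact prod_mem fun x _ => Or.inr (Or.inr ⟨_, rfl⟩)

theorem lin_nm (hs : σ.IsPoint S s) {X Y : FinGSet G} (f : X →[G] Y)
    (φ : ((FP G F).obj A).right.obj X) :
    σ.lin s (((FP G F).obj A).right.nm f φ) = S.right.nm f (σ.lin s φ) := by
  obtain ⟨E, P, e, p', q', h⟩ := exists_exponential (sndMap σ.pts X) f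
  conv_lhs => rw [← σ.reconstruct φ]
  rw [((FP G F).obj A).right.nm_tr h, lin_tr, map_mul, map_mul, hs.lin_mul]
  conv_rhs => rw [lin, S.right.nm_tr h, map_mul, map_mul]
  congr 2
  · rw [← S.unit_res, ← S.unit_nm, ← hs.lin_unit, TAlg.unit_nm, TAlg.unit_res]
    rfl
  · rw [← ((FP G F).obj A).right.res_comp, ← hs.nm_res_idem, S.right.res_comp]

/-- The map of algebras determined by an element which satisfies the relations of the universal
idempotent. -/
noncomputable def desc (hs : σ.IsPoint S s) : (FP G F).obj A ⟶ S :=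
  Under.homMk (U := (FP G F).obj A) (V := S)
    { app := hs.linHom
      res := σ.lin_res s
      tr := σ.lin_tr s
      nm := hs.lin_nm }
    (TambaraFunctor.hom_ext fun _ => hs.lin_unit)

theorem desc_idem (hs : σ.IsPoint S s) : hs.desc.right.app _ σ.idem = s := σ.lin_idem s

end IsPoint

theorem isFinitelyPresented (σ : Splitting A) : ((FP G F).obj A).IsFinitelyPresented := by
  refine ⟨1, fun _ => σ.pts, fun _ => σ.idem, 3,
    fun | 0 => σ.pts.prod σ.pts | 1 => Tamb.point G | 2 => σ.pts,
    fun
      | 0 => .mul (.res (fstMap _ _) (.var 0)) (.res (sndMap _ _) (.var 0))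
      | 1 => .tr (toPoint _) (.var 0)
      | 2 => .nm (sndMap (free G) _) (.res (sndMap (free G) _) (.var 0)),
    fun
      | 0 => .mul (.const (delta σ.pts)) (.res (fstMap _ _) (.var 0))
      | 1 => .const 1
      | 2 => .var 0, ?_, fun S s hs => ?_⟩
  · intro i
    fin_cases i
    · exact σ.isPoint_idem.mul
    · exact σ.isPoint_idem.tr.trans (map_one (((FP G F).obj A).unit _)).symm
    · exact σ.isPoint_idem.nm
  · have h : σ.IsPoint S (s 0) := ⟨hs 0, (hs 1).trans (map_one (S.unit _)), hs 2⟩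
    refine ⟨h.desc, fun j => ?_, fun Φ hΦ => σ.hom_ext ((hΦ 0).trans h.desc_idem.symm)⟩
    fin_cases j
    exact h.desc_idem

end Splitting

end Tamb

namespace Tamb

open CategoryTheory

section Functions

variable {G : Type u} [Group G] {F : Type u} [CommRing F]

/-- The `F`-algebra of functions on a finite `G`-set. -/
noncomputable def fnAction (F : Type u) [CommRing F] (T : FinGSet G) :
    Action (CommAlgCat.{u} F) G where
  V := CommAlgCat.of F (T → F)
  ρ :=
    { toFun := fun g => CommAlgCat.ofHom
        (AlgHom.pi fun t : T => Pi.evalAlgHom F (fun _ : T => F) (g⁻¹ • t))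
      map_one' := CommAlgCat.hom_ext (AlgHom.ext fun f => funext fun t =>
        congrArg f (by rw [inv_one, one_smul] : (1 : G)⁻¹ • t = t))
      map_mul' := fun g h => CommAlgCat.hom_ext (AlgHom.ext fun f => funext fun t =>
        congrArg f (by rw [mul_inv_rev, mul_smul] : (g * h)⁻¹ • t = h⁻¹ • g⁻¹ • t)) }

/-- The identity as a splitting of the algebra of functions on a finite `G`-set. -/
noncomputable def fnSplitting (F : Type u) [CommRing F] (T : FinGSet G) :
    Splitting (fnAction F T) where
  pts := T
  equiv := AlgEquiv.refl
  equivariant _ _ _ := rfl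

namespace Splitting

variable {A : Action (CommAlgCat.{u} F) G} (σ : Splitting A)

/-- The map from a split algebra to functions on a finite `G`-set induced by a map to the points. -/
noncomputable def toFn {T : FinGSet G} (f : T →[G] σ.pts) : A ⟶ fnAction F T where
  hom := CommAlgCat.ofHom
    ((AlgHom.pi fun t : T => Pi.evalAlgHom F (fun _ : σ.pts => F) (f t)).comp
      (σ.equiv : A.V →ₐ[F] (σ.pts → F)))
  comm g := CommAlgCat.hom_ext (AlgHom.ext fun a => funext fun t =>
    (σ.equivariant g a (f t)).trans (congrArg (σ.equiv a) (map_smul f g⁻¹ t).symm))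

/-- The map from functions on a finite `G`-set to a split algebra induced by a map of the points. -/
noncomputable def ofFn {T : FinGSet G} (f : σ.pts →[G] T) : fnAction F T ⟶ A where
  hom := CommAlgCat.ofHom ((σ.equiv.symm : (σ.pts → F) →ₐ[F] A.V).comp
    (AlgHom.pi fun t : σ.pts => Pi.evalAlgHom F (fun _ : T => F) (f t)))
  comm g := CommAlgCat.hom_ext (AlgHom.ext fun φ => σ.equiv.injective (funext fun t => by
    change σ.equiv (σ.equiv.symm fun t => φ (g⁻¹ • f t)) t =
      σ.equiv (ringAction A g (σ.equiv.symm fun t => φ (f t))) t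
    rw [σ.equivariant, AlgEquiv.apply_symm_apply, AlgEquiv.apply_symm_apply, map_smul]))

theorem equiv_ofFn {T : FinGSet G} (f : σ.pts →[G] T) (φ : T → F) (t : σ.pts) :
    σ.equiv ((σ.ofFn f).hom.hom φ) t = φ (f t) :=
  congrFun (σ.equiv.apply_symm_apply _) t

theorem toFn_ofFn {T : FinGSet G} (f : T →[G] σ.pts) (h : σ.pts →[G] T)
    (e : ∀ t, f (h t) = t) : σ.toFn f ≫ σ.ofFn h = 𝟙 A := by
  refine Action.hom_ext _ _ (CommAlgCat.hom_ext (AlgHom.ext fun a => σ.equiv.injective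
    (funext fun t => ?_)))
  exact (σ.equiv_ofFn h _ t).trans (congrArg (σ.equiv a) (e t))

/-- The identification of two descriptions of the value at `X` of the box square of `FP(A)`. -/
noncomputable def uncurry (X : FinGSet G)
    (χ : ((FP G F).obj A).right.obj (σ.pts.prod X)) :
    ((FP G F).obj (fnAction F (σ.pts.prod σ.pts))).right.obj X :=
  ⟨fun x p => σ.equiv (χ.1 ((p.1, x) : σ.pts.prod X)) p.2, fun g x => funext fun p => by
    have h : χ.1 ((p.1, g • x) : σ.pts.prod X) =
        ringAction A g (χ.1 ((g⁻¹ • p.1, x) : σ.pts.prod X)) := by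
      refine Eq.trans (congrArg χ.1 ?_) (χ.2 g ((g⁻¹ • p.1, x) : σ.pts.prod X))
      exact Prod.ext (smul_inv_smul g p.1).symm rfl
    change σ.equiv (χ.1 ((p.1, g • x) : σ.pts.prod X)) p.2 = _
    rw [h, σ.equivariant]
    rfl⟩

theorem uncurry_bijective (X : FinGSet G) : Function.Bijective (σ.uncurry X) := by
  constructor
  · intro χ χ' h
    refine Subtype.ext (funext fun p => σ.equiv.injective (funext fun t => ?_))
    exact congrFun (congrFun (congrArg Subtype.val h) p.2) ((p.1, t) : σ.pts.prod σ.pts)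
  · intro ψ
    refine ⟨⟨fun p => σ.equiv.symm fun t => (ψ.1 p.2 : σ.pts.prod σ.pts → F) (p.1, t),
      fun g p => σ.equiv.injective (funext fun t => ?_)⟩,
      Subtype.ext (funext fun x => funext fun p => ?_)⟩
    · rw [AlgEquiv.apply_symm_apply, σ.equivariant, AlgEquiv.apply_symm_apply]
      refine (congrFun (ψ.2 g p.2) _).trans ?_
      change (ψ.1 p.2 : σ.pts.prod σ.pts → F) (g⁻¹ • (g • p.1), g⁻¹ • t) = _
      rw [inv_smul_smul]
    · exact congrFun (σ.equiv.apply_symm_apply _) p.2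

/-- The first coprojection of the box square of `FP(A)`. -/
noncomputable def inl : A ⟶ fnAction F (σ.pts.prod σ.pts) := σ.toFn (fstMap _ _)

/-- The second coprojection of the box square of `FP(A)`. -/
noncomputable def inr : A ⟶ fnAction F (σ.pts.prod σ.pts) := σ.toFn (sndMap _ _)

theorem uncurry_boxCoord [Finite G] (X : FinGSet G)
    (z : TModule.Box ((FP G F).obj A).toModule ((FP G F).obj A).toModule X) :
    σ.uncurry X (TModule.boxCoord σ.coordMap ((FP G F).obj A).toModule X z) =
      TAlg.boxDesc ((FP G F).map σ.inl) ((FP G F).map σ.inr) X z := by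
  let β : ((FP G F).obj A).right.obj (σ.pts.prod X) →+
      ((FP G F).obj (fnAction F (σ.pts.prod σ.pts))).right.obj X :=
    { toFun := σ.uncurry X
      map_zero' := Subtype.ext (funext fun x => funext fun p => congrFun (map_zero σ.equiv) p.2)
      map_add' := fun χ χ' => Subtype.ext (funext fun x => funext fun p =>
        congrFun (map_add σ.equiv _ _) p.2) }
  have h : β.comp (TModule.boxCoord σ.coordMap ((FP G F).obj A).toModule X) =
      TAlg.boxDesc ((FP G F).map σ.inl) ((FP G F).map σ.inr) X := by
    refine TModule.box_hom_ext fun Y f a b => ?_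
    refine (congrArg (σ.uncurry X) (TModule.boxCoord_box σ.coordMap _ f a b)).trans ?_
    refine Eq.trans ?_ (boxDesc_box ((FP G F).map σ.inl) ((FP G F).map σ.inr) f
      (a : ((FP G F).obj A).right.obj Y) (b : ((FP G F).obj A).right.obj Y)).symm
    refine Subtype.ext (funext fun x => funext fun p => ?_)
    let ev : A.V →+* F := (Pi.evalRingHom (fun _ : σ.pts => F) p.2).comp
      (σ.equiv : A.V →+* (σ.pts → F))
    let ev' : (σ.pts.prod σ.pts → F) →+* F := Pi.evalRingHom (fun _ => F) p
    refine (fibreSum_map ev.toAddMonoidHom (timesMap σ.pts f) _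
      ((p.1, x) : σ.pts.prod X)).trans ?_
    refine Eq.trans ?_ (fibreSum_map (A := σ.pts.prod σ.pts → F) ev'.toAddMonoidHom f _ x).symm
    refine Eq.trans ?_ (fibreSum_pullback (isPullback_snd σ.pts f) _
      ((p.1, x) : σ.pts.prod X)).symm
    refine fibreSum_congr fun w hw => ?_
    have hw1 : w.1 = p.1 := congrArg Prod.fst hw
    change σ.equiv (algebraMap F A.V (σ.equiv (a.1 w.2) w.1) * b.1 w.2) p.2 =
      σ.equiv (a.1 w.2) p.1 * σ.equiv (b.1 w.2) p.2
    rw [map_mul, AlgEquiv.commutes, hw1]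
    rfl
  exact DFunLike.congr_fun h z

/-- The box square of `FP(A)`. -/
noncomputable def boxSquare [Finite G] : TAlg.BoxSquare ((FP G F).obj A) where
  alg := (FP G F).obj (fnAction F (σ.pts.prod σ.pts))
  inl := (FP G F).map σ.inl
  inr := (FP G F).map σ.inr
  bijective X := by
    have h : ⇑(TAlg.boxDesc ((FP G F).map σ.inl) ((FP G F).map σ.inr) X) = σ.uncurry X ∘
        TModule.boxCoord σ.coordMap ((FP G F).obj A).toModule X :=
      funext fun z => (σ.uncurry_boxCoord X z).symm
    rw [h]
    exact (σ.uncurry_bijective X).comp (TModule.boxCoord_bijective (ι := σ.coordMap)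
      (e := σ.idem) σ.coordHom_injective σ.coordHom_idem _ X)
  mul := (FP G F).map (σ.ofFn (diagMap _))
  inl_mul := by
    rw [← Functor.map_comp, inl, toFn_ofFn _ _ _ fun _ => rfl, CategoryTheory.Functor.map_id]
  inr_mul := by
    rw [← Functor.map_comp, inr, toFn_ofFn _ _ _ fun _ => rfl, CategoryTheory.Functor.map_id]

theorem isFormallyEtale [Finite G] (σ : Splitting A) :
    ((FP G F).obj A).IsFormallyEtale := by
  classical
  refine ⟨σ.isFlat, σ.boxSquare, fun X => ⟨fun x y => ?_⟩⟩
  have key : ∀ a : TAlg.ker σ.boxSquare.mul X,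
      a.1 ∈ TAlg.powGTOne σ.boxSquare.alg.right (TAlg.ker σ.boxSquare.mul) X := by
    intro a
    have ha : ∀ x t, (a.1.1 x : σ.pts.prod σ.pts → F) (t, t) = 0 := fun x t => by
      have h := congrFun (congrArg σ.equiv (congrFun (congrArg Subtype.val a.2) x)) t
      exact (σ.equiv_ofFn (diagMap _) (a.1.1 x) t).symm.trans (h.trans (congrFun (map_zero _) t))
    let d : σ.boxSquare.alg.right.obj X :=
      ⟨fun _ (p : σ.pts.prod σ.pts) => if p.1 = p.2 then 0 else 1, fun g x => funext fun p => by
        change _ = if g⁻¹ • p.1 = g⁻¹ • p.2 then (0 : F) else 1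
        simp only [smul_left_cancel_iff]⟩
    have hd : d ∈ TAlg.ker σ.boxSquare.mul X :=
      Subtype.ext (funext fun x => σ.equiv.injective (funext fun t =>
        (σ.equiv_ofFn (diagMap _) _ t).trans
          ((if_pos rfl).trans (congrFun (map_zero σ.equiv) t).symm)))
    have hm : a.1 = d * a.1 := Subtype.ext (funext fun x => funext fun p => by
      change (a.1.1 x : σ.pts.prod σ.pts → F) p =
        (if p.1 = p.2 then 0 else 1) * (a.1.1 x : σ.pts.prod σ.pts → F) p
      obtain ⟨s, t⟩ := p
      by_cases h : s = t
      · subst h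
        rw [ha, mul_zero]
      · rw [if_neg h, one_mul])
    rw [hm]
    exact TAlg.InPowGTOne.prod hd a.2
  obtain ⟨a, rfl⟩ := Submodule.Quotient.mk_surjective _ x
  obtain ⟨b, rfl⟩ := Submodule.Quotient.mk_surjective _ y
  exact (Submodule.Quotient.eq _).mpr (key (a - b))

theorem isEtale [Finite G] (σ : Splitting A) : ((FP G F).obj A).IsEtale :=
  ⟨σ.isFormallyEtale, σ.isFinitelyPresented⟩

end Splitting

end Functions

section Existence

variable {G : Type u} [Group G] {F : Type u} [Field F] [IsAlgClosed F]

/-- Finite étale algebras over an algebraically closed field are split. -/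
theorem exists_splitting (A : Action (CommAlgCat.{u} F) G) [Module.Finite F A.V]
    [Algebra.Etale F A.V] : Nonempty (Splitting A) := by
  have : IsArtinianRing A.V := IsArtinianRing.of_finite F A.V
  let _ : MulAction G (PrimeSpectrum A.V) :=
    { smul := fun g p => p.comap (ringAction A g⁻¹)
      one_smul := fun p => by
        change p.comap (ringAction A (1 : G)⁻¹) = p
        rw [inv_one, map_one]
        rfl
      mul_smul := fun g h p => by
        change p.comap (ringAction A (g * h)⁻¹) = (p.comap (ringAction A h⁻¹)).comap _
        rw [mul_inv_rev, map_mul]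
        rfl }
  exact ⟨{
    pts := ⟨PrimeSpectrum A.V⟩
    equiv := Algebra.FormallyEtale.equivPiOfIsSepClosed F A.V
    equivariant := fun g a p => by
      refine (Algebra.FormallyEtale.equivPiOfIsSepClosed_comap (A.ρ g).hom a p).symm.trans ?_
      refine congrArg (Algebra.FormallyEtale.equivPiOfIsSepClosed F A.V a) ?_
      change _ = p.comap (ringAction A g⁻¹⁻¹)
      rw [inv_inv]
      rfl }⟩

end Existence

end Tamb

namespace Tamb

open CategoryTheory

universe v w

namespace GrpSch

variable {C : Type w} [Category.{v} C]

theorem one_comp (𝒢 : GrpSch C) {S T : C} (f : S ⟶ T) : (1 : 𝒢.alg ⟶ S) ≫ f = 1 :=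
  map_one (𝒢.points.map f).hom

theorem inv_comp (𝒢 : GrpSch C) {S T : C} (a : 𝒢.alg ⟶ S) (f : S ⟶ T) :
    a⁻¹ ≫ f = (a ≫ f)⁻¹ :=
  map_inv (𝒢.points.map f).hom a

theorem rep_comp_one {𝒢 ℋ : GrpSch C} (α : 𝒢 ⟶ ℋ) (S : C) :
    rep α ≫ (1 : 𝒢.alg ⟶ S) = 1 :=
  (rep_comp_eq α 1).trans (map_one (α.hom.app S).hom)

theorem rep_comp_inv {𝒢 ℋ : GrpSch C} (α : 𝒢 ⟶ ℋ) {S : C} (a : 𝒢.alg ⟶ S) :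
    rep α ≫ a⁻¹ = (rep α ≫ a)⁻¹ := by
  rw [rep_comp_eq, rep_comp_eq]
  exact map_inv (α.hom.app S).hom a

/-- The isomorphism of affine group schemes represented by an isomorphism of algebras. -/
def isoOfRep {𝒢 ℋ : GrpSch C} (c : ℋ.alg ≅ 𝒢.alg)
    (hc : ∀ (S : C) (a b : 𝒢.alg ⟶ S), c.hom ≫ (a * b) = (c.hom ≫ a) * (c.hom ≫ b)) : 𝒢 ≅ ℋ where
  hom := ofRep c.hom hc
  inv := ofRep c.inv fun S a b => by
    rw [← cancel_epi c.hom, hc, Iso.hom_inv_id_assoc, Iso.hom_inv_id_assoc, Iso.hom_inv_id_assoc]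
  hom_inv_id := hom_ext_rep (by
    rw [rep_comp, rep_ofRep, rep_ofRep, Iso.inv_hom_id]
    rfl)
  inv_hom_id := hom_ext_rep (by
    rw [rep_comp, rep_ofRep, rep_ofRep, Iso.hom_inv_id]
    rfl)

/-- The algebra with `G`-action representing an affine group scheme with `G`-action. -/
abbrev algAct {G : Type u} [Group G] (𝒜 : Action (GrpSch C) G) : Action C G :=
  ((repActionFunctor C G).obj 𝒜).unop

end GrpSch

section LevelwiseIso

variable {G : Type u} [Group G] {k : TambaraFunctor G}

theorem TAlg.exists_iso {R S : TAlg k} (φ : R ⟶ S)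
    (h : ∀ X, Function.Bijective (φ.right.app X)) : ∃ c : R ≅ S, c.hom = φ := by
  let e := fun X => RingEquiv.ofBijective (φ.right.app X) (h X)
  have he : ∀ X a, φ.right.app X ((e X).symm a) = a := fun X a => (e X).apply_symm_apply a
  let ψ : S ⟶ R := Under.homMk
    { app := fun X => ((e X).symm : S.right.obj X →+* R.right.obj X)
      res := fun {X Y} f a => (h X).1 (by
        refine (he X _).trans ?_
        rw [φ.right.res]
        exact congrArg _ (he Y a).symm)
      tr := fun {X Y} f a => (h Y).1 (by
        refine (he Y _).trans ?_
        rw [φ.right.tr]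
        exact congrArg _ (he X a).symm)
      nm := fun {X Y} f a => (h Y).1 (by
        refine (he Y _).trans ?_
        rw [φ.right.nm]
        exact congrArg _ (he X a).symm) }
    (TambaraFunctor.hom_ext fun X c => (h X).1 ((he X _).trans (hom_app_const φ X c).symm))
  exact ⟨⟨φ, ψ, Under.UnderMorphism.ext (TambaraFunctor.hom_ext fun X a =>
    (e X).symm_apply_apply a), Under.UnderMorphism.ext (TambaraFunctor.hom_ext he)⟩, rfl⟩

end LevelwiseIso

section Comparison

variable {G : Type u} [Group G] {F : Type u} [CommRing F]

namespace Splitting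

theorem map_toFn_idem {A : Action (CommAlgCat.{u} F) G} (σ : Splitting A) {T : FinGSet G} (f : T →[G] σ.pts) :
    ((FP G F).map (σ.toFn f)).right.app _ σ.idem =
      ((FP G F).obj (fnAction F T)).right.tr f (fnSplitting F T).idem := by
  classical
  refine Subtype.ext (funext fun t => funext fun p => ?_)
  refine (σ.equiv_point t (f p)).trans ?_
  refine Eq.trans ?_ (fibreSum_map (A := T → F) (Pi.evalRingHom (fun _ : T => F) p).toAddMonoidHom
    f (fnSplitting F T).point t).symm
  have h : ∀ q : T, ((fnSplitting F T).point q : T → F) p = if p = q then 1 else 0 := fun q =>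
    (fnSplitting F T).equiv_point q p
  refine Eq.trans ?_ (fibreSum_congr (f := f) (y := t) fun q _ => h q).symm
  unfold fibreSum
  split_ifs with hp
  · rw [finsum_eq_single _ ⟨p, hp⟩ fun x hx => if_neg fun e => hx (Subtype.ext e.symm)]
    exact (if_pos rfl).symm
  · refine ((finsum_congr fun x => if_neg fun e => hp ?_).trans finsum_zero).symm
    rw [e]
    exact x.2

theorem delta_prod (T : FinGSet G) :
    (delta (T.prod T) : (const G F).obj ((T.prod T).prod (T.prod T))) =
      (const G F).res ((timesMap T (fstMap T T)).comp (mapTimes (fstMap T T) _)) (delta T) *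
      (const G F).res ((timesMap T (sndMap T T)).comp (mapTimes (sndMap T T) _)) (delta T) := by
  classical
  refine Subtype.ext (funext fun p => ?_)
  refine (delta_apply (F := F) (T.prod T) p).trans ?_
  change _ = (delta (F := F) T).1 ((p.1.1, p.2.1) : T.prod T) *
    (delta (F := F) T).1 ((p.1.2, p.2.2) : T.prod T)
  rw [delta_apply (F := F) T, delta_apply (F := F) T, Prod.ext_iff]
  split_ifs <;> simp_all

end Splitting

variable [Finite G]

/-- The canonical isomorphism `A ≅ FP(A)(G/e)`. -/
noncomputable def toBottom (A : Action (CommAlgCat.{u} F) G) :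
    A ≅ (evAlg G F).obj ((FP G F).obj A) where
  hom :=
    { hom := CommAlgCat.ofHom
        { toFun := fun a => (⟨fun g : G => ringAction A g a, fun g h => by
            change ringAction A (g * h) a = _
            rw [map_mul]
            rfl⟩ : ((FP G F).obj A).right.obj (free G))
          map_one' := Subtype.ext (funext fun g : G => map_one (ringAction A g))
          map_mul' := fun a b => Subtype.ext (funext fun g : G => map_mul (ringAction A g) a b)
          map_zero' := Subtype.ext (funext fun g : G => map_zero (ringAction A g))
          map_add' := fun a b => Subtype.ext (funext fun g : G => map_add (ringAction A g) a b)
          commutes' := fun c => Subtype.ext (funext fun g : G => (A.ρ g).hom.commutes c) }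
      comm := fun h => CommAlgCat.hom_ext (AlgHom.ext fun a => Subtype.ext (funext fun g : G => by
        change ringAction A g (ringAction A h a) = ringAction A (g * h) a
        rw [map_mul]
        rfl)) }
  inv :=
    { hom := CommAlgCat.ofHom
        { toFun := fun φ : ((FP G F).obj A).right.obj (free G) => φ.1 (1 : G)
          map_one' := rfl
          map_mul' := fun _ _ => rfl
          map_zero' := rfl
          map_add' := fun _ _ => rfl
          commutes' := fun _ => rfl }
      comm := fun h => CommAlgCat.hom_ext (AlgHom.ext fun
        (φ : ((FP G F).obj A).right.obj (free G)) => by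
          refine Eq.trans (congrArg φ.1 ?_) (φ.2 h (1 : G))
          exact (one_mul h).trans (mul_one h).symm) }
  hom_inv_id := Action.hom_ext _ _ (CommAlgCat.hom_ext (AlgHom.ext fun a => by
    change ringAction A (1 : G) a = a
    rw [map_one]
    rfl))
  inv_hom_id := Action.hom_ext _ _ (CommAlgCat.hom_ext (AlgHom.ext fun
    (φ : ((FP G F).obj A).right.obj (free G)) => Subtype.ext (funext fun g : G =>
      (φ.2 g (1 : G)).symm.trans (congrArg φ.1 (mul_one g)))))

theorem toBottom_inv_apply (A : Action (CommAlgCat.{u} F) G)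
    (φ : ((FP G F).obj A).right.obj (free G)) :
    (toBottom A).hom.hom.hom (φ.1 (1 : G)) = φ :=
  congrArg (fun v => v.hom.hom φ) (toBottom A).inv_hom_id

theorem toBottom_naturality {A B : Action (CommAlgCat.{u} F) G} (c : A ⟶ B) :
    c ≫ (toBottom B).hom = (toBottom A).hom ≫ (evAlg G F).map ((FP G F).map c) :=
  Action.hom_ext _ _ (CommAlgCat.hom_ext (AlgHom.ext fun a => Subtype.ext (funext fun g : G =>
    (congrArg (fun v => v.hom a) (c.comm g) :).symm)))

/-- The value at `G/e` of a map out of `FP(A)`. -/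
noncomputable def bottomPt {A : Action (CommAlgCat.{u} F) G} {S : TAlg (const G F)}
    (U : (FP G F).obj A ⟶ S) : A ⟶ (evAlg G F).obj S :=
  (toBottom A).hom ≫ (evAlg G F).map U

theorem bottomPt_comp {A : Action (CommAlgCat.{u} F) G} {S S' : TAlg (const G F)}
    (U : (FP G F).obj A ⟶ S) (f : S ⟶ S') : bottomPt (U ≫ f) = bottomPt U ≫ (evAlg G F).map f := by
  rw [bottomPt, bottomPt, CategoryTheory.Functor.map_comp, Category.assoc]

theorem bottomPt_precomp {A B : Action (CommAlgCat.{u} F) G} (c : A ⟶ B) {S : TAlg (const G F)}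
    (U : (FP G F).obj B ⟶ S) : bottomPt ((FP G F).map c ≫ U) = c ≫ bottomPt U := by
  rw [bottomPt, bottomPt, CategoryTheory.Functor.map_comp, ← Category.assoc, ← toBottom_naturality,
    Category.assoc]

namespace Splitting

variable {A : Action (CommAlgCat.{u} F) G} (σ : Splitting A) {S : TAlg (const G F)}

theorem bottomPt_injective (σ : Splitting A) :
    Function.Injective (bottomPt (A := A) (S := S)) := by
  intro U V h
  refine σ.hom_ext ?_
  rw [← (σ.isPoint_idem.map U).nm, ← (σ.isPoint_idem.map V).nm]
  congr 1
  apply (S.right.additive (fun x : σ.pts => orb (X := (free G).prod σ.pts) ((1 : G), x))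
    (orb_cover (prod_orbits σ.pts))).1
  funext t
  have key : ∀ W : (FP G F).obj A ⟶ S,
      S.right.res (orb (X := (free G).prod σ.pts) ((1 : G), t))
        (S.right.res (sndMap (free G) σ.pts) (W.right.app _ σ.idem)) =
      (bottomPt W).hom.hom (σ.point t) := fun W => by
    rw [← S.right.res_comp, comp_orb, ← W.right.res]
    exact congrArg (W.right.app (free G)) (Subtype.ext (funext fun g : G =>
      (σ.ringAction_point g t).symm))
  exact (key U).trans ((congrArg (fun v => v.hom.hom (σ.point t)) h).trans (key V).symm)

variable {s t : S.right.obj σ.pts}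

/-- The element of `S(T × T)` given by a pair of elements of `S(T)`. -/
noncomputable def pairing (s t : S.right.obj σ.pts) : S.right.obj (σ.pts.prod σ.pts) :=
  S.right.res (fstMap _ _) s * S.right.res (sndMap _ _) t

theorem tr_fst (ht : σ.IsPoint S t) : S.right.tr (fstMap σ.pts σ.pts) (σ.pairing s t) = s := by
  rw [pairing, S.right.frobenius_left, ← S.right.res_tr (isPullback_toPoint σ.pts σ.pts).symm, ht.tr,
    map_one, mul_one]

theorem tr_snd (hs : σ.IsPoint S s) : S.right.tr (sndMap σ.pts σ.pts) (σ.pairing s t) = t := by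
  rw [pairing, S.right.frobenius, ← S.right.res_tr (isPullback_toPoint σ.pts σ.pts), hs.tr,
    map_one, one_mul]

theorem isPoint_fn {T : FinGSet G} {s : S.right.obj T}
    (mul : S.right.res (fstMap T T) s * S.right.res (sndMap T T) s =
      S.unit _ (delta T) * S.right.res (fstMap T T) s)
    (tr : S.right.tr (toPoint T) s = 1)
    (nm : S.right.nm (sndMap (free G) T) (S.right.res (sndMap (free G) T) s) = s) :
    (fnSplitting F T).IsPoint S s := ⟨mul, tr, nm⟩

theorem isPoint_prod (hs : σ.IsPoint S s) (ht : σ.IsPoint S t) :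
    (fnSplitting F (σ.pts.prod σ.pts)).IsPoint S (σ.pairing s t) := by
  refine isPoint_fn ?_ ?_ ?_
  · have h1 := congrArg (S.right.res ((timesMap σ.pts (fstMap σ.pts σ.pts)).comp
      (mapTimes (fstMap σ.pts σ.pts) _))) hs.mul
    have h2 := congrArg (S.right.res ((timesMap σ.pts (sndMap σ.pts σ.pts)).comp
      (mapTimes (sndMap σ.pts σ.pts) _))) ht.mul
    rw [map_mul, map_mul, ← S.right.res_comp, ← S.right.res_comp, ← S.unit_res] at h1 h2
    rw [delta_prod, pairing, map_mul, map_mul, map_mul, ← S.right.res_comp, ← S.right.res_comp,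
      ← S.right.res_comp, ← S.right.res_comp, mul_mul_mul_comm]
    exact (congrArg₂ (· * ·) h1 h2).trans (mul_mul_mul_comm _ _ _ _)
  · have h : toPoint (σ.pts.prod σ.pts) = (toPoint σ.pts).comp (fstMap _ _) := rfl
    rw [h, S.right.tr_comp, σ.tr_fst ht, hs.tr]
  · rw [pairing, map_mul, map_mul]
    exact congrArg₂ (· * ·) (hs.nm_res (fstMap _ _)) (ht.nm_res (sndMap _ _))

theorem exists_pairing (U V : (FP G F).obj A ⟶ S) :
    ∃ W : (FP G F).obj (fnAction F (σ.pts.prod σ.pts)) ⟶ S,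
      (FP G F).map σ.inl ≫ W = U ∧ (FP G F).map σ.inr ≫ W = V := by
  have hs := σ.isPoint_idem.map U
  have ht := σ.isPoint_idem.map V
  obtain ⟨W, hW⟩ : ∃ W : (FP G F).obj (fnAction F (σ.pts.prod σ.pts)) ⟶ S,
      W.right.app (σ.pts.prod σ.pts) (fnSplitting F (σ.pts.prod σ.pts)).idem =
        σ.pairing (U.right.app _ σ.idem) (V.right.app _ σ.idem) :=
    ⟨(σ.isPoint_prod hs ht).desc, (σ.isPoint_prod hs ht).desc_idem⟩
  refine ⟨W, σ.hom_ext ?_, σ.hom_ext ?_⟩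
  · refine (congrArg (W.right.app _) (σ.map_toFn_idem (fstMap _ _))).trans ?_
    refine (W.right.tr _ _).trans ?_
    exact (congrArg (S.right.tr _) hW).trans (σ.tr_fst ht)
  · refine (congrArg (W.right.app _) (σ.map_toFn_idem (sndMap _ _))).trans ?_
    refine (W.right.tr _ _).trans ?_
    exact (congrArg (S.right.tr _) hW).trans (σ.tr_snd hs)

theorem isPoint_one (S : TAlg (const G F)) : (fnSplitting F (Tamb.point G)).IsPoint S
    (1 : S.right.obj (Tamb.point G)) := by
  classical
  have h : (delta (Tamb.point G) : (const G F).obj ((Tamb.point G).prod (Tamb.point G))) = 1 :=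
    Subtype.ext (funext fun p => (delta_apply (F := F) (Tamb.point G) p).trans (if_pos rfl))
  refine isPoint_fn ?_ (S.right.tr_id 1) ?_
  · rw [h, map_one, map_one, map_one]
  · rw [map_one, map_one]

end Splitting

end Comparison

end Tamb

namespace Tamb

open CategoryTheory

section FixedPointGroup

variable {G : Type u} [Group G] [Finite G] {F : Type u} [CommRing F]

open GrpSch

/-- A map of algebras with `G`-action out of the algebra of a group scheme with `G`-action. -/
def actHom {𝒜 : Action (GrpSch (CommAlgCat.{u} F)) G} {B : Action (CommAlgCat.{u} F) G}
    (a : 𝒜.V.alg ⟶ B.V) (ha : ∀ g, rep (𝒜.ρ g⁻¹) ≫ a = a ≫ B.ρ g) : algAct 𝒜 ⟶ B where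
  hom := a
  comm := ha

variable (𝒜 : Action (GrpSch (CommAlgCat.{u} F)) G)

/-- The map of `F`-algebras given by a map out of `FP(A)`, as a point of the group scheme. -/
noncomputable def toPt (S : TAlg (const G F)) (U : (FP G F).obj (algAct 𝒜) ⟶ S) :
    𝒜.V.alg ⟶ ((evAlg G F).obj S).V :=
  (bottomPt U).hom

theorem toPt_comp {S S' : TAlg (const G F)} (U : (FP G F).obj (algAct 𝒜) ⟶ S) (f : S ⟶ S') :
    toPt 𝒜 S' (U ≫ f) = toPt 𝒜 S U ≫ ((evAlg G F).map f).hom :=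
  congrArg Action.Hom.hom (bottomPt_comp U f)

theorem toPt_precomp {B : Action (CommAlgCat.{u} F) G} (c : algAct 𝒜 ⟶ B) {S : TAlg (const G F)}
    (U : (FP G F).obj B ⟶ S) :
    toPt 𝒜 S ((FP G F).map c ≫ U) = c.hom ≫ (bottomPt U).hom :=
  congrArg Action.Hom.hom (bottomPt_precomp c U)

variable {𝒜}

theorem toPt_injective (σ : Splitting (algAct 𝒜)) (S : TAlg (const G F)) :
    Function.Injective (toPt 𝒜 S) :=
  fun _ _ h => σ.bottomPt_injective (Action.hom_ext _ _ h)

theorem mem_range_mul (σ : Splitting (algAct 𝒜)) {S : TAlg (const G F)}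
    (U V : (FP G F).obj (algAct 𝒜) ⟶ S) :
    toPt 𝒜 S U * toPt 𝒜 S V ∈ Set.range (toPt 𝒜 S) := by
  obtain ⟨W, rfl, rfl⟩ := σ.exists_pairing U V
  let l : 𝒜.V.alg ⟶ (fnAction F (σ.pts.prod σ.pts)).V := σ.inl.hom
  let r : 𝒜.V.alg ⟶ (fnAction F (σ.pts.prod σ.pts)).V := σ.inr.hom
  refine ⟨(FP G F).map (actHom (𝒜 := 𝒜) (l * r) fun g => ?_) ≫ W, ?_⟩
  · rw [rep_comp_mul, 𝒜.V.mul_comp]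
    exact congrArg₂ (· * ·) (σ.inl.comm g) (σ.inr.comm g)
  · rw [toPt_precomp, toPt_precomp, toPt_precomp]
    exact 𝒜.V.mul_comp l r _

theorem mem_range_inv {S : TAlg (const G F)} (U : (FP G F).obj (algAct 𝒜) ⟶ S) :
    (toPt 𝒜 S U)⁻¹ ∈ Set.range (toPt 𝒜 S) := by
  let i : 𝒜.V.alg ⟶ (algAct 𝒜).V := 𝟙 𝒜.V.alg
  refine ⟨(FP G F).map (actHom (𝒜 := 𝒜) i⁻¹ fun g => ?_) ≫ U, ?_⟩
  · rw [rep_comp_inv, 𝒜.V.inv_comp]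
    exact congrArg (·⁻¹) ((Category.comp_id _).trans (Category.id_comp _).symm)
  · rw [toPt_precomp]
    exact (𝒜.V.inv_comp i _).trans (congrArg (·⁻¹) (Category.id_comp _))

theorem mem_range_one (S : TAlg (const G F)) :
    (1 : 𝒜.V.alg ⟶ ((evAlg G F).obj S).V) ∈ Set.range (toPt 𝒜 S) := by
  let e : 𝒜.V.alg ⟶ (fnAction F (point G)).V := 1
  refine ⟨(FP G F).map (actHom (𝒜 := 𝒜) e fun g => ?_) ≫ (Splitting.isPoint_one S).desc, ?_⟩
  · exact (rep_comp_one _ _).trans (𝒜.V.one_comp _).symm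
  · rw [toPt_precomp]
    exact 𝒜.V.one_comp _

/-- The subgroup of the points of a group scheme with `G`-action which come from maps out
of `FP(A)`. -/
def rangePt (σ : Splitting (algAct 𝒜)) (S : TAlg (const G F)) :
    Subgroup (𝒜.V.alg ⟶ ((evAlg G F).obj S).V) where
  carrier := Set.range (toPt 𝒜 S)
  mul_mem' := by
    rintro _ _ ⟨U, rfl⟩ ⟨V, rfl⟩
    exact mem_range_mul σ U V
  one_mem' := mem_range_one S
  inv_mem' := by
    rintro _ ⟨U, rfl⟩
    exact mem_range_inv U

/-- The points of `FP(A)` as a subgroup of the points of `A`. -/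
noncomputable def ptEquiv (σ : Splitting (algAct 𝒜)) (S : TAlg (const G F)) :
    ((FP G F).obj (algAct 𝒜) ⟶ S) ≃ rangePt σ S :=
  Equiv.ofInjective _ (toPt_injective σ S)

theorem toPt_ptEquiv_mul (σ : Splitting (algAct 𝒜)) (S : TAlg (const G F))
    (U V : (FP G F).obj (algAct 𝒜) ⟶ S) :
    toPt 𝒜 S ((ptEquiv σ S).group.mul U V) = toPt 𝒜 S U * toPt 𝒜 S V :=
  congrArg Subtype.val ((ptEquiv σ S).apply_symm_apply (ptEquiv σ S U * ptEquiv σ S V))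

/-- The group scheme represented by `FP(A)`, for a group scheme with `G`-action represented
by a split algebra `A`. -/
noncomputable def fpGrp (σ : Splitting (algAct 𝒜)) : GrpSch (TAlg (const G F)) where
  alg := (FP G F).obj (algAct 𝒜)
  grp S := (ptEquiv σ S).group
  mul_comp {S T} U V f := by
    apply toPt_injective σ T
    refine Eq.trans ?_ (toPt_ptEquiv_mul σ T (U ≫ f) (V ≫ f)).symm
    rw [toPt_comp, toPt_comp, toPt_comp, ← 𝒜.V.mul_comp]
    exact congrArg (· ≫ _) (toPt_ptEquiv_mul σ S U V)

theorem toPt_mul (σ : Splitting (algAct 𝒜)) {S : TAlg (const G F)} (U V : (fpGrp σ).alg ⟶ S) :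
    toPt 𝒜 S (U * V) = toPt 𝒜 S U * toPt 𝒜 S V :=
  toPt_ptEquiv_mul σ S U V

/-- The equivariant map of algebras representing an equivariant morphism of group schemes. -/
abbrev repAlg {ℬ : Action (GrpSch (CommAlgCat.{u} F)) G} (α : 𝒜 ⟶ ℬ) : algAct ℬ ⟶ algAct 𝒜 :=
  ((repActionFunctor _ G).map α).unop

theorem toPt_repAlg {ℬ : Action (GrpSch (CommAlgCat.{u} F)) G} (α : 𝒜 ⟶ ℬ) {S : TAlg (const G F)}
    (U : (FP G F).obj (algAct 𝒜) ⟶ S) :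
    toPt ℬ S ((FP G F).map (repAlg α) ≫ U) = rep α.hom ≫ toPt 𝒜 S U :=
  toPt_precomp ℬ (repAlg α) U

theorem map_repAlg_comp_mul {ℬ : Action (GrpSch (CommAlgCat.{u} F)) G}
    (σ : Splitting (algAct 𝒜)) (τ : Splitting (algAct ℬ)) (α : 𝒜 ⟶ ℬ) {S : TAlg (const G F)}
    (U V : (fpGrp σ).alg ⟶ S) :
    (show (fpGrp τ).alg ⟶ S from (FP G F).map (repAlg α) ≫ (U * V)) =
      (show (fpGrp τ).alg ⟶ S from (FP G F).map (repAlg α) ≫ U) *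
        (show (fpGrp τ).alg ⟶ S from (FP G F).map (repAlg α) ≫ V) := by
  apply toPt_injective τ S
  refine Eq.trans ?_ (toPt_mul τ _ _).symm
  refine (toPt_repAlg α (U * V)).trans ?_
  rw [toPt_mul, rep_comp_mul]
  exact congrArg₂ (· * ·) (toPt_repAlg α U).symm (toPt_repAlg α V).symm

/-- The morphism of group schemes represented by the map `FP(B) → FP(A)` induced by an equivariant
morphism of group schemes. -/
noncomputable def fpGrpMap {ℬ : Action (GrpSch (CommAlgCat.{u} F)) G} (σ : Splitting (algAct 𝒜))
    (τ : Splitting (algAct ℬ)) (α : 𝒜 ⟶ ℬ) : fpGrp σ ⟶ fpGrp τ :=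
  GrpSch.ofRep (𝒢 := fpGrp σ) (ℋ := fpGrp τ) ((FP G F).map (repAlg α)) fun _ U V =>
    map_repAlg_comp_mul σ τ α U V

theorem rep_fpGrpMap {ℬ : Action (GrpSch (CommAlgCat.{u} F)) G} (σ : Splitting (algAct 𝒜))
    (τ : Splitting (algAct ℬ)) (α : 𝒜 ⟶ ℬ) :
    rep (fpGrpMap σ τ α) = (FP G F).map (repAlg α) :=
  rep_ofRep _ _

theorem toBottom_comp_mul (σ : Splitting (algAct 𝒜)) {S : CommAlgCat.{u} F}
    (a b : (evGrpObj (fpGrp σ)).alg ⟶ S) :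
    (show 𝒜.V.alg ⟶ S from (toBottom (algAct 𝒜)).hom.hom ≫ (a * b)) =
      (show 𝒜.V.alg ⟶ S from (toBottom (algAct 𝒜)).hom.hom ≫ a) *
        (show 𝒜.V.alg ⟶ S from (toBottom (algAct 𝒜)).hom.hom ≫ b) := by
  let ev : ((evAlg G F).obj ((coindAlg G F).obj S)).V ⟶ S := CommAlgCat.ofHom
    { toFun := fun φ : G → S => φ 1
      map_one' := rfl
      map_mul' := fun _ _ => rfl
      map_zero' := rfl
      map_add' := fun _ _ => rfl
      commutes' := fun _ => rfl }
  have key : ∀ c : (evGrpObj (fpGrp σ)).alg ⟶ S,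
      (show 𝒜.V.alg ⟶ S from (toBottom (algAct 𝒜)).hom.hom ≫ c) =
        toPt 𝒜 _ (adjunct (fpGrp σ).alg S c) ≫ ev := fun c =>
    CommAlgCat.hom_ext (AlgHom.ext fun x => congrArg c.hom
      (res_orb_one (fpGrp σ).alg.right _).symm)
  rw [key, key, key, adjunct_mul, toPt_mul, 𝒜.V.mul_comp]

/-- The isomorphism `ev_{G/e} J(𝒜) ≅ 𝒜` of group schemes. -/
noncomputable def counitIso (σ : Splitting (algAct 𝒜)) : evGrpObj (fpGrp σ) ≅ 𝒜.V :=
  isoOfRep (𝒢 := evGrpObj (fpGrp σ)) (ℋ := 𝒜.V)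
    ((Action.forget _ _).mapIso (toBottom (algAct 𝒜))) fun _ a b => toBottom_comp_mul σ a b

theorem rep_counitIso (σ : Splitting (algAct 𝒜)) :
    rep (counitIso σ).hom = (toBottom (algAct 𝒜)).hom.hom :=
  rep_ofRep _ _

end FixedPointGroup

end Tamb

namespace Tamb

open CategoryTheory GrpSch

section Unit

variable {G : Type u} [Group G] [Finite G] {F : Type u} [CommRing F]

/-- The map `R → FP(R(G/e))`. -/
noncomputable def toFP (R : TAlg (const G F)) : R ⟶ (FP G F).obj ((evAlg G F).obj R) :=
  let u := adjunct R ((evAlg G F).obj R).V (𝟙 _)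
  Under.homMk
    { app := fun X => RingHom.codRestrict (u.right.app X)
        (equivariantFunctions (ringAction ((evAlg G F).obj R)) X) fun a g x => by
          change R.right.res (orb (g • x)) a =
            R.right.res (orb (X := free G) g) (R.right.res (orb x) a)
          rw [← R.right.res_comp, comp_orb]
          rfl
      res := fun f a => Subtype.ext (u.right.res f a)
      tr := fun f a => Subtype.ext (u.right.tr f a)
      nm := fun f a => Subtype.ext (u.right.nm f a) }
    (TambaraFunctor.hom_ext fun X c => Subtype.ext (TAlg.hom_app_const u X c))

theorem toFP_bijective {R : TAlg (const G F)} (hR : R.IsFlat) (X : FinGSet G) :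
    Function.Bijective ((toFP R).right.app X) := by
  constructor
  · intro a b h
    exact Flat.ext_orb hR fun x => congrFun (congrArg Subtype.val h) x
  · intro φ
    obtain ⟨m, hm⟩ := Flat.exists_glue hR φ.1 fun g x => φ.2 g x
    exact ⟨m, Subtype.ext (funext hm)⟩

theorem toFP_naturality {R S : TAlg (const G F)} (f : R ⟶ S) :
    f ≫ toFP S = toFP R ≫ (FP G F).map ((evAlg G F).map f) :=
  Under.UnderMorphism.ext (TambaraFunctor.hom_ext fun _ a => Subtype.ext (funext fun x =>
    (f.right.res (orb x) a).symm))

theorem map_toFP (R : TAlg (const G F)) :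
    (evAlg G F).map (toFP R) = (toBottom ((evAlg G F).obj R)).hom := rfl

theorem map_comp_mul (𝒢 : GrpSch (TAlg (const G F))) {S : TAlg (const G F)} (a b : 𝒢.alg ⟶ S) :
    (show (evGrpObj 𝒢).alg ⟶ ((evAlg G F).obj S).V from ((evAlg G F).map (a * b)).hom) =
      (show (evGrpObj 𝒢).alg ⟶ ((evAlg G F).obj S).V from ((evAlg G F).map a).hom) *
        (show (evGrpObj 𝒢).alg ⟶ ((evAlg G F).obj S).V from ((evAlg G F).map b).hom) := by
  apply (adjunct 𝒢.alg _).injective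
  refine Eq.trans ?_ (adjunct_mul 𝒢 _ _).symm
  have key : ∀ c : 𝒢.alg ⟶ S, adjunct 𝒢.alg ((evAlg G F).obj S).V ((evAlg G F).map c).hom =
      c ≫ adjunct S ((evAlg G F).obj S).V (𝟙 _) := fun c =>
    (congrArg (adjunct 𝒢.alg _) (Category.comp_id _).symm).trans (adjunct_precomp c (𝟙 _))
  refine (key (a * b)).trans ((𝒢.mul_comp a b _).trans ?_)
  exact congrArg₂ (· * ·) (key a).symm (key b).symm

/-- The algebra with `G`-action representing `ev_{G/e} 𝒢`. -/
noncomputable def evGrpAlgIso (𝒢 : GrpSch (TAlg (const G F))) :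
    (evAlg G F).obj 𝒢.alg ≅ algAct ((evGrp G F).obj 𝒢) :=
  Action.mkIso (Iso.refl _) fun g => by
    have h : (algAct ((evGrp G F).obj 𝒢)).ρ g = ((evAlg G F).obj 𝒢.alg).ρ g :=
      (rep_evGrpAct 𝒢 g⁻¹).trans (by rw [inv_inv])
    refine (Category.comp_id _).trans (h.symm.trans (Category.id_comp _).symm)

/-- The map from the algebra of `𝒢` to the algebra of `J (ev_{G/e} 𝒢)`. -/
noncomputable def unitRep (𝒢 : GrpSch (TAlg (const G F))) :
    𝒢.alg ⟶ (FP G F).obj (algAct ((evGrp G F).obj 𝒢)) :=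
  toFP 𝒢.alg ≫ (FP G F).map (evGrpAlgIso 𝒢).hom

theorem toPt_unitRep (𝒢 : GrpSch (TAlg (const G F))) {S : TAlg (const G F)}
    (U : (FP G F).obj (algAct ((evGrp G F).obj 𝒢)) ⟶ S) :
    toPt ((evGrp G F).obj 𝒢) S U = ((evAlg G F).map (unitRep 𝒢 ≫ U)).hom := by
  have h : (evGrpAlgIso 𝒢).hom ≫ bottomPt U = (evAlg G F).map (unitRep 𝒢 ≫ U) := by
    rw [unitRep, CategoryTheory.Functor.map_comp, CategoryTheory.Functor.map_comp, map_toFP,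
      ← toBottom_naturality, bottomPt, Category.assoc]
  exact (Category.id_comp _).symm.trans (congrArg Action.Hom.hom h)

theorem exists_unitRep_iso (𝒢 : GrpSch (TAlg (const G F))) (h : 𝒢.alg.IsFlat) :
    ∃ c : 𝒢.alg ≅ (FP G F).obj (algAct ((evGrp G F).obj 𝒢)), c.hom = unitRep 𝒢 := by
  obtain ⟨c, hc⟩ := TAlg.exists_iso (toFP 𝒢.alg) (toFP_bijective h)
  exact ⟨c ≪≫ (FP G F).mapIso (evGrpAlgIso 𝒢), congrArg (· ≫ _) hc⟩

theorem unitRep_comp_mul (𝒢 : GrpSch (TAlg (const G F)))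
    (σ : Splitting (algAct ((evGrp G F).obj 𝒢)))
    (c : 𝒢.alg ≅ (FP G F).obj (algAct ((evGrp G F).obj 𝒢))) (hc : c.hom = unitRep 𝒢)
    {S : TAlg (const G F)} (a b : 𝒢.alg ⟶ S) :
    (show (fpGrp σ).alg ⟶ S from c.inv ≫ (a * b)) =
      (show (fpGrp σ).alg ⟶ S from c.inv ≫ a) * (show (fpGrp σ).alg ⟶ S from c.inv ≫ b) := by
  apply toPt_injective σ S
  refine Eq.trans ?_ (toPt_mul σ _ _).symm
  have key : ∀ a : 𝒢.alg ⟶ S, toPt ((evGrp G F).obj 𝒢) S (c.inv ≫ a) =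
      ((evAlg G F).map a).hom := fun a => by
    rw [toPt_unitRep, ← hc, Iso.hom_inv_id_assoc]
  exact (key (a * b)).trans ((map_comp_mul 𝒢 a b).trans (congrArg₂ (· * ·) (key a).symm (key b).symm))

/-- The isomorphism `𝒢 ≅ J (ev_{G/e} 𝒢)`, for a flat group scheme. -/
noncomputable def unitIso (𝒢 : GrpSch (TAlg (const G F))) (h : 𝒢.alg.IsFlat)
    (σ : Splitting (algAct ((evGrp G F).obj 𝒢))) : 𝒢 ≅ fpGrp σ :=
  isoOfRep (𝒢 := 𝒢) (ℋ := fpGrp σ) (exists_unitRep_iso 𝒢 h).choose.symm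
    fun _ a b => unitRep_comp_mul 𝒢 σ _ (exists_unitRep_iso 𝒢 h).choose_spec a b

theorem rep_unitIso_inv (𝒢 : GrpSch (TAlg (const G F))) (h : 𝒢.alg.IsFlat)
    (σ : Splitting (algAct ((evGrp G F).obj 𝒢))) : rep (unitIso 𝒢 h σ).inv = unitRep 𝒢 :=
  (rep_ofRep _ _).trans (exists_unitRep_iso 𝒢 h).choose_spec

theorem unitIso_inv_naturality {𝒢 ℋ : GrpSch (TAlg (const G F))} (h : 𝒢.alg.IsFlat)
    (h' : ℋ.alg.IsFlat) (σ : Splitting (algAct ((evGrp G F).obj 𝒢)))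
    (τ : Splitting (algAct ((evGrp G F).obj ℋ))) (α : 𝒢 ⟶ ℋ) :
    fpGrpMap σ τ ((evGrp G F).map α) ≫ (unitIso ℋ h' τ).inv = (unitIso 𝒢 h σ).inv ≫ α := by
  apply hom_ext_rep
  rw [rep_comp, rep_comp, rep_unitIso_inv, rep_unitIso_inv, rep_fpGrpMap]
  have hn : (evGrpAlgIso ℋ).hom ≫ repAlg ((evGrp G F).map α) =
      (evAlg G F).map (rep α) ≫ (evGrpAlgIso 𝒢).hom :=
    Action.hom_ext _ _ ((Category.id_comp _).trans
      ((rep_evGrpMap α).trans (Category.comp_id _).symm))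
  change (toFP ℋ.alg ≫ (FP G F).map _) ≫ (FP G F).map _ = rep α ≫ toFP 𝒢.alg ≫ (FP G F).map _
  rw [Category.assoc, ← CategoryTheory.Functor.map_comp, hn, CategoryTheory.Functor.map_comp,
    ← Category.assoc, ← toFP_naturality, Category.assoc]

theorem counitIso_comm {𝒜 : Action (GrpSch (CommAlgCat.{u} F)) G} (σ : Splitting (algAct 𝒜))
    (g : G) : evGrpAct (fpGrp σ) g ≫ (counitIso σ).hom = (counitIso σ).hom ≫ 𝒜.ρ g := by
  apply hom_ext_rep
  rw [rep_comp, rep_comp, rep_counitIso, rep_evGrpAct]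
  have h : (algAct 𝒜).ρ g⁻¹ = rep (𝒜.ρ g) := by
    change rep (𝒜.ρ g⁻¹⁻¹) = _
    rw [inv_inv]
  exact ((toBottom (algAct 𝒜)).hom.comm g⁻¹).symm.trans (congrArg (· ≫ _) h)

theorem counitIso_naturality {𝒜 ℬ : Action (GrpSch (CommAlgCat.{u} F)) G}
    (σ : Splitting (algAct 𝒜)) (τ : Splitting (algAct ℬ)) (α : 𝒜 ⟶ ℬ) :
    evGrpMap (fpGrpMap σ τ α) ≫ (counitIso τ).hom = (counitIso σ).hom ≫ α.hom := by
  apply hom_ext_rep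
  rw [rep_comp, rep_comp, rep_counitIso, rep_counitIso, rep_evGrpMap, rep_fpGrpMap]
  exact (congrArg Action.Hom.hom (toBottom_naturality (repAlg α))).symm

theorem fpGrpMap_id {𝒜 : Action (GrpSch (CommAlgCat.{u} F)) G} (σ : Splitting (algAct 𝒜)) :
    fpGrpMap σ σ (𝟙 𝒜) = 𝟙 (fpGrp σ) :=
  hom_ext_rep (rep_fpGrpMap σ σ (𝟙 𝒜))

theorem fpGrpMap_comp {𝒜 ℬ 𝒞 : Action (GrpSch (CommAlgCat.{u} F)) G} (σ : Splitting (algAct 𝒜))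
    (τ : Splitting (algAct ℬ)) (υ : Splitting (algAct 𝒞)) (α : 𝒜 ⟶ ℬ) (β : ℬ ⟶ 𝒞) :
    fpGrpMap σ υ (α ≫ β) = fpGrpMap σ τ α ≫ fpGrpMap τ υ β := by
  apply hom_ext_rep
  have h : repAlg (α ≫ β) = repAlg β ≫ repAlg α :=
    congrArg Quiver.Hom.unop ((repActionFunctor _ G).map_comp α β)
  rw [rep_comp, rep_fpGrpMap, rep_fpGrpMap, rep_fpGrpMap, h]
  exact (FP G F).map_comp _ _

end Unit

section Equivalence

variable {G : Type u} [Group G] [Finite G] {F : Type u} [Field F] [IsAlgClosed F]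

theorem evPreservesFinEt (G : Type u) [Group G] [Finite G] (F : Type u) [Field F] :
    EvPreservesFinEt G F := fun _ h => finEt_bottom h.1 h.2

/-- The group scheme with `G`-action underlying a finite étale one. -/
abbrev toAct (𝒜 : Action (FinEtGrp F) G) : Action (GrpSch (CommAlgCat.{u} F)) G :=
  ((finEt F).ι.mapAction G).obj 𝒜

/-- A splitting of the algebra of a finite étale group scheme. -/
noncomputable def finEtSplitting (𝒜 : Action (FinEtGrp F) G) : Splitting (algAct (toAct 𝒜)) :=
  haveI : Module.Finite F (algAct (toAct 𝒜)).V := 𝒜.V.property.1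
  haveI : Algebra.Etale F (algAct (toAct 𝒜)).V := 𝒜.V.property.2
  (exists_splitting (algAct (toAct 𝒜))).some

/-- The inverse of `ev_{G/e}`. -/
noncomputable def fpFinEt (G : Type u) [Group G] [Finite G] (F : Type u) [Field F]
    [IsAlgClosed F] : Action (FinEtGrp F) G ⥤ FinEtGrpTamb (const G F) where
  obj 𝒜 := ⟨fpGrp (finEtSplitting 𝒜), (finEtSplitting 𝒜).isFinite, (finEtSplitting 𝒜).isEtale⟩
  map {𝒜 ℬ} α := ObjectProperty.homMk (fpGrpMap (finEtSplitting 𝒜) (finEtSplitting ℬ)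
    (((finEt F).ι.mapAction G).map α))
  map_id 𝒜 := ObjectProperty.hom_ext _ ((congrArg (fpGrpMap _ _)
    (((finEt F).ι.mapAction G).map_id 𝒜)).trans (fpGrpMap_id (finEtSplitting 𝒜)))
  map_comp {𝒜 ℬ 𝒞} α β := ObjectProperty.hom_ext _ ((congrArg (fpGrpMap _ _)
    (((finEt F).ι.mapAction G).map_comp α β)).trans (fpGrpMap_comp (finEtSplitting 𝒜)
      (finEtSplitting ℬ) (finEtSplitting 𝒞) _ _))

/-- The unit of the equivalence. -/
noncomputable def finEtUnit (h : EvPreservesFinEt G F) :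
    𝟭 (FinEtGrpTamb (const G F)) ≅ evFinEt h ⋙ fpFinEt G F :=
  Iso.symm <| NatIso.ofComponents
    (fun 𝒢 => ObjectProperty.isoMk _
      (unitIso 𝒢.obj 𝒢.property.2.1.1 (finEtSplitting ((evFinEt h).obj 𝒢))).symm)
    fun {𝒢 ℋ} α => ObjectProperty.hom_ext _ (unitIso_inv_naturality 𝒢.property.2.1.1
      ℋ.property.2.1.1 (finEtSplitting ((evFinEt h).obj 𝒢))
      (finEtSplitting ((evFinEt h).obj ℋ)) α.hom)

/-- The counit of the equivalence. -/
noncomputable def finEtCounit (h : EvPreservesFinEt G F) :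
    fpFinEt G F ⋙ evFinEt h ≅ 𝟭 (Action (FinEtGrp F) G) :=
  NatIso.ofComponents
    (fun 𝒜 => Action.mkIso (ObjectProperty.isoMk _ (counitIso (finEtSplitting 𝒜)))
      fun g => ObjectProperty.hom_ext _ (counitIso_comm (finEtSplitting 𝒜) g))
    fun {𝒜 ℬ} α => Action.hom_ext _ _ (ObjectProperty.hom_ext _ (counitIso_naturality
      (finEtSplitting 𝒜) (finEtSplitting ℬ) (((finEt F).ι.mapAction G).map α)))

/-- The algebra representing `J 𝒜` is `FP(A)`. -/
noncomputable def fpFinEtRep (G : Type u) [Group G] [Finite G] (F : Type u) [Field F]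
    [IsAlgClosed F] : fpFinEt G F ⋙ repTamb (const G F) ≅ repAct G F ⋙ (FP G F).op :=
  NatIso.ofComponents (fun 𝒜 => Iso.refl (Opposite.op
    ((FP G F).obj (GrpSch.algAct (toAct 𝒜))))) fun {𝒜 ℬ} α => by
      have h := rep_fpGrpMap (finEtSplitting 𝒜) (finEtSplitting ℬ)
        (((finEt F).ι.mapAction G).map α)
      exact (Category.comp_id _).trans ((congrArg Quiver.Hom.op h).trans
        (Category.id_comp _).symm)

end Equivalence

end Tamb
theorem mainTheorem2 (G : Type u) [Group G] [Finite G] (F : Type u) [Field F]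
    [IsAlgClosed F] :
    ∃ h : EvPreservesFinEt G F, (evFinEt h).IsEquivalence ∧
      ∃ (J : Action (FinEtGrp F) G ⥤ FinEtGrpTamb (const G F))
        (_ : 𝟭 (FinEtGrpTamb (const G F)) ≅ evFinEt h ⋙ J)
        (ε : J ⋙ evFinEt h ≅ 𝟭 (Action (FinEtGrp F) G))
        (θ : J ⋙ repTamb (const G F) ≅ repAct G F ⋙ (FP G F).op),
        ∀ (𝒜 : Action (FinEtGrp F) G)
          (φ : ((FP G F).obj ((repAct G F).obj 𝒜).unop).right.obj (free G)),
          (θ.hom.app 𝒜).unop.right.app (free G) φ =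
            ((repAct G F).map (ε.hom.app 𝒜)).unop.hom.hom (φ.1 (1 : G)) := by
  let h := evPreservesFinEt G F
  refine ⟨h, (CategoryTheory.Equivalence.mk (evFinEt h) (fpFinEt G F) (finEtUnit h)
    (finEtCounit h)).isEquivalence_functor, fpFinEt G F, finEtUnit h, finEtCounit h,
    fpFinEtRep G F, fun 𝒜 φ => ?_⟩
  refine (toBottom_inv_apply (GrpSch.algAct (toAct 𝒜)) φ).symm.trans ?_
  exact congrArg (fun v => v.hom (φ.1 (1 : G))) (rep_counitIso (finEtSplitting 𝒜)).symm
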